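/- All matroids and hypergraphs are finite. A hypergraph $(V,E)$ is an interval hypergraph if there is a bijection $V\to\{1,\dots,|V|\}$ sending every edge to an interval $[i,j]$ with $i\le j$. A matroid of rank $r$ is paving if each of its circuits has at least $r$ elements; its clutter is the hypergraph on its ground set whose edges are its dependent hyperplanes. A $d$-paving clutter is the clutter of some paving matroid of rank $d$. A relaxation of a paving matroid $M$ is a paving matroid of the same rank on the same ground set whose dependent hyperplanes form a subset of those of $M$; equivalently, a partial clutter (same vertices, a subset of the edges) of the clutter of $M$. A matroid of rank $r$ on $[n]=\{1,\dots,n\}$ is an ordered interval positroid if its matroid polytope (the convex hull of the indicator vectors of its bases) is the subset of the hypersimplex $\Delta_{r,n}=\{x\in[0,1]^n:\sum_i x_i=r\}$ determined by some family of inequalities of the form $x_i+x_{i+1}+\cdots+x_j\le k$ with $i\le j$; an interval positroid is a matroid isomorphic to an ordered interval positroid. An excluded minor of interval positroids is a matroid that is not an interval positroid but all of whose proper minors are. **Theorem.** Let $M$ be a paving matroid of rank $d\ge 3$ that is an excluded minor of interval positroids. Then some relaxation of $M$, or equivalently some partial clutter of the clutter of $M$, is a non-interval clutter of one of the following three types.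 1. $O_{a_1,\dots,a_m;d}$, where $m\ge 3$ and $1\le a_1,\dots,a_m\le d-2$ are integers such that no index $i$ modulo $m$ satisfies both $a_i+a_{i+1}>d$ and $a_{i+1}+a_{i+2}>d$: a $d$-paving clutter with exactly $m$ edges $A_1,\dots,A_m$ (indices modulo $m$) such that (a) every vertex lies in some edge; (b) every vertex lies in at most two edges; (c) $|A_i\cap A_{i+1}|=a_i$ for all $i$, and $A_i\cap A_j=\emptyset$ whenever $j\not\equiv i,\,i\pm1 \pmod m$; (d) each vertex in an edge of cardinality greater than $d$ also lies in another edge, of cardinality $d$. 2. $Y_{a,b;d}$, where $0\le a,b\le d-3$ are integers: a $d$-paving clutter with exactly three edges $A,B,C$ such that (a) every vertex lies in some edge; (b) $|A|=|B|=d$, $|C|\ge d$, $|(A\cap C)\setminus B|=a$, $|(C\cap B)\setminus A|=b$, $|(A\cap B)\setminus C|=0$, $|C\setminus(A\cup B)|>0$ and $|A\cap B\cap C|=1$; (c) $|C|>d$ only if $|C\setminus(A\cup B)|=1$. 3. $\mathrm{Sh}_{a,b,c;d}$, where $1\le a,b,c\le d-2$ are integers: a $d$-paving clutter with exactly four edges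 $A,B,C,D$ such that (a) every vertex lies in some edge; (b) $|A|=|B|=|C|=d$, $|D|\ge d$, $|A\cap D|=a$, $|B\cap D|=b$, $|C\cap D|=c$; (c) $A,B,C$ are pairwise disjoint; (d) $|D|>d$ only if $a+b+c=|D|$. -/

import Mathlib

namespace PavingIP

/-! ### Hypergraphs -/

/-- `H'` is a partial hypergraph of `H`: same vertices, and its edges are among the edges of `H`. -/
def IsPartialHypergraph {α : Type*} (H' H : Hypergraph α) : Prop :=
  H'.vertexSet = H.vertexSet ∧ H'.edgeSet ⊆ H.edgeSet

/-- A hypergraph on `n` vertices is an interval hypergraph if its vertices can be put in bijection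
with `{1, …, n}` (here `Fin n`) so that every edge corresponds to an interval `[i, j]`, `i ≤ j`. -/
def IsIntervalHypergraph {α : Type*} (H : Hypergraph α) : Prop :=
  ∃ (n : ℕ) (f : Fin n → α), Set.BijOn f Set.univ H.vertexSet ∧
    ∀ e ∈ H.edgeSet, ∃ i j : Fin n, i ≤ j ∧ e = f '' Set.Icc i j

/-- No vertex is isolated: every vertex lies in some edge. -/
def NoIsolatedVertex {α : Type*} (H : Hypergraph α) : Prop :=
  ∀ v ∈ H.vertexSet, ∃ e ∈ H.edgeSet, v ∈ e

/-! ### Paving matroids and their clutters of dependent hyperplanes -/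

/-- A matroid is paving if each of its circuits has at least `rank` elements. -/
def IsPaving {α : Type*} (M : Matroid α) : Prop :=
  ∀ C, M.IsCircuit C → M.eRank ≤ C.encard

/-- A hyperplane of a (finite) matroid is a flat whose rank is one less than that of the matroid. -/
def IsHyperplane {α : Type*} (M : Matroid α) (H : Set α) : Prop :=
  M.IsFlat H ∧ M.eRk H + 1 = M.eRank

/-- The hypergraph on the ground set of `M` whose edges are the dependent hyperplanes of `M`. -/
def clutter {α : Type*} (M : Matroid α) : Hypergraph α where
  vertexSet := M.E
  edgeSet := {H | IsHyperplane M H ∧ M.Dep H}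
  subset_vertexSet_of_mem_edgeSet' := fun _ he => he.2.subset_ground

/-- A `d`-paving clutter is the clutter of some (finite) paving matroid of rank `d`. -/
def IsPavingClutter {α : Type*} (d : ℕ) (H : Hypergraph α) : Prop :=
  ∃ N : Matroid α, N.Finite ∧ IsPaving N ∧ N.eRank = d ∧ clutter N = H

/-- `N` is a relaxation of the paving matroid `M`: a paving matroid of the same rank on the same
ground set, whose dependent hyperplanes are obtained from those of `M` by removing some
(possibly none) of them. -/
def IsRelaxation {α : Type*} (N M : Matroid α) : Prop :=
  IsPaving N ∧ N.eRank = M.eRank ∧ IsPartialHypergraph (clutter N) (clutter M)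

/-! ### Interval positroids -/

/-- The matroid polytope: the convex hull of the indicator vectors of the bases. -/
noncomputable def matroidPolytope {n : ℕ} (N : Matroid (Fin n)) : Set (Fin n → ℝ) :=
  convexHull ℝ {x | ∃ B, N.IsBase B ∧ x = B.indicator 1}

/-- The hypersimplex `Δ_{d,n}`. -/
def hypersimplex (d n : ℕ) : Set (Fin n → ℝ) :=
  {x | (∀ i, 0 ≤ x i ∧ x i ≤ 1) ∧ ∑ i, x i = d}

/-- A matroid of rank `d` on the ordered set `{1, …, n}` is an ordered interval positroid if its
polytope is cut out of `Δ_{d,n}` by a family of inequalities `x_i + x_{i+1} + ⋯ + x_j ≤ k`. -/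
def IsOrderedIntervalPositroid {n : ℕ} (N : Matroid (Fin n)) : Prop :=
  N.E = Set.univ ∧ ∃ (d : ℕ) (S : Set (Fin n × Fin n × ℝ)), N.eRank = d ∧
    (∀ p ∈ S, p.1 ≤ p.2.1) ∧
    matroidPolytope N =
      {x | x ∈ hypersimplex d n ∧ ∀ p ∈ S, ∑ l ∈ Finset.Icc p.1 p.2.1, x l ≤ p.2.2}

/-- An interval positroid is a matroid isomorphic to an ordered interval positroid. -/
def IsIntervalPositroid {α : Type*} (M : Matroid α) : Prop :=
  ∃ (n : ℕ) (N : Matroid (Fin n)) (f : Fin n ↪ α),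
    IsOrderedIntervalPositroid N ∧ N.mapEmbedding f = M

/-- `M` is an excluded minor of the class `P`: it is not in `P`, but all its proper minors are. -/
def IsExcludedMinor {α : Type*} (P : Matroid α → Prop) (M : Matroid α) : Prop :=
  ¬ P M ∧ ∀ N, Matroid.IsStrictMinor N M → P N

/-! ### The three families -/

/-- `H` is a cycle `O_{a_1, …, a_m; d}`. The indices live in `ZMod m`, that is, modulo `m`. -/
structure IsO {α : Type*} (m : ℕ) (a : ZMod m → ℕ) (d : ℕ) (H : Hypergraph α) : Prop where
  three_le : 3 ≤ m
  one_le : ∀ i, 1 ≤ a i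
  add_two_le : ∀ i, a i + 2 ≤ d
  no_three : ¬ ∃ i, d < a i + a (i + 1) ∧ d < a (i + 1) + a (i + 2)
  paving : IsPavingClutter d H
  noIsolated : NoIsolatedVertex H
  at_most_two : ∀ v ∈ H.vertexSet, {e ∈ H.edgeSet | v ∈ e}.encard ≤ 2
  edges : ∃ A : ZMod m → Set α, Function.Injective A ∧ H.edgeSet = Set.range A ∧
    (∀ i, (A i ∩ A (i + 1)).encard = a i) ∧
    (∀ i j, j ≠ i → j ≠ i + 1 → i ≠ j + 1 → Disjoint (A i) (A j)) ∧
    (∀ i, (d : ℕ∞) < (A i).encard → ∀ v ∈ A i, ∃ j, j ≠ i ∧ v ∈ A j ∧ (A j).encard = d)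

/-- `H` is a clutter `Y_{a,b;d}`. -/
structure IsY {α : Type*} (a b d : ℕ) (H : Hypergraph α) : Prop where
  a_le : a + 3 ≤ d
  b_le : b + 3 ≤ d
  paving : IsPavingClutter d H
  noIsolated : NoIsolatedVertex H
  edges : ∃ A B C : Set α, A ≠ B ∧ A ≠ C ∧ B ≠ C ∧ H.edgeSet = {A, B, C} ∧
    A.encard = d ∧ B.encard = d ∧ (d : ℕ∞) ≤ C.encard ∧
    ((A ∩ C) \ B).encard = a ∧ ((C ∩ B) \ A).encard = b ∧ ((A ∩ B) \ C).encard = 0 ∧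
    0 < (C \ (A ∪ B)).encard ∧ (A ∩ B ∩ C).encard = 1 ∧
    ((d : ℕ∞) < C.encard → (C \ (A ∪ B)).encard = 1)

/-- `H` is a clutter `Sh_{a,b,c;d}`. -/
structure IsSh {α : Type*} (a b c d : ℕ) (H : Hypergraph α) : Prop where
  a_bounds : 1 ≤ a ∧ a + 2 ≤ d
  b_bounds : 1 ≤ b ∧ b + 2 ≤ d
  c_bounds : 1 ≤ c ∧ c + 2 ≤ d
  paving : IsPavingClutter d H
  noIsolated : NoIsolatedVertex H
  edges : ∃ A B C D : Set α, A ≠ B ∧ A ≠ C ∧ A ≠ D ∧ B ≠ C ∧ B ≠ D ∧ C ≠ D ∧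
    H.edgeSet = {A, B, C, D} ∧
    A.encard = d ∧ B.encard = d ∧ C.encard = d ∧ (d : ℕ∞) ≤ D.encard ∧
    (A ∩ D).encard = a ∧ (B ∩ D).encard = b ∧ (C ∩ D).encard = c ∧
    Disjoint A B ∧ Disjoint B C ∧ Disjoint A C ∧
    ((d : ℕ∞) < D.encard → ((a + b + c : ℕ) : ℕ∞) = D.encard)

end PavingIP

/-! Distinct dependent hyperplanes of a paving matroid of rank d share at most d - 2 points, so they
form an antichain. An antichain of nonempty sets is an interval hypergraph exactly when it is
`Orderable`: it has a linear order in which A before B before C implies A ∩ C ⊆ B, and B ⊆ A ∪ C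
whenever A and C meet. This turns the theorem into combinatorics of finite set families.

Polytopes enter in two places. The polytope of a paving matroid is cut out of the hypersimplex by
the inequalities x(H) ≤ d - 1 over its dependent hyperplanes H, so an interval clutter gives an
interval positroid (`isIntervalPositroid_of_isIntervalHypergraph`). Conversely, a set that behaves
like a dependent hyperplane in an ordered interval positroid is an interval
(`IsOrderedIntervalPositroid.exists_eq_Icc`). For an excluded minor M the clutter is therefore not
orderable, while the families coming from every contraction M / v and every deletion M \ v are.

Take a minimal non-orderable family F of dependent hyperplanes (`exists_isObstruction`). If F has
three members, they meet pairwise. Without a common point they form a cycle O; with a common point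
v, orderability of the link of v forces the shape Y. If F has at least four members, all its triples
are orderable. A claw gives Sh, and a chordless cycle of length at least four gives O. The remaining
local obstruction, a four-wheel around a common point, is excluded by the link of that point. The
numerical conditions in all three shapes hold because otherwise some point could be deleted without
destroying the obstruction, against orderability of the deletion.

The combinatorial core is `IsClean.orderable`: a family without these configurations, all of whose
one-member deletions are orderable, is orderable. Connectedness lets two members X and Y be removed
so that the rest is a chain of consecutively meeting sets, whose order is unique up to reversal. X
and Y each fit into a slot of the chain, and the excluded configurations are what could prevent
inserting both (`IsClean.orderable_of_fits`).

Finally, F is the family of dependent hyperplanes of a paving matroid in its own right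
(`pavingMatroid`), and this matroid is the required relaxation. -/

namespace PavingIP

open Set

/-! ### Betweenness of sets and orderable families -/

section Orderable

variable {α ι : Type*}

/-- `B` can lie between `A` and `C` in a left-to-right arrangement of intervals none of which
contains another. -/
def Btw (A B C : Set α) : Prop :=
  A ∩ C ⊆ B ∧ ((A ∩ C).Nonempty → B ⊆ A ∪ C)

/-- The sets `Q i`, `i ∈ F`, can be linearly ordered compatibly with betweenness. -/
def Orderable (F : Set ι) (Q : ι → Set α) : Prop :=
  ∃ g : ι → ℤ, InjOn g F ∧ ∀ A ∈ F, ∀ B ∈ F, ∀ C ∈ F, g A < g B → g B < g C →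
    Btw (Q A) (Q B) (Q C)

/-- Two sets meet. -/
def Meets (A B : Set α) : Prop := (A ∩ B).Nonempty

theorem Meets.symm {A B : Set α} (h : Meets A B) : Meets B A := by
  obtain ⟨x, hx⟩ := h
  exact ⟨x, hx.2, hx.1⟩

theorem Btw.symm {A B C : Set α} (h : Btw A B C) : Btw C B A := by
  refine ⟨by rw [inter_comm]; exact h.1, fun h' => ?_⟩
  rw [union_comm]
  rw [inter_comm] at h'
  exact h.2 h'

theorem Btw.of_not_meets {A B C : Set α} (h : ¬ Meets A C) : Btw A B C :=
  ⟨fun x hx => absurd ⟨x, hx⟩ h, fun h' => absurd h' h⟩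

theorem Btw.mem {A B C : Set α} (h : Btw A B C) {x : α} (hA : x ∈ A) (hC : x ∈ C) : x ∈ B :=
  h.1 ⟨hA, hC⟩

theorem Btw.cover {A B C : Set α} (h : Btw A B C) (hm : Meets A C) {x : α} (hB : x ∈ B) :
    x ∈ A ∨ x ∈ C :=
  h.2 hm hB

theorem Orderable.mono {F G : Set ι} {Q : ι → Set α} (h : Orderable F Q) (hG : G ⊆ F) :
    Orderable G Q := by
  obtain ⟨g, hg, h⟩ := h
  exact ⟨g, hg.mono hG, fun A hA B hB C hC => h A (hG hA) B (hG hB) C (hG hC)⟩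

/-- Rigidity of a connected triple. If P were also between Q and R, a point of Q ∩ R would lie in P,
so P and R would meet and Q ⊆ P ∪ R; the part of Q inside R lies in P as well, whence Q ⊆ P. -/
theorem Btw.not_left_of_btw {P Q R : Set α} (h : Btw P Q R) (hQR : Meets Q R) (hPQ : ¬ Q ⊆ P) :
    ¬ Btw Q P R := by
  intro h'
  obtain ⟨c, hc1, hc2⟩ := hQR
  obtain ⟨x, hx1, hx2⟩ := not_subset.1 hPQ
  have hcP := h'.mem hc1 hc2
  rcases h.cover ⟨c, hcP, hc2⟩ hx1 with hx | hx
  · exact hx2 hx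
  · exact hx2 (h'.mem hx1 hx)

/-- Three sets admitting a betweenness relation have one according to any injective ranking. -/
theorem Orderable.btw_of_triple {F : Set ι} {Q : ι → Set α} (h : Orderable F Q) {a b c : ι}
    (ha : a ∈ F) (hb : b ∈ F) (hc : c ∈ F) (hab : a ≠ b) (hbc : b ≠ c) (hac : a ≠ c) :
    Btw (Q a) (Q b) (Q c) ∨ Btw (Q b) (Q c) (Q a) ∨ Btw (Q c) (Q a) (Q b) := by
  obtain ⟨g, hg, h⟩ := h
  have h1 := hg.ne ha hb hab
  have h2 := hg.ne hb hc hbc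
  have h3 := hg.ne ha hc hac
  rcases lt_or_gt_of_ne h1 with h1 | h1 <;> rcases lt_or_gt_of_ne h2 with h2 | h2 <;>
    rcases lt_or_gt_of_ne h3 with h3 | h3
  · exact Or.inl (h a ha b hb c hc h1 h2)
  · omega
  · exact Or.inr (Or.inl (h a ha c hc b hb h3 h2).symm)
  · exact Or.inr (Or.inr (h c hc a ha b hb h3 h1))
  · exact Or.inr (Or.inr (h b hb a ha c hc h1 h3).symm)
  · exact Or.inr (Or.inl (h b hb c hc a ha h2 h3))
  · omega
  · exact Or.inl (h c hc b hb a ha h2 h1).symm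

/-- A cyclic sequence of sets in which each consecutive pair has a private common point is not
orderable. -/
theorem not_orderable_of_cycle {F : Set ι} {Q : ι → Set α} {m : ℕ} (hm : 3 ≤ m)
    (A : ZMod m → ι) (hA : ∀ i, A i ∈ F) (x : ZMod m → α)
    (hx : ∀ i, x i ∈ Q (A i) ∧ x i ∈ Q (A (i + 1)))
    (hx' : ∀ i j, j ≠ i → j ≠ i + 1 → x i ∉ Q (A j)) : ¬ Orderable F Q := by
  rintro ⟨g, hg, h⟩
  have : NeZero m := ⟨by omega⟩
  have : Fact (1 < m) := ⟨by omega⟩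
  have h2 : (2 : ZMod m) ≠ 0 := by
    intro h0
    have := (ZMod.natCast_eq_zero_iff 2 m).1 (by exact_mod_cast h0)
    have := Nat.le_of_dvd (by norm_num) this
    omega
  have hinj : Function.Injective A := by
    intro i j hij
    by_contra hne
    have hj : j = i + 1 := by
      by_contra hj
      exact hx' i j (Ne.symm hne) hj (hij ▸ (hx i).1)
    have hi : i = j + 1 := by
      by_contra hi
      exact hx' j i hne hi (hij ▸ (hx j).1)
    rw [hj] at hi
    apply h2
    linear_combination -hi
  -- Start at the leftmost set. The nearer of its two cyclic neighbours lies between it and the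
  -- farther one, hence contains the private point of that pair.
  obtain ⟨i, hi⟩ := Finite.exists_min (fun i => g (A i))
  have hne1 : i + 1 ≠ i := by simp
  have hne2 : i - 1 ≠ i := by simp
  have hne3 : i - 1 ≠ i + 1 := by
    intro h0
    apply h2
    linear_combination -h0
  have l1 : g (A i) < g (A (i + 1)) :=
    lt_of_le_of_ne (hi _) (hg.ne (hA _) (hA _) (hinj.ne hne1.symm))
  have l2 : g (A i) < g (A (i - 1)) :=
    lt_of_le_of_ne (hi _) (hg.ne (hA _) (hA _) (hinj.ne hne2.symm))
  rcases lt_or_gt_of_ne (hg.ne (hA _) (hA _) (hinj.ne hne3)) with l3 | l3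
  · have := (h _ (hA i) _ (hA (i - 1)) _ (hA (i + 1)) l2 l3).mem (hx i).1 (hx i).2
    exact hx' i (i - 1) hne2 hne3 this
  · have hb := h _ (hA i) _ (hA (i + 1)) _ (hA (i - 1)) l1 l3
    have hy := hx (i - 1)
    rw [sub_add_cancel] at hy
    have := hb.mem hy.2 hy.1
    exact hx' (i - 1) (i + 1) hne3.symm (by simp) this

/-- Three pairwise disjoint sets and a fourth one meeting all of them are not orderable. -/
theorem not_orderable_of_claw {F : Set ι} {Q : ι → Set α} {a b c e : ι}
    (ha : a ∈ F) (hb : b ∈ F) (hc : c ∈ F) (he : e ∈ F)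
    (hab : ¬ Meets (Q a) (Q b)) (hbc : ¬ Meets (Q b) (Q c)) (hac : ¬ Meets (Q a) (Q c))
    (hae : Meets (Q a) (Q e)) (hbe : Meets (Q b) (Q e)) (hce : Meets (Q c) (Q e)) :
    ¬ Orderable F Q := by
  rintro ⟨g, hg, h⟩
  -- Disjoint sets meeting `Q e` lie on opposite sides of it, since otherwise the nearer one would
  -- contain a common point of the farther one and `Q e`. Three sets cannot be pairwise on opposite
  -- sides.
  have key : ∀ {p q}, p ∈ F → q ∈ F → ¬ Meets (Q p) (Q q) → Meets (Q p) (Q e) → Meets (Q q) (Q e) →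
      ¬ (g p < g q ∧ g q < g e) ∧ ¬ (g e < g p ∧ g p < g q) := by
    rintro p q hp hq hpq ⟨x, hx1, hx2⟩ ⟨y, hy1, hy2⟩
    refine ⟨fun hlt => hpq ⟨x, hx1, (h p hp q hq e he hlt.1 hlt.2).mem hx1 hx2⟩, fun hlt =>
      hpq ⟨y, (h e he p hp q hq hlt.1 hlt.2).mem hy2 hy1, hy1⟩⟩
  have sw : ∀ {p q : ι}, ¬ Meets (Q p) (Q q) → ¬ Meets (Q q) (Q p) := fun h h' => h h'.symm
  have ne : ∀ {p q : ι}, p ∈ F → q ∈ F → Meets (Q p) (Q e) → ¬ Meets (Q p) (Q q) →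
      g p ≠ g q := by
    rintro p q hp hq ⟨x, hx1, -⟩ hpq heq
    obtain rfl := hg hp hq heq
    exact hpq ⟨x, hx1, hx1⟩
  have ne' : ∀ {p q : ι}, p ∈ F → q ∈ F → Meets (Q q) (Q e) → ¬ Meets (Q p) (Q q) →
      g p ≠ g e := by
    intro p q hp hq hqe hpq heq
    obtain rfl := hg hp he heq
    exact hpq hqe.symm
  have := key ha hb hab hae hbe
  have := key hb ha (sw hab) hbe hae
  have := key hb hc hbc hbe hce
  have := key hc hb (sw hbc) hce hbe
  have := key ha hc hac hae hce
  have := key hc ha (sw hac) hce hae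
  have := ne ha hb hae hab
  have := ne hb hc hbe hbc
  have := ne ha hc hae hac
  have := ne' ha hb hbe hab
  have := ne' hb hc hce hbc
  have := ne' hc hb hbe (sw hbc)
  omega

end Orderable

/-! ### Clean families and betweenness of four sets -/

section Clean

variable {α : Type*}

/-- A Sperner family all of whose triples are orderable, without claws, without cycles of length
four through a common point, and without chordless cycles of length at least four. -/
structure IsClean (F : Set (Set α)) : Prop where
  sperner : ∀ P ∈ F, ∀ Q ∈ F, P ⊆ Q → P = Q
  triple : ∀ P ∈ F, ∀ Q ∈ F, ∀ R ∈ F, P ≠ Q → Q ≠ R → P ≠ R →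
    Btw P Q R ∨ Btw Q R P ∨ Btw R P Q
  no_claw : ∀ P ∈ F, ∀ Q ∈ F, ∀ R ∈ F, ∀ D ∈ F, ¬ Meets P Q → ¬ Meets Q R → ¬ Meets P R →
    Meets P D → Meets Q D → ¬ Meets R D
  no_wheel : ∀ P : Fin 4 → Set α, (∀ i, P i ∈ F) → (⋂ i, P i).Nonempty →
    ¬ ∀ i, ∃ x, ∀ j, x ∈ P j ↔ (j = i ∨ j = i + 1)
  no_cycle : ∀ N, 4 ≤ N → ∀ W : ℕ → Set α, (∀ i < N, W i ∈ F) →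
    (∀ i, i + 1 < N → Meets (W i) (W (i + 1))) → Meets (W (N - 1)) (W 0) →
    ¬ ∀ i j, i + 2 ≤ j → j < N → (i = 0 → j + 1 < N) → ¬ Meets (W i) (W j)

theorem IsClean.wheel {F : Set (Set α)} (hF : IsClean F) {A B C D : Set α} (hA : A ∈ F)
    (hB : B ∈ F) (hC : C ∈ F) (hD : D ∈ F) {c x y z w : α}
    (hc : c ∈ A ∧ c ∈ B ∧ c ∈ C ∧ c ∈ D) (hx : x ∈ A ∧ x ∈ B ∧ x ∉ C ∧ x ∉ D)
    (hy : y ∉ A ∧ y ∈ B ∧ y ∈ C ∧ y ∉ D) (hz : z ∉ A ∧ z ∉ B ∧ z ∈ C ∧ z ∈ D)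
    (hw : w ∈ A ∧ w ∉ B ∧ w ∉ C ∧ w ∈ D) : False := by
  refine hF.no_wheel ![A, B, C, D] ?_ ⟨c, ?_⟩ ?_
  · intro i; fin_cases i <;> assumption
  · rw [mem_iInter]; intro i; fin_cases i <;> simp [hc]
  · intro i
    fin_cases i
    · refine ⟨x, fun j => ?_⟩; fin_cases j <;> simp [hx]
    · refine ⟨y, fun j => ?_⟩; fin_cases j <;> simp [hy]
    · refine ⟨z, fun j => ?_⟩; fin_cases j <;> simp [hz]
    · refine ⟨w, fun j => ?_⟩; fin_cases j <;> simp [hw]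

variable {F : Set (Set α)} {A B X Y : Set α}

theorem IsClean.exists_diff (hF : IsClean F) (hA : A ∈ F) (hB : B ∈ F) (h : A ≠ B) :
    ∃ x, x ∈ A ∧ x ∉ B := by
  obtain ⟨x, hx⟩ := not_subset.1 fun h' => h (hF.sperner A hA B hB h')
  exact ⟨x, hx⟩

/-- `X` cannot separate `A` from `Y` if `A` should lie between `X` and `Y`, with `B` following
`A`. -/
theorem IsClean.not_btw_of_next (hF : IsClean F) (hA : A ∈ F) (hB : B ∈ F) (hX : X ∈ F)
    (hY : Y ∈ F) (hAX : A ≠ X) (hAB : A ≠ B) (mAB : Meets A B) (mAY : Meets A Y)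
    (h1 : Btw X A B) (h2 : Btw A Y B ∨ Btw A B Y) : ¬ Btw A X Y := by
  intro h
  obtain ⟨q, hq, hqX⟩ := hF.exists_diff hA hX hAX
  rcases h2 with h2 | h2
  · obtain ⟨c, hc1, hc2⟩ := mAB
    have hcX : c ∈ X := h.mem hc1 (h2.mem hc1 hc2)
    have hqB := (h1.cover ⟨c, hcX, hc2⟩ hq).resolve_left hqX
    exact hqX (h.mem hq (h2.mem hq hqB))
  · obtain ⟨c, hc1, hc2⟩ := mAY
    have hcX : c ∈ X := h.mem hc1 hc2
    have hcB : c ∈ B := h2.mem hc1 hc2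
    have cA : ∀ {z}, z ∈ A → z ∈ X ∨ z ∈ B := h1.cover ⟨c, hcX, hcB⟩
    have cX : ∀ {z}, z ∈ X → z ∈ A ∨ z ∈ Y := h.cover ⟨c, hc1, hc2⟩
    have cB : ∀ {z}, z ∈ B → z ∈ A ∨ z ∈ Y := h2.cover ⟨c, hc1, hc2⟩
    obtain ⟨p, hp, hpA⟩ := hF.exists_diff hB hA hAB.symm
    obtain ⟨r, hr, hrA⟩ := hF.exists_diff hX hA hAX.symm
    obtain ⟨u, hu, huB⟩ := hF.exists_diff hA hB hAB
    have hqB := (cA hq).resolve_left hqX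
    -- The cyclic sequence A, X, Y, B is a wheel with hub c.
    exact hF.wheel hA hX hY hB (c := c) (x := u) (y := r) (z := p) (w := q)
      ⟨hc1, hcX, hc2, hcB⟩
      ⟨hu, (cA hu).resolve_right huB, fun h' => huB (h2.mem hu h'), huB⟩
      ⟨hrA, hr, (cX hr).resolve_left hrA, fun h' => hrA (h1.mem hr h')⟩
      ⟨hpA, fun h' => hpA (h1.mem h' hp), (cB hp).resolve_left hpA, hp⟩
      ⟨hq, hqX, fun h' => hqX (h.mem hq h'), hqB⟩

/-- `X` cannot separate `A` from `Y` if `A` should lie between `X` and `Y`, with `B` preceding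
`A`. -/
theorem IsClean.not_btw_of_prev (hF : IsClean F) (hA : A ∈ F) (hB : B ∈ F) (hX : X ∈ F)
    (hAX : A ≠ X) (hAB : A ≠ B) (mAB : Meets A B) (mAY : Meets A Y)
    (h1 : Btw B A Y) (h2 : Btw B X A ∨ Btw X B A) : ¬ Btw A X Y := by
  intro h
  rcases h2 with h2 | h2
  · obtain ⟨r, hr, hrA⟩ := hF.exists_diff hX hA hAX.symm
    have hrY := (h.cover mAY hr).resolve_left hrA
    have hrB := (h2.cover mAB.symm hr).resolve_right hrA
    exact hrA (h1.mem hrB hrY)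
  · obtain ⟨c, hc1, hc2⟩ := mAY
    have hcX : c ∈ X := h.mem hc1 hc2
    have hcB : c ∈ B := h2.mem hcX hc1
    obtain ⟨u, hu, huB⟩ := hF.exists_diff hA hB hAB
    have huY := (h1.cover ⟨c, hcB, hc2⟩ hu).resolve_left huB
    exact huB (h2.mem (h.mem hu huY) hu)

/-- If A also lay between X and Y, then A, Y, B, X in this cyclic order would form a wheel whose hub
is a common point of A and B. This handles a chain member next to an inner slot holding X and Y. -/
theorem IsClean.not_btw_of_both (hF : IsClean F) (hA : A ∈ F) (hB : B ∈ F) (hX : X ∈ F)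
    (hY : Y ∈ F) (hAX : A ≠ X) (hAY : A ≠ Y) (mAB : Meets A B) (mXY : Meets X Y)
    (h1 : Btw A X B) (h2 : Btw A Y B) : ¬ Btw X A Y := by
  intro h
  obtain ⟨c, hc1, hc2⟩ := id mAB
  obtain ⟨x, hx, hxA⟩ := hF.exists_diff hX hA hAX.symm
  obtain ⟨y, hy, hyA⟩ := hF.exists_diff hY hA hAY.symm
  obtain ⟨u, hu, huX⟩ := hF.exists_diff hA hX hAX
  obtain ⟨v, hv, hvY⟩ := hF.exists_diff hA hY hAY
  have cX : ∀ {z}, z ∈ X → z ∈ A ∨ z ∈ B := h1.cover mAB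
  have cY : ∀ {z}, z ∈ Y → z ∈ A ∨ z ∈ B := h2.cover mAB
  have cA : ∀ {z}, z ∈ A → z ∈ X ∨ z ∈ Y := h.cover mXY
  exact hF.wheel hA hY hB hX (c := c) (x := u) (y := y) (z := x) (w := v)
    ⟨hc1, h2.mem hc1 hc2, hc2, h1.mem hc1 hc2⟩
    ⟨hu, (cA hu).resolve_left huX, fun h' => huX (h1.mem hu h'), huX⟩
    ⟨hyA, hy, (cY hy).resolve_left hyA, fun h' => hyA (h.mem h' hy)⟩
    ⟨hxA, fun h' => hxA (h.mem hx h'), (cX hx).resolve_left hxA, hx⟩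
    ⟨hv, hvY, fun h' => hvY (h2.mem hv h'), (cA hv).resolve_right hvY⟩

/-- If A lay between X and Y, it would be covered by A ∩ X and A ∩ Y, both contained in B, against
the antichain property. This handles chain members not adjacent to the slot of X and Y. -/
theorem IsClean.not_btw_of_far (hF : IsClean F) (hA : A ∈ F) (hB : B ∈ F) (hAB : A ≠ B)
    (mXY : Meets X Y) (h1 : Btw A B X) (h2 : Btw A B Y) : ¬ Btw X A Y := by
  intro h
  obtain ⟨u, hu, huB⟩ := hF.exists_diff hA hB hAB
  rcases h.cover mXY hu with h' | h'
  · exact huB (h1.mem hu h')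
  · exact huB (h2.mem hu h')

/-- Here A ends a chain, B precedes it, and X, Y come beyond. If A ⊆ X ∪ Y, then B meets both X and
Y, and points of A outside X, Y and B show that none of B, X, Y lies between the other two. -/
theorem IsClean.not_btw_of_end (hF : IsClean F) (hA : A ∈ F) (hB : B ∈ F) (hX : X ∈ F)
    (hY : Y ∈ F) (hAX : A ≠ X) (hAY : A ≠ Y) (hAB : A ≠ B) (hBX : B ≠ X) (hBY : B ≠ Y)
    (hXY : X ≠ Y) (mAB : Meets A B) (mXY : Meets X Y)
    (h1 : Btw B A X) (h2 : Btw B A Y) : ¬ Btw X A Y := by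
  intro h
  have cA : ∀ {z}, z ∈ A → z ∈ X ∨ z ∈ Y := h.cover mXY
  obtain ⟨u, hu, huX⟩ := hF.exists_diff hA hX hAX
  obtain ⟨v, hv, hvY⟩ := hF.exists_diff hA hY hAY
  obtain ⟨w, hw, hwB⟩ := hF.exists_diff hA hB hAB
  have huY := (cA hu).resolve_left huX
  have hvX := (cA hv).resolve_right hvY
  have key : Meets B X ∧ Meets B Y := by
    obtain ⟨c, hc1, hc2⟩ := mAB
    rcases cA hc1 with hc | hc
    · exact ⟨⟨c, hc2, hc⟩, ⟨u, (h1.cover ⟨c, hc2, hc⟩ hu).resolve_right huX, huY⟩⟩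
    · exact ⟨⟨v, (h2.cover ⟨c, hc2, hc⟩ hv).resolve_right hvY, hvX⟩, ⟨c, hc2, hc⟩⟩
  have hwX := (h1.cover key.1 hw).resolve_left hwB
  have hwY := (h2.cover key.2 hw).resolve_left hwB
  have huB := (h1.cover key.1 hu).resolve_right huX
  have hvB := (h2.cover key.2 hv).resolve_right hvY
  rcases hF.triple B hB X hX Y hY hBX hXY hBY with h' | h' | h'
  · exact huX (h'.mem huB huY)
  · exact hvY (h'.mem hvX hvB)
  · exact hwB (h'.mem hwY hwX)

/-- Two sets on the same side of `X` and `Y` do not force different orders of `X` and `Y`. -/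
theorem btw_of_btw_same_side (h1 : Btw A B Y) (h4 : Btw B X Y) : Btw A X Y := by
  by_cases mAY : Meets A Y
  swap
  · exact .of_not_meets mAY
  obtain ⟨c, hcA, hcY⟩ := mAY
  have hcX : c ∈ X := h4.mem (h1.mem hcA hcY) hcY
  refine ⟨fun z hz => h4.mem (h1.mem hz.1 hz.2) hz.2, fun _ x hx => ?_⟩
  by_contra hx'
  simp only [mem_union, not_or] at hx'
  have hxB := (h4.cover ⟨c, h1.mem hcA hcY, hcY⟩ hx).resolve_right hx'.2
  rcases h1.cover ⟨c, hcA, hcY⟩ hxB with h | h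
  · exact hx'.1 h
  · exact hx'.2 h

/-- Two sets on different sides of `X` and `Y` do not force different orders of `X` and `Y`. -/
theorem IsClean.btw_or_btw (hF : IsClean F) (hA : A ∈ F) (hB : B ∈ F) (hX : X ∈ F)
    (hY : Y ∈ F) (hXY : X ≠ Y) (mXY : Meets X Y) (h1 : Btw A X B)
    (hA' : Btw A Y X) (hB' : Btw B Y X) : Btw A X Y ∨ Btw B X Y := by
  by_contra hcon
  rw [not_or] at hcon
  have mAY : Meets A Y := by by_contra h; exact hcon.1 (.of_not_meets h)
  have mBY : Meets B Y := by by_contra h; exact hcon.2 (.of_not_meets h)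
  obtain ⟨x, hx, hxY⟩ := hF.exists_diff hX hY hXY
  obtain ⟨y, hy, hyX⟩ := hF.exists_diff hY hX hXY.symm
  by_cases mAB : Meets A B
  · rcases h1.cover mAB hx with h | h
    · exact hxY (hA'.mem h hx)
    · exact hxY (hB'.mem h hx)
  · have sub : ∀ {P Q : Set α}, ¬ Meets P Q → Btw P Y X → Btw Q Y X → Meets P X →
        Meets Q Y → False := by
      intro P Q mPQ hP hQ mPX mQY
      obtain ⟨d, hdQ, hdY⟩ := mQY
      have hdX : d ∈ X := (hP.cover mPX hdY).resolve_left fun h => mPQ ⟨d, h, hdQ⟩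
      have hyQ := (hQ.cover ⟨d, hdQ, hdX⟩ hy).resolve_right hyX
      have hyP := (hP.cover mPX hy).resolve_right hyX
      exact mPQ ⟨y, hyP, hyQ⟩
    by_cases mAX : Meets A X
    · exact sub mAB hA' hB' mAX mBY
    · by_cases mBX : Meets B X
      · exact sub (fun h => mAB h.symm) hB' hA' mBX mAY
      · exact hF.no_claw A hA B hB X hX Y hY mAB mBX mAX mAY mBY mXY

/-- Two disjoint sets cannot both follow the last set of a chain. -/
theorem IsClean.not_both_follow (hF : IsClean F) (hA : A ∈ F) (hB : B ∈ F) (hX : X ∈ F)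
    (hY : Y ∈ F) (hAB : A ≠ B) (mAB : Meets A B) (mAX : Meets A X) (mAY : Meets A Y)
    (h1 : Btw B A X) (h2 : Btw B A Y) : Meets X Y := by
  by_contra mXY
  obtain ⟨w, hw, hwB⟩ := hF.exists_diff hA hB hAB
  -- Once B meets P, a common point of A and Q lies in B, so B meets Q as well; a point of A outside
  -- B then lies in both P and Q. If B meets neither X nor Y, there is a claw at A.
  have key : ∀ {P Q : Set α}, ¬ Meets P Q → Btw B A P → Btw B A Q → Meets A Q →
      Meets B P → False := by
    rintro P Q mPQ hP hQ ⟨c, hcA, hcQ⟩ mBP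
    have hcB := (hP.cover mBP hcA).resolve_right fun h => mPQ ⟨c, h, hcQ⟩
    have h3 := (hP.cover mBP hw).resolve_left hwB
    have h4 := (hQ.cover ⟨c, hcB, hcQ⟩ hw).resolve_left hwB
    exact mPQ ⟨w, h3, h4⟩
  by_cases mBX : Meets B X
  · exact key mXY h1 h2 mAY mBX
  · by_cases mBY : Meets B Y
    · exact key (fun h => mXY h.symm) h2 h1 mAX mBY
    · exact hF.no_claw B hB X hX Y hY A hA mBX mXY mBY mAB.symm mAX.symm mAY.symm

end Clean

/-! ### Chordless paths -/

/-- Greedy choice: jump from `A j` to the last set up to `A b` that meets it, so that no chord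
starts at `A j`, and continue. The parameter n = b - j - 1 only drives the induction. -/
theorem exists_chordless_path {α : Type*} (A : ℕ → Set α) (b : ℕ) :
    ∀ n j, j + n + 1 = b → (∀ i, j ≤ i → i < b → Meets (A i) (A (i + 1))) →
      ∃ (r : ℕ) (w : ℕ → ℕ), 1 ≤ r ∧ w 0 = j ∧ w r = b ∧ (∀ u, u < r → w u < w (u + 1)) ∧
        (∀ u < r, Meets (A (w u)) (A (w (u + 1)))) ∧
        ∀ u v, u + 2 ≤ v → v ≤ r → ¬ Meets (A (w u)) (A (w v)) := by
  classical
  intro n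
  induction n using Nat.strong_induction_on with
  | _ n ih =>
  intro j hj hm
  set P : ℕ → Prop := fun l => j < l ∧ Meets (A j) (A l) with hP
  have hj1 : P (j + 1) := ⟨by omega, hm j le_rfl (by omega)⟩
  set l := Nat.findGreatest P b with hl
  have hPl : P l := Nat.findGreatest_spec (P := P) (by omega : j + 1 ≤ b) hj1
  have hlb : l ≤ b := Nat.findGreatest_le b
  have hmax : ∀ u, l < u → u ≤ b → ¬ Meets (A j) (A u) := fun u hu hub h =>
    Nat.findGreatest_is_greatest hu hub ⟨hPl.1.trans hu, h⟩
  rcases hlb.eq_or_lt with hlb | hlb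
  · refine ⟨1, fun u => if u = 0 then j else b, le_rfl, by simp, by simp, ?_, ?_, ?_⟩
    · intro u hu
      obtain rfl : u = 0 := by omega
      simp; omega
    · intro u hu
      obtain rfl : u = 0 := by omega
      simpa [hlb] using hPl.2
    · intro u v huv hv; omega
  · obtain ⟨r, w, hr, hw0, hwr, hwm, hwa, hwc⟩ := ih (b - l - 1) (by have := hPl.1; omega) l
      (by omega) (fun i hi => hm i (by have := hPl.1; omega))
    have hwl : ∀ u, u ≤ r → 1 ≤ u → l < w u ∧ w u ≤ b := by
      intro u hu h1
      have mono : ∀ a c, a ≤ c → c ≤ r → w a ≤ w c := by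
        intro a c hac
        induction c, hac using Nat.le_induction with
        | base => intro _; exact le_rfl
        | succ c hc ihc => intro hcr; exact (ihc (by omega)).trans (hwm c (by omega)).le
      have h2 := mono 1 u h1 hu
      have h3 := mono u r hu le_rfl
      have h4 := hwm 0 (by omega)
      rw [hw0, zero_add] at h4
      omega
    refine ⟨r + 1, fun u => if u = 0 then j else w (u - 1), by omega, by simp, by simp [hwr],
      ?_, ?_, ?_⟩
    · intro u hu
      rcases Nat.eq_zero_or_pos u with rfl | hu0
      · simpa [hw0] using hPl.1
      · have := hwm (u - 1) (by omega)
        rw [Nat.sub_add_cancel hu0] at this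
        simpa [hu0.ne'] using this
    · intro u hu
      rcases Nat.eq_zero_or_pos u with rfl | hu0
      · simpa [hw0] using hPl.2
      · have := hwa (u - 1) (by omega)
        rw [Nat.sub_add_cancel hu0] at this
        simpa [hu0.ne'] using this
    · intro u v huv hv
      have hv0 : v ≠ 0 := by omega
      rcases Nat.eq_zero_or_pos u with rfl | hu0
      · have := hwl (v - 1) (by omega) (by omega)
        simpa [hv0] using hmax _ this.1 this.2
      · simpa [hv0, hu0.ne'] using hwc (u - 1) (v - 1) (by omega) (by omega)

/-! ### Inserting two sets into a chain -/

section Insertion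

variable {α : Type*}

theorem orderable_image_of_pos {W : ℕ → Set α} {N : ℕ} (pos : ℕ → ℤ)
    (hpos : ∀ a < N, ∀ b < N, pos a = pos b → a = b)
    (h : ∀ a < N, ∀ b < N, ∀ c < N, pos a < pos b → pos b < pos c → Btw (W a) (W b) (W c)) :
    Orderable (W '' Iio N) id := by
  classical
  have key : ∀ B ∈ W '' Iio N, ∃ n < N, W n = B := fun B hB => hB
  choose! idx hidx hidx' using key
  refine ⟨fun B => pos (idx B), fun B hB C hC hBC => ?_, fun A hA B hB C hC h1 h2 => ?_⟩
  · rw [← hidx' B hB, ← hidx' C hC, hpos _ (hidx B hB) _ (hidx C hC) hBC]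
  · have := h _ (hidx A hA) _ (hidx B hB) _ (hidx C hC) h1 h2
    rwa [hidx' A hA, hidx' B hB, hidx' C hC] at this

/-- `A i` sits at position 4i + 2, which leaves two free integers 4s and 4s + 1 in each slot s, so
that X and Y can share a slot in either order. The hypotheses list every type of triple. -/
theorem orderable_insert_two {A : ℕ → Set α} {k : ℕ} {X Y : Set α} {p q : ℤ} (hpq : p ≠ q)
    (hp : ∀ i < k, p ≠ 4 * i + 2) (hq : ∀ i < k, q ≠ 4 * i + 2)
    (hA : ∀ i j l, i < j → j < l → l < k → Btw (A i) (A j) (A l))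
    (hX1 : ∀ i j, i < j → j < k → p < 4 * i + 2 → Btw X (A i) (A j))
    (hX2 : ∀ i j, i < j → j < k → 4 * i + 2 < p → p < 4 * j + 2 → Btw (A i) X (A j))
    (hX3 : ∀ i j, i < j → j < k → 4 * j + 2 < p → Btw (A i) (A j) X)
    (hY1 : ∀ i j, i < j → j < k → q < 4 * i + 2 → Btw Y (A i) (A j))
    (hY2 : ∀ i j, i < j → j < k → 4 * i + 2 < q → q < 4 * j + 2 → Btw (A i) Y (A j))
    (hY3 : ∀ i j, i < j → j < k → 4 * j + 2 < q → Btw (A i) (A j) Y)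
    (hAXY : ∀ i < k, 4 * i + 2 < p → p < q → Btw (A i) X Y)
    (hXAY : ∀ i < k, p < 4 * i + 2 → 4 * i + 2 < q → Btw X (A i) Y)
    (hXYA : ∀ i < k, p < q → q < 4 * i + 2 → Btw X Y (A i))
    (hAYX : ∀ i < k, 4 * i + 2 < q → q < p → Btw (A i) Y X)
    (hYAX : ∀ i < k, q < 4 * i + 2 → 4 * i + 2 < p → Btw Y (A i) X)
    (hYXA : ∀ i < k, q < p → p < 4 * i + 2 → Btw Y X (A i)) :
    Orderable (insert X (insert Y (A '' Iio k))) id := by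
  set W : ℕ → Set α := fun n => if n < k then A n else if n = k then X else Y with hW
  set pos : ℕ → ℤ := fun n => if n < k then 4 * n + 2 else if n = k then p else q with hposdef
  have hset : insert X (insert Y (A '' Iio k)) = W '' Iio (k + 2) := by
    ext B
    simp only [mem_insert_iff, mem_image, mem_Iio]
    constructor
    · rintro (rfl | rfl | ⟨i, hi, rfl⟩)
      · exact ⟨k, by omega, by simp [hW]⟩
      · exact ⟨k + 1, by omega, by simp [hW]⟩
      · exact ⟨i, by omega, by simp [hW, hi]⟩
    · rintro ⟨n, hn, rfl⟩
      by_cases h1 : n < k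
      · exact Or.inr (Or.inr ⟨n, h1, by simp [hW, h1]⟩)
      · by_cases h2 : n = k
        · left; simp [hW, h2]
        · right; left; simp [hW, h1, h2]
  have cases3 : ∀ n < k + 2, (n < k ∧ W n = A n ∧ pos n = 4 * n + 2) ∨
      (n = k ∧ W n = X ∧ pos n = p) ∨ (n = k + 1 ∧ W n = Y ∧ pos n = q) := by
    intro n hn
    by_cases h1 : n < k
    · left; simp [hW, hposdef, h1]
    · by_cases h2 : n = k
      · right; left; simp [hW, hposdef, h2]
      · right; right; exact ⟨by omega, by simp [hW, h1, h2], by simp [hposdef, h1, h2]⟩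
  rw [hset]
  refine orderable_image_of_pos pos ?_ ?_
  · intro a ha b hb hab
    rcases cases3 a ha with ⟨ha, -, hpa⟩ | ⟨ha, -, hpa⟩ | ⟨ha, -, hpa⟩ <;>
    rcases cases3 b hb with ⟨hb, -, hpb⟩ | ⟨hb, -, hpb⟩ | ⟨hb, -, hpb⟩ <;>
    rw [hpa, hpb] at hab
    · omega
    · exact absurd hab.symm (hp a ha)
    · exact absurd hab.symm (hq a ha)
    · exact absurd hab (hp b hb)
    · omega
    · exact absurd hab hpq
    · exact absurd hab (hq b hb)
    · exact absurd hab.symm hpq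
    · omega
  · intro a ha b hb c hc hab hbc
    rcases cases3 a ha with ⟨ha, wa, hpa⟩ | ⟨ha, wa, hpa⟩ | ⟨ha, wa, hpa⟩ <;>
    rcases cases3 b hb with ⟨hb, wb, hpb⟩ | ⟨hb, wb, hpb⟩ | ⟨hb, wb, hpb⟩ <;>
    rw [hpa, hpb] at hab <;> first | omega | skip
    all_goals
      rcases cases3 c hc with ⟨hc, wc, hpc⟩ | ⟨hc, wc, hpc⟩ | ⟨hc, wc, hpc⟩ <;>
      rw [hpb, hpc] at hbc <;> first | omega | skip
      all_goals
        rw [wa, wb, wc]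
        first
          | exact hA a b c (by omega) (by omega) hc
          | exact hX1 b c (by omega) hc hab
          | exact hX2 a c (by omega) hc hab hbc
          | exact hX3 a b (by omega) hb hbc
          | exact hY1 b c (by omega) hc hab
          | exact hY2 a c (by omega) hc hab hbc
          | exact hY3 a b (by omega) hb hbc
          | exact hAXY a ha hab hbc
          | exact hXAY b hb hab hbc
          | exact hXYA c hc hab hbc
          | exact hAYX a ha hab hbc
          | exact hYAX b hb hab hbc
          | exact hYXA c hc hab hbc

/-- `X` fits into the sequence `A 0, …, A (k - 1)` between `A (s - 1)` and `A s`. -/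
structure FitsAt (A : ℕ → Set α) (k : ℕ) (X : Set α) (s : ℕ) : Prop where
  le : s ≤ k
  before : ∀ i j, i < j → j < k → s ≤ i → Btw X (A i) (A j)
  between : ∀ i j, i < s → s ≤ j → j < k → Btw (A i) X (A j)
  after : ∀ i j, i < j → j < s → Btw (A i) (A j) X
  meets : ∃ i < k, Meets X (A i)

variable {A : ℕ → Set α} {k s t : ℕ} {X Y : Set α} {F : Set (Set α)}

/-- In an inner slot X inherits the common points of the two neighbouring chain members. In the last
slot, `A (s - 1)` lies between X and whichever chain member X meets. -/
theorem FitsAt.meets_left (h : FitsAt A k X s) (hm : ∀ i, i + 1 < k → Meets (A i) (A (i + 1)))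
    (hs : 0 < s) : Meets X (A (s - 1)) := by
  rcases h.le.lt_or_eq with hk | hk
  · obtain ⟨c, hc1, hc2⟩ := hm (s - 1) (by omega)
    rw [Nat.sub_add_cancel hs] at hc2
    exact ⟨c, (h.between (s - 1) s (by omega) le_rfl hk).mem hc1 hc2, hc1⟩
  · obtain ⟨i, hi, c, hc1, hc2⟩ := h.meets
    rcases (show i ≤ s - 1 by omega).lt_or_eq with hlt | rfl
    · exact ⟨c, hc1, (h.after i (s - 1) hlt (by omega)).mem hc2 hc1⟩
    · exact ⟨c, hc1, hc2⟩

theorem FitsAt.meets_right (h : FitsAt A k X s) (hm : ∀ i, i + 1 < k → Meets (A i) (A (i + 1)))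
    (hs : s < k) : Meets X (A s) := by
  rcases Nat.eq_zero_or_pos s with rfl | hs0
  · obtain ⟨i, hi, c, hc1, hc2⟩ := h.meets
    rcases Nat.eq_zero_or_pos i with rfl | hi0
    · exact ⟨c, hc1, hc2⟩
    · exact ⟨c, hc1, (h.before 0 i hi0 hi le_rfl).mem hc1 hc2⟩
  · obtain ⟨c, hc1, hc2⟩ := hm (s - 1) (by omega)
    rw [Nat.sub_add_cancel hs0] at hc2
    exact ⟨c, (h.between (s - 1) s (by omega) le_rfl hs).mem hc1 hc2, hc2⟩

/-- `A s` is an intermediate stop: X lies between `A i` and `A s`, and `A s` between `A i` and Y. -/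
theorem FitsAt.btw_before_of_lt (hX : FitsAt A k X s) (hY : FitsAt A k Y t)
    (hst : s < t) {i : ℕ} (hi : i < s) : Btw (A i) X Y := by
  by_cases hm : Meets (A i) Y
  swap
  · exact .of_not_meets hm
  have hsk := hY.le
  have h1 : Btw (A i) (A s) Y := hY.after i s hi hst
  have h2 := hX.between i s hi le_rfl (by omega)
  obtain ⟨c, hc1, hc2⟩ := id hm
  refine ⟨fun z hz => h2.mem hz.1 (h1.mem hz.1 hz.2), fun _ z hz => ?_⟩
  rcases h2.cover ⟨c, hc1, h1.mem hc1 hc2⟩ hz with h | h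
  · exact Or.inl h
  · exact h1.cover hm h

theorem FitsAt.btw_after_of_lt (hX : FitsAt A k X s) (hY : FitsAt A k Y t)
    (hst : s < t) {i : ℕ} (hi : t ≤ i) (hik : i < k) : Btw X Y (A i) := by
  by_cases hm : Meets X (A i)
  swap
  · exact .of_not_meets hm
  have h1 : Btw X (A (t - 1)) (A i) := hX.before _ _ (by omega) hik (by omega)
  have h2 := hY.between (t - 1) i (by omega) hi hik
  obtain ⟨c, hc1, hc2⟩ := id hm
  refine ⟨fun z hz => h2.mem (h1.mem hz.1 hz.2) hz.2, fun _ z hz => ?_⟩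
  rcases h2.cover ⟨c, h1.mem hc1 hc2, hc2⟩ hz with h | h
  · exact h1.cover hm h
  · exact Or.inr h

end Insertion

/-! ### Compatibility of two insertions in a clean family -/

section InsertionClean

variable {α : Type*} {A : ℕ → Set α} {k s t : ℕ} {X Y : Set α} {F : Set (Set α)}

/-- A chain of sets linking `X` to `Y` through sets missing one of them yields a chordless
cycle. -/
theorem IsClean.no_link (hF : IsClean F) (hAF : ∀ i < k, A i ∈ F) (hX : X ∈ F) (hY : Y ∈ F)
    (hm : ∀ i, i + 1 < k → Meets (A i) (A (i + 1))) (mXY : Meets X Y) {j b : ℕ} (hjb : j < b)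
    (hbk : b < k) (mX : Meets X (A j)) (mY : Meets Y (A b))
    (nX : ∀ i, j < i → i ≤ b → ¬ Meets X (A i)) (nY : ∀ i, j ≤ i → i < b → ¬ Meets Y (A i)) :
    False := by
  obtain ⟨r, w, hr, hw0, hwr, hwm, hwa, hwc⟩ := exists_chordless_path A b (b - j - 1) j (by omega)
    (fun i _ hi => hm i (by omega))
  have mono : ∀ a c, a < c → c ≤ r → w a < w c := by
    intro a c hac
    induction c, hac using Nat.le_induction with
    | base => intro hc; exact hwm a hc
    | succ c hc ihc => intro hcr; exact (ihc (by omega)).trans (hwm c (by omega))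
  have hle : ∀ u ≤ r, j ≤ w u ∧ w u ≤ b := by
    intro u hu
    constructor
    · rcases Nat.eq_zero_or_pos u with rfl | h
      · exact hw0.ge
      · have := mono 0 u h hu; omega
    · rcases hu.lt_or_eq with h | rfl
      · have := mono u r h le_rfl; omega
      · exact hwr.le
  -- X, the r + 1 sets of the chordless path, then Y: a cycle of length r + 3 ≥ 4. It has no chords,
  -- since among `A j`, …, `A b` the set X meets only `A j` and Y only `A b`.
  set W : ℕ → Set α := fun n => if n = 0 then X else if n ≤ r + 1 then A (w (n - 1)) else Y with hW
  have hW0 : W 0 = X := by simp [hW]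
  have hWi : ∀ n, n ≤ r → W (n + 1) = A (w n) := by intro n hn; simp [hW, hn]
  have hWr : W (r + 2) = Y := by simp [hW]
  refine hF.no_cycle (r + 3) (by omega) W ?_ ?_ ?_ ?_
  · rintro (_ | n) hn
    · rwa [hW0]
    · rcases (show n ≤ r + 1 by omega).lt_or_eq with h | rfl
      · rw [hWi n (by omega)]; exact hAF _ (by have := hle n (by omega); omega)
      · rwa [hWr]
  · rintro (_ | n) hn
    · rw [hW0, hWi 0 (by omega), hw0]; exact mX
    · rcases (show n ≤ r by omega).lt_or_eq with h | rfl
      · rw [hWi n (by omega), hWi (n + 1) (by omega)]; exact hwa n h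
      · rw [hWi n le_rfl, hWr, hwr]; exact mY.symm
  · rw [hW0, show r + 3 - 1 = r + 2 by omega, hWr]; exact mXY.symm
  · rintro (_ | u) v huv hv h0
    · have := h0 rfl
      obtain ⟨v, rfl⟩ : ∃ v', v = v' + 1 := ⟨v - 1, by omega⟩
      rw [hW0, hWi v (by omega)]
      have h1 := mono 0 v (by omega) (by omega)
      exact nX _ (by omega) (hle v (by omega)).2
    · obtain ⟨v, rfl⟩ : ∃ v', v = v' + 1 := ⟨v - 1, by omega⟩
      rcases (show v ≤ r + 1 by omega).lt_or_eq with h | rfl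
      · rw [hWi u (by omega), hWi v (by omega)]; exact hwc u v (by omega) (by omega)
      · rw [hWi u (by omega), hWr]
        have h1 := mono u r (by omega) le_rfl
        exact fun h => nY _ (hle u (by omega)).1 (by omega) h.symm

/-- The point is that `A i` meets both X and Y as soon as these meet each other. With that known,
the two wrong middles of the triple are excluded by `not_btw_of_prev` and `not_btw_of_next`. -/
theorem IsClean.btw_between_of_lt (hF : IsClean F) (hAF : ∀ i < k, A i ∈ F) (hXF : X ∈ F)
    (hYF : Y ∈ F) (hXY : X ≠ Y) (hAX : ∀ i < k, A i ≠ X) (hAY : ∀ i < k, A i ≠ Y)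
    (hinj : InjOn A (Iio k))
    (hm : ∀ i, i + 1 < k → Meets (A i) (A (i + 1))) (hk : 2 ≤ k)
    (hX : FitsAt A k X s) (hY : FitsAt A k Y t) (hst : s < t)
    {i : ℕ} (hsi : s ≤ i) (hit : i < t) : Btw X (A i) Y := by
  classical
  by_cases mXY : Meets X Y
  swap
  · exact .of_not_meets mXY
  have htk := hY.le
  have hik : i < k := by omega
  have tri := hF.triple X hXF (A i) (hAF i hik) Y hYF (hAX i hik).symm (hAY i hik) hXY
  have mXs : Meets X (A s) := hX.meets_right hm (by omega)
  have mYt : Meets Y (A (t - 1)) := hY.meets_left hm (by omega)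
  have mXle : ∀ u v, s ≤ u → u ≤ v → v < k → ∀ x, x ∈ X → x ∈ A v → x ∈ A u := by
    intro u v hu huv hv x hx hxv
    rcases huv.lt_or_eq with h | rfl
    · exact (hX.before u v h hv hu).mem hx hxv
    · exact hxv
  have mYge : ∀ u v, u ≤ v → v < t → ∀ x, x ∈ Y → x ∈ A u → x ∈ A v := by
    intro u v huv hv x hx hxu
    rcases huv.lt_or_eq with h | rfl
    · exact (hY.after u v h hv).mem hxu hx
    · exact hxu
  -- Rightwards from slot s, X meets an initial run of the chain, ending at j; leftwards from slot
  -- t, Y meets a final run, starting at b. If j < b, a chordless cycle closes up. Otherwise X, Y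
  -- and `A b` meet pairwise, hence have a common point by orderability of triples, and it
  -- propagates to `A i`.
  have both : Meets X (A i) ∧ Meets Y (A i) := by
    set PX : ℕ → Prop := fun l => s ≤ l ∧ Meets X (A l) with hPX
    set j := Nat.findGreatest PX (t - 1) with hj
    have hPs : PX s := ⟨le_rfl, mXs⟩
    have hPj : PX j := Nat.findGreatest_spec (P := PX) (by omega : s ≤ t - 1) hPs
    have hjt : j ≤ t - 1 := Nat.findGreatest_le _
    have hmaxj : ∀ u, j < u → u < t → ¬ Meets X (A u) := fun u hu hut h =>
      Nat.findGreatest_is_greatest (P := PX) (n := t - 1) hu (by omega)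
        ⟨hPj.1.trans hu.le, h⟩
    have hex : ∃ l, s ≤ l ∧ Meets Y (A l) := ⟨t - 1, by omega, mYt⟩
    obtain ⟨hsb, hPb⟩ := Nat.find_spec hex
    set b := Nat.find hex with hb
    have hminb : ∀ u, s ≤ u → u < b → ¬ Meets Y (A u) := fun u hu hub h =>
      Nat.find_min hex hub ⟨hu, h⟩
    have hbt : b ≤ t - 1 := Nat.find_min' hex ⟨by omega, mYt⟩
    rcases lt_or_ge j b with hjb | hbj
    · exact (hF.no_link hAF hXF hYF hm mXY hjb (by omega) hPj.2 hPb
        (fun u hu hub => hmaxj u hu (by omega))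
        (fun u hu hub => hminb u (hPj.1.trans hu) hub)).elim
    · obtain ⟨c, hcX, hcj⟩ := hPj.2
      have hcb := mXle b j hsb hbj (by omega) c hcX hcj
      obtain ⟨e, heY, heb⟩ := hPb
      have hbk : b < k := by omega
      have hcen : ∃ z, z ∈ X ∧ z ∈ Y ∧ z ∈ A b := by
        obtain ⟨f, hf1, hf2⟩ := mXY
        rcases hF.triple X hXF (A b) (hAF b hbk) Y hYF (hAX b hbk).symm (hAY b hbk) hXY
          with h | h | h
        · exact ⟨f, hf1, hf2, h.mem hf1 hf2⟩
        · exact ⟨c, hcX, h.mem hcb hcX, hcb⟩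
        · exact ⟨e, h.mem heY heb, heY, heb⟩
      obtain ⟨z, hzX, hzY, hzb⟩ := hcen
      rcases le_total i b with hib | hbi
      · have := mXle i b hsi hib hbk z hzX hzb
        exact ⟨⟨z, hzX, this⟩, ⟨z, hzY, this⟩⟩
      · have := mYge b i hbi hit z hzY hzb
        exact ⟨⟨z, hzX, this⟩, ⟨z, hzY, this⟩⟩
  rcases tri with h | h | h
  · exact h
  · exfalso
    -- `Y` separates
    rcases Nat.eq_zero_or_pos i with rfl | hi0
    · refine hF.not_btw_of_prev (hAF 0 hik) (hAF 1 (by omega)) hYF (hAY 0 hik)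
        (hinj.ne (by simpa using hik) (by simp; omega) (by simp)) (hm 0 (by omega)) both.1.symm
        (hX.before 0 1 (by omega) (by omega) hsi).symm ?_ h
      by_cases h1 : 1 < t
      · exact Or.inr (hY.after 0 1 (by omega) h1).symm
      · exact Or.inl (hY.between 0 1 hit (by omega) (by omega)).symm
    · have hne : i - 1 < i := by omega
      have mm := hm (i - 1) (by omega)
      rw [Nat.sub_add_cancel hi0] at mm
      refine hF.not_btw_of_next (hAF i hik) (hAF (i - 1) (by omega)) hYF hXF (hAY i hik)
        (hinj.ne (by simpa using hik) (by simp; omega) (by omega)) mm.symm both.1.symm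
        (hY.after (i - 1) i hne hit).symm ?_ h
      by_cases h1 : i - 1 < s
      · exact Or.inl (hX.between (i - 1) i h1 hsi hik).symm
      · exact Or.inr (hX.before (i - 1) i hne hik (by omega)).symm
  · exfalso
    -- `X` separates
    rcases (show i + 1 ≤ k by omega).lt_or_eq with hi1 | hi1
    · refine hF.not_btw_of_next (hAF i hik) (hAF (i + 1) hi1) hXF hYF (hAX i hik)
        (hinj.ne (by simpa using hik) (by simpa using hi1) (by omega)) (hm i hi1) both.2.symm
        (hX.before i (i + 1) (by omega) hi1 hsi) ?_ h.symm
      by_cases h1 : i + 1 < t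
      · exact Or.inr (hY.after i (i + 1) (by omega) h1)
      · exact Or.inl (hY.between i (i + 1) hit (by omega) hi1)
    · have mm := hm (i - 1) (by omega)
      rw [Nat.sub_add_cancel (by omega)] at mm
      refine hF.not_btw_of_prev (hAF i hik) (hAF (i - 1) (by omega)) hXF (hAX i hik)
        (hinj.ne (by simpa using hik) (by simp; omega) (by omega)) mm.symm both.2.symm
        (hY.after (i - 1) i (by omega) hit) ?_ h.symm
      by_cases h1 : i - 1 < s
      · exact Or.inl (hX.between (i - 1) i h1 hsi hik)
      · exact Or.inr (hX.before (i - 1) i (by omega) hik (by omega))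

/-- Two sets fitting into the same slot can be put there in one of the two orders. -/
theorem IsClean.btw_same_slot (hF : IsClean F) (hAF : ∀ i < k, A i ∈ F) (hXF : X ∈ F)
    (hYF : Y ∈ F) (hXY : X ≠ Y) (hAX : ∀ i < k, A i ≠ X) (hAY : ∀ i < k, A i ≠ Y)
    (hinj : InjOn A (Iio k))
    (hm : ∀ i, i + 1 < k → Meets (A i) (A (i + 1))) (hk : 2 ≤ k)
    (hX : FitsAt A k X s) (hY : FitsAt A k Y s) :
    ((∀ i < s, Btw (A i) X Y) ∧ ∀ i, s ≤ i → i < k → Btw (A i) Y X) ∨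
    ((∀ i < s, Btw (A i) Y X) ∧ ∀ i, s ≤ i → i < k → Btw (A i) X Y) := by
  have hsk := hX.le
  have ne : ∀ i j, i < k → j < k → i ≠ j → A i ≠ A j := fun i j hi hj hij => hinj.ne hi hj hij
  have mXY : Meets X Y := by
    rcases Nat.eq_zero_or_pos s with rfl | hs0
    · exact hF.not_both_follow (hAF 0 (by omega)) (hAF 1 (by omega)) hXF hYF
        (ne 0 1 (by omega) (by omega) (by omega)) (hm 0 (by omega))
        (hX.meets_right hm (by omega)).symm (hY.meets_right hm (by omega)).symm
        (hX.before 0 1 (by omega) (by omega) le_rfl).symm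
        (hY.before 0 1 (by omega) (by omega) le_rfl).symm
    · rcases hsk.lt_or_eq with hs | hs
      · obtain ⟨c, hc1, hc2⟩ := hm (s - 1) (by omega)
        rw [Nat.sub_add_cancel hs0] at hc2
        exact ⟨c, (hX.between (s - 1) s (by omega) le_rfl hs).mem hc1 hc2,
          (hY.between (s - 1) s (by omega) le_rfl hs).mem hc1 hc2⟩
      · have mm := hm (s - 2) (by omega)
        rw [show s - 2 + 1 = s - 1 by omega] at mm
        exact hF.not_both_follow (hAF (s - 1) (by omega)) (hAF (s - 2) (by omega)) hXF hYF
          (ne _ _ (by omega) (by omega) (by omega)) mm.symm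
          (hX.meets_left hm hs0).symm (hY.meets_left hm hs0).symm
          (hX.after (s - 2) (s - 1) (by omega) (by omega))
          (hY.after (s - 2) (s - 1) (by omega) (by omega))
  -- Neither X nor Y being separated from the other by a chain member leaves only the question which
  -- of the two is nearer to `A i`.
  have notmid : ∀ i < k, ¬ Btw X (A i) Y := by
    intro i hi
    rcases lt_or_ge i s with his | his
    · rcases (show i + 1 ≤ s by omega).lt_or_eq with h1 | h1
      · exact hF.not_btw_of_far (hAF i hi) (hAF (i + 1) (by omega))
          (ne _ _ hi (by omega) (by omega)) mXY
          (hX.after i (i + 1) (by omega) h1) (hY.after i (i + 1) (by omega) h1)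
      · rcases hsk.lt_or_eq with hs | hs
        · exact hF.not_btw_of_both (hAF i hi) (hAF (i + 1) (by omega)) hXF hYF (hAX i hi) (hAY i hi)
            (hm i (by omega)) mXY (hX.between i (i + 1) his (by omega) (by omega))
            (hY.between i (i + 1) his (by omega) (by omega))
        · have mm := hm (i - 1) (by omega)
          rw [Nat.sub_add_cancel (by omega)] at mm
          exact hF.not_btw_of_end (hAF i hi) (hAF (i - 1) (by omega)) hXF hYF (hAX i hi) (hAY i hi)
            (ne _ _ hi (by omega) (by omega)) (hAX _ (by omega)) (hAY _ (by omega)) hXY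
            mm.symm mXY
            (hX.after (i - 1) i (by omega) his) (hY.after (i - 1) i (by omega) his)
    · rcases his.lt_or_eq with h1 | h1
      · exact hF.not_btw_of_far (hAF i hi) (hAF s (by omega))
          (ne _ _ hi (by omega) (by omega)) mXY
          (hX.before s i h1 hi le_rfl).symm (hY.before s i h1 hi le_rfl).symm
      · rcases Nat.eq_zero_or_pos s with hs | hs
        · exact hF.not_btw_of_end (hAF i hi) (hAF (i + 1) (by omega)) hXF hYF (hAX i hi) (hAY i hi)
            (ne _ _ hi (by omega) (by omega)) (hAX _ (by omega)) (hAY _ (by omega)) hXY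
            (hm i (by omega)) mXY
            (hX.before i (i + 1) (by omega) (by omega) his).symm
            (hY.before i (i + 1) (by omega) (by omega) his).symm
        · have mm := hm (i - 1) (by omega)
          rw [Nat.sub_add_cancel (by omega)] at mm
          exact hF.not_btw_of_both (hAF i hi) (hAF (i - 1) (by omega)) hXF hYF (hAX i hi)
            (hAY i hi) mm.symm mXY (hX.between (i - 1) i (by omega) (by omega) hi).symm
            (hY.between (i - 1) i (by omega) (by omega) hi).symm
  have or' : ∀ i < k, Btw (A i) X Y ∨ Btw (A i) Y X := by
    intro i hi
    rcases hF.triple (A i) (hAF i hi) X hXF Y hYF (hAX i hi) hXY (hAY i hi) with h | h | h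
    · exact Or.inl h
    · exact Or.inr h.symm
    · exact (notmid i hi h.symm).elim
  -- The chain member adjacent to the slot decides for its whole side.
  have left : (∀ i < s, Btw (A i) X Y) ∨ ∀ i < s, Btw (A i) Y X := by
    rcases Nat.eq_zero_or_pos s with hs | hs
    · left; intro i hi; omega
    · rcases or' (s - 1) (by omega) with h | h
      · left
        intro i hi
        rcases (show i ≤ s - 1 by omega).lt_or_eq with h1 | rfl
        · exact btw_of_btw_same_side (hY.after i (s - 1) h1 (by omega)) h
        · exact h
      · right
        intro i hi
        rcases (show i ≤ s - 1 by omega).lt_or_eq with h1 | rfl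
        · exact btw_of_btw_same_side (hX.after i (s - 1) h1 (by omega)) h
        · exact h
  have right : (∀ i, s ≤ i → i < k → Btw (A i) X Y) ∨ ∀ i, s ≤ i → i < k → Btw (A i) Y X := by
    rcases hsk.lt_or_eq with hs | hs
    · rcases or' s hs with h | h
      · left
        intro i hi hik
        rcases hi.lt_or_eq with h1 | rfl
        · exact btw_of_btw_same_side (hY.before s i h1 hik le_rfl).symm h
        · exact h
      · right
        intro i hi hik
        rcases hi.lt_or_eq with h1 | rfl
        · exact btw_of_btw_same_side (hX.before s i h1 hik le_rfl).symm h
        · exact h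
    · left; intro i hi; omega
  -- The two sides cannot both insist that Y is the nearer set; `cross2` is the same for X. So the
  -- preferences of the two sides can be combined into one order.
  have cross1 : ∀ i < s, ∀ j, s ≤ j → j < k → Btw (A i) X Y ∨ Btw (A j) X Y := by
    intro i hi j hj hjk
    by_contra hcon
    rw [not_or] at hcon
    rcases hF.btw_or_btw (hAF i (by omega)) (hAF j hjk) hXF hYF hXY mXY
      (hX.between i j hi hj hjk) ((or' i (by omega)).resolve_left hcon.1)
      ((or' j hjk).resolve_left hcon.2) with h | h
    · exact hcon.1 h
    · exact hcon.2 h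
  have cross2 : ∀ i < s, ∀ j, s ≤ j → j < k → Btw (A i) Y X ∨ Btw (A j) Y X := by
    intro i hi j hj hjk
    by_contra hcon
    rw [not_or] at hcon
    rcases hF.btw_or_btw (hAF i (by omega)) (hAF j hjk) hYF hXF hXY.symm mXY.symm
      (hY.between i j hi hj hjk) ((or' i (by omega)).resolve_right hcon.1)
      ((or' j hjk).resolve_right hcon.2) with h | h
    · exact hcon.1 h
    · exact hcon.2 h
  by_cases hL : ∀ i < s, Btw (A i) X Y
  · by_cases hR : ∀ i, s ≤ i → i < k → Btw (A i) Y X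
    · exact Or.inl ⟨hL, hR⟩
    · right
      refine ⟨?_, right.resolve_right hR⟩
      push Not at hR
      obtain ⟨j, hj, hjk, hnot⟩ := hR
      exact fun i hi => (cross2 i hi j hj hjk).resolve_right hnot
  · right
    refine ⟨left.resolve_left hL, ?_⟩
    push Not at hL
    obtain ⟨i, hi, hnot⟩ := hL
    exact fun j hj hjk => (cross1 i hi j hj hjk).resolve_left hnot

/-- A connected chain into which each of `X` and `Y` fits can be extended by both. -/
theorem IsClean.orderable_of_fits (hF : IsClean F) (hAF : ∀ i < k, A i ∈ F) (hXF : X ∈ F)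
    (hYF : Y ∈ F) (hXY : X ≠ Y) (hAX : ∀ i < k, A i ≠ X) (hAY : ∀ i < k, A i ≠ Y)
    (hinj : InjOn A (Iio k)) (hA : ∀ i j l, i < j → j < l → l < k → Btw (A i) (A j) (A l))
    (hm : ∀ i, i + 1 < k → Meets (A i) (A (i + 1))) (hk : 2 ≤ k)
    (hX : FitsAt A k X s) (hY : FitsAt A k Y t) :
    Orderable (insert X (insert Y (A '' Iio k))) id := by
  have ins : ∀ {X Y : Set α} {s t : ℕ} (p q : ℤ), FitsAt A k X s → FitsAt A k Y t →
      (p = 4 * s ∨ p = 4 * s + 1) → (q = 4 * t ∨ q = 4 * t + 1) → p < q →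
      (∀ i < s, Btw (A i) X Y) → (∀ i, s ≤ i → i < t → Btw X (A i) Y) →
      (∀ i, t ≤ i → i < k → Btw X Y (A i)) →
      Orderable (insert X (insert Y (A '' Iio k))) id := by
    intro X Y s t p q hX hY hp hq hpq h1 h2 h3
    exact orderable_insert_two (p := p) (q := q) hpq.ne
      (fun i _ => by omega) (fun i _ => by omega) hA
      (fun i j hij hj h => hX.before i j hij hj (by omega))
      (fun i j hij hj h h' => hX.between i j (by omega) (by omega) hj)
      (fun i j hij hj h => hX.after i j hij (by omega))
      (fun i j hij hj h => hY.before i j hij hj (by omega))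
      (fun i j hij hj h h' => hY.between i j (by omega) (by omega) hj)
      (fun i j hij hj h => hY.after i j hij (by omega))
      (fun i hi h _ => h1 i (by omega)) (fun i hi h h' => h2 i (by omega) (by omega))
      (fun i hi _ h => h3 i (by omega) hi) (fun i hi h h' => by omega)
      (fun i hi h h' => by omega) (fun i hi h h' => by omega)
  rcases lt_trichotomy s t with hst | rfl | hst
  · exact ins (4 * s) (4 * t) hX hY (Or.inl rfl) (Or.inl rfl) (by omega)
      (fun i hi => hX.btw_before_of_lt hY hst hi)
      (fun i hi hi' => hF.btw_between_of_lt hAF hXF hYF hXY hAX hAY hinj hm hk hX hY hst hi hi')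
      (fun i hi hi' => hX.btw_after_of_lt hY hst hi hi')
  · rcases hF.btw_same_slot hAF hXF hYF hXY hAX hAY hinj hm hk hX hY with ⟨h1, h2⟩ | ⟨h1, h2⟩
    -- Both sets go into slot s, where the two free positions realize the chosen order.
    · exact ins (4 * s) (4 * s + 1) hX hY (Or.inl rfl) (Or.inr rfl) (by omega) h1
        (fun i hi hi' => by omega) (fun i hi hi' => (h2 i hi hi').symm)
    · rw [insert_comm]
      exact ins (4 * s) (4 * s + 1) hY hX (Or.inl rfl) (Or.inr rfl) (by omega) h1
        (fun i hi hi' => by omega) (fun i hi hi' => (h2 i hi hi').symm)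
  · rw [insert_comm]
    exact ins (4 * t) (4 * s) hY hX (Or.inl rfl) (Or.inl rfl) (by omega)
      (fun i hi => hY.btw_before_of_lt hX hst hi)
      (fun i hi hi' => hF.btw_between_of_lt hAF hYF hXF hXY.symm hAY hAX hinj hm hk hY hX hst hi
        hi')
      (fun i hi hi' => hY.btw_after_of_lt hX hst hi hi')

end InsertionClean

/-! ### Connected families, uniqueness of the chain order, and the ordering theorem -/

section Connected

variable {α : Type*} {F S : Set (Set α)}

/-- The intersection graph of the family `F` is connected (or empty). -/
def IsConn (F : Set (Set α)) : Prop :=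
  ∀ S ⊆ F, S.Nonempty → (F \ S).Nonempty → ∃ A ∈ S, ∃ B ∈ F \ S, Meets A B

theorem IsConn.insert_of_meets {A B : Set α} (hS : IsConn S) (hA : A ∈ S) (hAB : Meets A B) :
    IsConn (insert B S) := by
  rintro T hT ⟨P, hP⟩ ⟨Q, hQ, hQT⟩
  by_cases hBT : B ∈ T
  · have hQS : Q ∈ S := hQ.resolve_left (by rintro rfl; exact hQT hBT)
    by_cases hTS : (T ∩ S).Nonempty
    · obtain ⟨A', hA', B', hB', hm⟩ := hS (T ∩ S) inter_subset_right hTS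
        ⟨Q, hQS, fun h => hQT h.1⟩
      exact ⟨A', hA'.1, B', ⟨Or.inr hB'.1, fun h => hB'.2 ⟨h, hB'.1⟩⟩, hm⟩
    · exact ⟨B, hBT, A, ⟨Or.inr hA, fun h => hTS ⟨A, h, hA⟩⟩, hAB.symm⟩
  · have hTS : T ⊆ S := fun R hR => (hT hR).resolve_left (by rintro rfl; exact hBT hR)
    by_cases hST : (S \ T).Nonempty
    · obtain ⟨A', hA', B', hB', hm⟩ := hS T hTS ⟨P, hP⟩ hST
      exact ⟨A', hA', B', ⟨Or.inr hB'.1, hB'.2⟩, hm⟩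
    · have hAT : A ∈ T := by by_contra h; exact hST ⟨A, hA, h⟩
      exact ⟨A, hAT, B, ⟨Or.inl rfl, hBT⟩, hAB⟩

/-- A connected family has a member, different from a given one, that does not disconnect it. -/
theorem IsConn.exists_diff_singleton (hF : IsConn F) (hfin : F.Finite) {Z : Set α} (hZ : Z ∈ F)
    (hne : ∃ Y ∈ F, Y ≠ Z) : ∃ Y ∈ F, Y ≠ Z ∧ IsConn (F \ {Y}) := by
  obtain ⟨Y₀, hY₀, hYZ⟩ := hne
  have hfin' : {S : Set (Set α) | Z ∈ S ∧ S ⊆ F ∧ S ≠ F ∧ IsConn S}.Finite :=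
    hfin.finite_subsets.subset fun S hS => hS.2.1
  -- A maximal connected proper subfamily containing Z misses exactly one member: adding any B that
  -- meets it gives a connected family, which must be all of F.
  obtain ⟨S, hS⟩ := hfin'.exists_maximal ⟨{Z}, rfl, by simpa using hZ, by
    intro h; rw [← h] at hY₀; exact hYZ hY₀, by
    rintro T hT ⟨P, hP⟩ ⟨Q, hQ, hQT⟩
    rw [mem_singleton_iff.1 (hT hP)] at hP
    rw [mem_singleton_iff.1 hQ] at hQT
    exact (hQT hP).elim⟩
  obtain ⟨⟨hZS, hSF, hSne, hSc⟩, hmax⟩ := hS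
  have hdiff : (F \ S).Nonempty := by
    by_contra h
    exact hSne (hSF.antisymm (sdiff_eq_empty.1 (not_nonempty_iff_eq_empty.1 h)))
  obtain ⟨A, hA, B, hB, hAB⟩ := hF S hSF ⟨Z, hZS⟩ hdiff
  have hins : insert B S = F := by
    by_contra h
    exact hB.2 (hmax ⟨Or.inr hZS, insert_subset hB.1 hSF, h, hSc.insert_of_meets hA hAB⟩
      (subset_insert _ _) (mem_insert _ _))
  refine ⟨B, hB.1, by rintro rfl; exact hB.2 hZS, ?_⟩
  rwa [← hins, insert_sdiff_self_of_notMem hB.2]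

/-- Rank all of G above S by a shift. A triple whose outer sets come from different families imposes
no condition, as these do not meet. -/
theorem Orderable.union_of_not_meets {G : Set (Set α)} (hS : Orderable S id)
    (hG : Orderable G id) (hSf : S.Finite) (hGf : G.Finite)
    (h : ∀ A ∈ S, ∀ B ∈ G, ¬ Meets A B) : Orderable (S ∪ G) id := by
  classical
  obtain ⟨g₁, hg₁, h₁⟩ := hS
  obtain ⟨g₂, hg₂, h₂⟩ := hG
  obtain ⟨M, hM⟩ := (hSf.image g₁).bddAbove
  obtain ⟨L, hL⟩ := (hGf.image g₂).bddBelow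
  have hM' : ∀ A ∈ S, g₁ A ≤ M := fun A hA => hM ⟨A, hA, rfl⟩
  have hL' : ∀ A ∈ G, L ≤ g₂ A := fun A hA => hL ⟨A, hA, rfl⟩
  set g : Set α → ℤ := fun A => if A ∈ S then g₁ A else g₂ A - L + M + 1 with hg
  have cs : ∀ A ∈ S ∪ G, (A ∈ S ∧ g A = g₁ A) ∨ (A ∈ G ∧ g A = g₂ A - L + M + 1) := by
    intro A hA
    by_cases hAS : A ∈ S
    · left; simp [hg, hAS]
    · right; exact ⟨hA.resolve_left hAS, by simp [hg, hAS]⟩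
  refine ⟨g, fun A hA B hB hAB => ?_, fun A hA B hB C hC hab hbc => ?_⟩
  · rcases cs A hA with ⟨hA', ha⟩ | ⟨hA', ha⟩ <;> rcases cs B hB with ⟨hB', hb⟩ | ⟨hB', hb⟩ <;>
      rw [ha, hb] at hAB
    · exact hg₁ hA' hB' hAB
    · have := hM' A hA'; have := hL' B hB'; omega
    · have := hM' B hB'; have := hL' A hA'; omega
    · exact hg₂ hA' hB' (by omega)
  · rcases cs A hA with ⟨hA', ha⟩ | ⟨hA', ha⟩ <;> rcases cs C hC with ⟨hC', hc⟩ | ⟨hC', hc⟩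
    · rcases cs B hB with ⟨hB', hb⟩ | ⟨hB', hb⟩
      · exact h₁ A hA' B hB' C hC' (by omega) (by omega)
      · have := hM' C hC'; have := hL' B hB'; omega
    · exact .of_not_meets (h A hA' C hC')
    · have := hM' C hC'; have := hL' A hA'; omega
    · rcases cs B hB with ⟨hB', hb⟩ | ⟨hB', hb⟩
      · have := hM' B hB'; have := hL' A hA'; omega
      · exact h₂ A hA' B hB' C hC' (by omega) (by omega)

theorem exists_enumeration {R : Set (Set α)} (hR : R.Finite) {g : Set α → ℤ} (hg : InjOn g R) :
    ∃ A : ℕ → Set α, InjOn A (Iio R.ncard) ∧ A '' Iio R.ncard = R ∧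
      ∀ i j, i < j → j < R.ncard → g (A i) < g (A j) := by
  classical
  set T : Finset ℤ := hR.toFinset.image g with hT
  have hcard : T.card = R.ncard := by
    rw [hT, Finset.card_image_of_injOn (by simpa using hg), ncard_eq_toFinset_card R hR]
  have key : ∀ i : Fin R.ncard, ∃ B ∈ R, g B = T.orderEmbOfFin hcard i := by
    intro i
    have := T.orderEmbOfFin_mem hcard i
    obtain ⟨B, hB, h⟩ := Finset.mem_image.1 this
    exact ⟨B, by simpa using hB, h⟩
  choose B hB hgB using key
  have mono : ∀ i j : Fin R.ncard, i < j → g (B i) < g (B j) := by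
    intro i j hij
    rw [hgB, hgB]
    exact (T.orderEmbOfFin hcard).strictMono hij
  refine ⟨fun n => if h : n < R.ncard then B ⟨n, h⟩ else ∅, ?_, ?_, ?_⟩
  · intro i hi j hj hij
    simp only [mem_Iio] at hi hj
    simp only [hi, hj, dif_pos] at hij
    by_contra hne
    rcases lt_or_gt_of_ne hne with h | h
    · exact (mono ⟨i, hi⟩ ⟨j, hj⟩ h).ne (by rw [hij])
    · exact (mono ⟨j, hj⟩ ⟨i, hi⟩ h).ne (by rw [hij])
  · ext P
    constructor
    · rintro ⟨n, hn, rfl⟩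
      simp only [mem_Iio] at hn
      simp only [hn, dif_pos]
      exact hB _
    · intro hP
      have : g P ∈ T := by simpa [hT] using ⟨P, hP, rfl⟩
      rw [← Finset.mem_coe, ← T.range_orderEmbOfFin hcard] at this
      obtain ⟨i, hi⟩ := this
      refine ⟨i, i.2, ?_⟩
      simp only [i.2, dif_pos]
      exact hg (hB _) hP (by rw [← hi, ← hgB])
  · intro i j hij hj
    have hi := hij.trans hj
    simp only [hi, hj, dif_pos]
    exact mono ⟨i, hi⟩ ⟨j, hj⟩ hij

/-- The slot is the first index whose set is ranked above X, or k if there is none. -/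
theorem exists_fitsAt {A : ℕ → Set α} {k : ℕ} {X : Set α} {f : Set α → ℤ}
    (hf : InjOn f F) (hB : ∀ P ∈ F, ∀ Q ∈ F, ∀ R ∈ F, f P < f Q → f Q < f R → Btw P Q R)
    (hAF : ∀ i < k, A i ∈ F) (hX : X ∈ F) (hAX : ∀ i < k, A i ≠ X)
    (hmono : ∀ i j, i < j → j < k → f (A i) < f (A j)) (hmeet : ∃ i < k, Meets X (A i)) :
    ∃ s, FitsAt A k X s := by
  classical
  have hex : ∃ s, k ≤ s ∨ f X < f (A s) := ⟨k, Or.inl le_rfl⟩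
  set s := Nat.find hex with hs
  have hsk : s ≤ k := Nat.find_min' hex (Or.inl le_rfl)
  have lo : ∀ i, i < s → f (A i) < f X := by
    intro i hi
    have h := Nat.find_min hex hi
    push Not at h
    exact lt_of_le_of_ne h.2 (hf.ne (hAF i h.1) hX (hAX i h.1))
  have hi : ∀ i, s ≤ i → i < k → f X < f (A i) := by
    intro i hi hik
    have h := (Nat.find_spec hex).resolve_left (by omega)
    rcases hi.lt_or_eq with h1 | h1
    · exact h.trans (hmono s i h1 hik)
    · rwa [← h1]
  exact ⟨s, hsk,
    fun i j hij hj hsi => hB _ hX _ (hAF i (by omega)) _ (hAF j hj) (hi i hsi (by omega))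
      (hmono i j hij hj),
    fun i j his hsj hj => hB _ (hAF i (by omega)) _ hX _ (hAF j hj) (lo i his) (hi j hsj hj),
    fun i j hij hjs => hB _ (hAF i (by omega)) _ (hAF j (by omega)) _ hX (hmono i j hij (by omega))
      (lo j hjs), hmeet⟩

theorem strictMono_of_consecutive {f : ℕ → ℤ} {k : ℕ} (h01 : f 0 < f 1)
    (h : ∀ i, i + 2 < k → (f i < f (i + 1) ∧ f (i + 1) < f (i + 2)) ∨
      (f (i + 2) < f (i + 1) ∧ f (i + 1) < f i)) :
    ∀ i j, i < j → j < k → f i < f j := by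
  have step : ∀ i, i + 1 < k → f i < f (i + 1) := by
    intro i
    induction i with
    | zero => intro _; exact h01
    | succ i ih =>
      intro hi
      have := ih (by omega)
      rcases h i hi with h1 | h1
      · exact h1.2
      · omega
  intro i j hij
  induction j, hij using Nat.le_induction with
  | base => intro hj; exact step i hj
  | succ j hj ih => intro hjk; exact (ih (by omega)).trans (step j hjk)

/-- A compatible ranking of a chain is unique up to reversal. -/
theorem IsClean.mono_or_anti (hF : IsClean F) {A : ℕ → Set α} {k : ℕ} {f : Set α → ℤ}
    {G : Set (Set α)} (hf : InjOn f G)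
    (hB : ∀ P ∈ G, ∀ Q ∈ G, ∀ R ∈ G, f P < f Q → f Q < f R → Btw P Q R)
    (hAF : ∀ i < k, A i ∈ F) (hAG : ∀ i < k, A i ∈ G) (hinj : InjOn A (Iio k)) (hk : 2 ≤ k)
    (hA : ∀ i j l, i < j → j < l → l < k → Btw (A i) (A j) (A l))
    (hm : ∀ i, i + 1 < k → Meets (A i) (A (i + 1))) :
    (∀ i j, i < j → j < k → f (A i) < f (A j)) ∨
      (∀ i j, i < j → j < k → f (A j) < f (A i)) := by
  have ne : ∀ i j, i < k → j < k → i ≠ j → A i ≠ A j := fun i j hi hj hij => hinj.ne hi hj hij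
  have hfne : ∀ i j, i < k → j < k → i ≠ j → f (A i) ≠ f (A j) := fun i j hi hj hij =>
    hf.ne (hAG i hi) (hAG j hj) (ne i j hi hj hij)
  have key : ∀ i, i + 2 < k → (f (A i) < f (A (i + 1)) ∧ f (A (i + 1)) < f (A (i + 2))) ∨
      (f (A (i + 2)) < f (A (i + 1)) ∧ f (A (i + 1)) < f (A i)) := by
    intro i hi
    have h0 := hA i (i + 1) (i + 2) (by omega) (by omega) hi
    -- A connected triple in an antichain has only one possible middle, so f places `A (i + 1)`
    -- between its neighbours. Monotonicity then propagates along the chain.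
    have n1 := h0.not_left_of_btw (hm (i + 1) hi) fun h =>
      ne (i + 1) i (by omega) (by omega) (by omega)
        (hF.sperner _ (hAF _ (by omega)) _ (hAF _ (by omega)) h)
    have n2 := h0.symm.not_left_of_btw (hm i (by omega)).symm fun h =>
      ne (i + 1) (i + 2) (by omega) (by omega) (by omega)
        (hF.sperner _ (hAF _ (by omega)) _ (hAF _ (by omega)) h)
    have a0 := hAG i (by omega)
    have a1 := hAG (i + 1) (by omega)
    have a2 := hAG (i + 2) (by omega)
    have b1 := fun h h' => n1 (hB _ a1 _ a0 _ a2 h h')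
    have b2 := fun h h' => n1 (hB _ a2 _ a0 _ a1 h h').symm
    have b3 := fun h h' => n2 (hB _ a1 _ a2 _ a0 h h')
    have b4 := fun h h' => n2 (hB _ a0 _ a2 _ a1 h h').symm
    have e1 := hfne i (i + 1) (by omega) (by omega) (by omega)
    have e2 := hfne i (i + 2) (by omega) (by omega) (by omega)
    have e3 := hfne (i + 1) (i + 2) (by omega) (by omega) (by omega)
    rcases lt_or_gt_of_ne e1 with l1 | l1 <;> rcases lt_or_gt_of_ne e2 with l2 | l2 <;>
      rcases lt_or_gt_of_ne e3 with l3 | l3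
    all_goals first | exact Or.inl ⟨l1, l3⟩ | exact Or.inr ⟨l3, l1⟩ | exfalso
    · exact b4 l2 l3
    · exact b2 l2 l1
    · exact b1 l1 l2
    · exact b3 l3 l2
  rcases lt_or_gt_of_ne (hfne 0 1 (by omega) (by omega) (by omega)) with h | h
  · exact Or.inl (strictMono_of_consecutive (f := fun i => f (A i)) h key)
  · right
    have := strictMono_of_consecutive (f := fun i => -f (A i)) (k := k) (by simpa using h)
      (fun i hi => by rcases key i hi with h | h <;> simp only [neg_lt_neg_iff] <;> tauto)
    intro i j hij hj
    simpa using this i j hij hj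

/-- A clean family with at least four members is orderable if all its proper subfamilies are. -/
theorem IsClean.orderable (hF : IsClean F) (hfin : F.Finite) (hcard : 4 ≤ F.ncard)
    (hmin : ∀ H ∈ F, Orderable (F \ {H}) id) : Orderable F id := by
  by_contra hcon
  -- Otherwise F splits into two proper parts with no meetings across; each is orderable by
  -- minimality, and so is their union.
  have hconn : IsConn F := by
    rintro S hSF ⟨P, hP⟩ ⟨Q, hQ⟩
    by_contra h
    push Not at h
    apply hcon
    rw [← union_sdiff_cancel hSF]
    refine ((hmin Q hQ.1).mono fun R hR => ⟨hSF hR, ?_⟩).union_of_not_meets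
      ((hmin P (hSF hP)).mono fun R hR => ⟨hR.1, ?_⟩) (hfin.subset hSF) (hfin.subset sdiff_subset) h
    · rintro rfl; exact hQ.2 hR
    · rintro rfl; exact hR.2 hP
  have two : ∀ (G : Set (Set α)) (Z : Set α), G.Finite → 2 ≤ G.ncard → ∃ Y ∈ G, Y ≠ Z := by
    intro G Z hG h2
    exact exists_ne_of_one_lt_ncard (by omega) Z
  obtain ⟨Z₀, hZ₀⟩ : F.Nonempty := nonempty_of_ncard_ne_zero (by omega)
  obtain ⟨X, hX, -, hXc⟩ := hconn.exists_diff_singleton hfin hZ₀ (two F Z₀ hfin (by omega))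
  have hc1 : (F \ {X}).ncard + 1 = F.ncard := ncard_sdiff_singleton_add_one hX hfin
  have hfin1 : (F \ {X}).Finite := hfin.subset sdiff_subset
  obtain ⟨X', hX', Z, hZ, hXZ⟩ := hconn {X} (by simpa using hX) (singleton_nonempty X)
    (nonempty_of_ncard_ne_zero (by omega))
  obtain rfl := mem_singleton_iff.1 hX'
  -- Y is chosen different from the neighbour Z of X, so that X still meets the remaining chain.
  obtain ⟨Y, hY, hYZ, hYc⟩ := hXc.exists_diff_singleton hfin1 hZ (two _ Z hfin1 (by omega))
  have hYX : Y ≠ X' := fun h => hY.2 h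
  have hc2 : ((F \ {X'}) \ {Y}).ncard + 1 = (F \ {X'}).ncard :=
    ncard_sdiff_singleton_add_one hY hfin1
  set R := (F \ {X'}) \ {Y} with hR
  have hRfin : R.Finite := hfin1.subset sdiff_subset
  obtain ⟨g, hg, hgB⟩ := hmin X' hX
  obtain ⟨h, hh, hhB⟩ := hmin Y hY.1
  obtain ⟨A, hAinj, hAR, hAg⟩ := exists_enumeration hRfin (hg.mono (sdiff_subset : R ⊆ F \ {X'}))
  set k := R.ncard with hk
  have hk2 : 2 ≤ k := by omega
  have hA : ∀ i < k, A i ∈ R := fun i hi => hAR ▸ mem_image_of_mem A hi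
  have hAF : ∀ i < k, A i ∈ F := fun i hi => (hA i hi).1.1
  have hAX : ∀ i < k, A i ≠ X' := fun i hi => (hA i hi).1.2
  have hAY : ∀ i < k, A i ≠ Y := fun i hi => (hA i hi).2
  have hAB : ∀ i j l, i < j → j < l → l < k → Btw (A i) (A j) (A l) := fun i j l hij hjl hl =>
    hgB _ (hA i (by omega)).1 _ (hA j (by omega)).1 _ (hA l hl).1 (hAg i j hij (by omega))
      (hAg j l hjl hl)
  have surj : ∀ B ∈ R, ∃ i < k, A i = B := fun B hB => by
    rw [← hAR] at hB; exact hB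
  -- Connectedness gives two sets that meet across the cut after i; betweenness carries their common
  -- point to `A i` and `A (i + 1)`.
  have hm : ∀ i, i + 1 < k → Meets (A i) (A (i + 1)) := by
    intro i hi
    obtain ⟨P, ⟨a, ha, rfl⟩, Q, ⟨hQ, hQ'⟩, c, hc1, hc2⟩ := hYc (A '' Iic i)
      (by rintro _ ⟨a, ha, rfl⟩; simp only [mem_Iic] at ha; exact hA a (by omega))
      ⟨A i, i, by simp, rfl⟩
      ⟨A (i + 1), hA _ hi, by
        rintro ⟨a, ha, hai⟩
        simp only [mem_Iic] at ha
        have := hAinj (by simp only [mem_Iio]; omega) (by simpa using hi) hai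
        omega⟩
    obtain ⟨b, hb, rfl⟩ := surj Q hQ
    simp only [mem_Iic] at ha
    have hib : i < b := by
      by_contra h
      exact hQ' ⟨b, by simp only [mem_Iic]; omega, rfl⟩
    have hci : c ∈ A i := by
      rcases ha.lt_or_eq with h | rfl
      · exact (hAB a i b h hib hb).mem hc1 hc2
      · exact hc1
    rcases (show i + 1 ≤ b by omega).lt_or_eq with h | rfl
    · exact ⟨c, hci, (hAB i (i + 1) b (by omega) h hb).mem hci hc2⟩
    · exact ⟨c, hci, hc2⟩
  have hXm : ∃ i < k, Meets X' (A i) := by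
    obtain ⟨i, hi, rfl⟩ := surj Z ⟨hZ, fun h => hYZ h.symm⟩
    exact ⟨i, hi, hXZ⟩
  have hYm : ∃ i < k, Meets Y (A i) := by
    obtain ⟨Y', hY', Q, hQ, hYQ⟩ := hXc {Y} (by simpa using hY) (singleton_nonempty Y)
      (show R.Nonempty from nonempty_of_ncard_ne_zero (by omega))
    obtain rfl := mem_singleton_iff.1 hY'
    obtain ⟨i, hi, rfl⟩ := surj Q hQ
    exact ⟨i, hi, hYQ⟩
  obtain ⟨t, ht⟩ := exists_fitsAt hg hgB (fun i hi => (hA i hi).1) hY hAY hAg hYm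
  have hAGY : ∀ i < k, A i ∈ F \ {Y} := fun i hi => ⟨hAF i hi, hAY i hi⟩
  have hXGY : X' ∈ F \ {Y} := ⟨hX, hYX.symm⟩
  -- The rankings of F \ {X} and F \ {Y} agree on the chain up to reversal; reverse the second one
  -- if necessary.
  obtain ⟨s, hs⟩ : ∃ s, FitsAt A k X' s := by
    rcases hF.mono_or_anti hh hhB hAF hAGY hAinj hk2 hAB hm with hmono | hanti
    · exact exists_fitsAt hh hhB hAGY hXGY hAX hmono hXm
    · refine exists_fitsAt (f := fun P => - h P)
        (fun P hP Q hQ hPQ => hh hP hQ (by simpa using hPQ))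
        (fun P hP Q hQ R hR h1 h2 => (hhB R hR Q hQ P hP (by simpa using h2)
          (by simpa using h1)).symm) hAGY hXGY hAX (fun i j hij hj => ?_) hXm
      simpa using hanti i j hij hj
  have := hF.orderable_of_fits hAF hX hY.1 hYX.symm hAX hAY hAinj hAB hm hk2 hs ht
  rw [hAR, hR, insert_sdiff_singleton, insert_eq_of_mem hY, insert_sdiff_singleton,
    insert_eq_of_mem hX] at this
  exact hcon this

end Connected

/-! ### Orderable families and interval hypergraphs -/

section Interval

variable {α ι : Type*}

/-- Rank by left endpoints. In an antichain of intervals the right endpoints increase along with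
them, which gives betweenness. -/
theorem orderable_of_intervals {F : Set ι} {Q : ι → Set α} {n : ℕ} {f : Fin n → α}
    (hf : Function.Injective f) (hQ : ∀ A ∈ F, ∃ i j : Fin n, i ≤ j ∧ Q A = f '' Icc i j)
    (hS : ∀ A ∈ F, ∀ B ∈ F, Q A ⊆ Q B → A = B) : Orderable F Q := by
  classical
  rcases F.eq_empty_or_nonempty with rfl | ⟨A₀, hA₀⟩
  · exact ⟨fun _ => 0, by simp, by simp⟩
  obtain ⟨i₀, -, -⟩ := hQ A₀ hA₀
  have : Nonempty (Fin n) := ⟨i₀⟩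
  choose! lo hi hlh hQ using hQ
  have mem : ∀ A ∈ F, ∀ u, f u ∈ Q A ↔ lo A ≤ u ∧ u ≤ hi A := by
    intro A hA u
    rw [hQ A hA, hf.mem_set_image, mem_Icc]
  have ex : ∀ A ∈ F, ∀ x ∈ Q A, ∃ u, f u = x := by
    intro A hA x hx
    rw [hQ A hA] at hx
    obtain ⟨u, -, rfl⟩ := hx
    exact ⟨u, rfl⟩
  have sub : ∀ A ∈ F, ∀ B ∈ F, lo B ≤ lo A → hi A ≤ hi B → A = B := by
    intro A hA B hB h1 h2
    refine hS A hA B hB fun x hx => ?_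
    obtain ⟨u, rfl⟩ := ex A hA x hx
    rw [mem B hB]
    have := (mem A hA u).1 hx
    exact ⟨h1.trans this.1, this.2.trans h2⟩
  have mono : ∀ A ∈ F, ∀ B ∈ F, lo A < lo B → hi A < hi B := by
    intro A hA B hB h
    by_contra h'
    have := sub B hB A hA h.le (not_lt.1 h')
    subst this
    exact h.false
  refine ⟨fun A => (lo A : ℕ), fun A hA B hB hAB => ?_, fun A hA B hB C hC h1 h2 => ?_⟩
  · have h : lo A = lo B := by
      have h : ((lo A : ℕ) : ℤ) = (lo B : ℕ) := hAB
      exact Fin.ext (by exact_mod_cast h)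
    rcases le_total (hi A) (hi B) with h' | h'
    · exact sub A hA B hB h.ge h'
    · exact (sub B hB A hA h.le h').symm
  · replace h1 : lo A < lo B := by
      have h : ((lo A : ℕ) : ℤ) < (lo B : ℕ) := h1
      exact_mod_cast h
    replace h2 : lo B < lo C := by
      have h : ((lo B : ℕ) : ℤ) < (lo C : ℕ) := h2
      exact_mod_cast h
    have h3 := mono A hA B hB h1
    have h4 := mono B hB C hC h2
    constructor
    · rintro x ⟨hxA, hxC⟩
      obtain ⟨u, rfl⟩ := ex A hA x hxA
      rw [mem A hA] at hxA
      rw [mem C hC] at hxC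
      rw [mem B hB]
      exact ⟨h2.le.trans hxC.1, hxA.2.trans h3.le⟩
    · rintro ⟨y, hyA, hyC⟩ x hxB
      obtain ⟨w, rfl⟩ := ex A hA y hyA
      rw [mem A hA] at hyA
      rw [mem C hC] at hyC
      obtain ⟨u, rfl⟩ := ex B hB x hxB
      rw [mem B hB] at hxB
      rcases le_total u (hi A) with h | h
      · exact Or.inl ((mem A hA u).2 ⟨h1.le.trans hxB.1, h⟩)
      · exact Or.inr ((mem C hC u).2 ⟨hyC.1.trans (hyA.2.trans h), hxB.2.trans h4.le⟩)

/-- s and t are the first and last rank of an edge through v. For an isolated v the value s exceeds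
every rank, which will push v behind all edges; t is then irrelevant. -/
theorem exists_extreme_ranks {F : Set (Set α)} (hF : F.Finite) (g : Set α → ℤ) (v : α) :
    ∃ s t : ℤ, ((∃ e ∈ F, v ∈ e) → (∃ e ∈ F, v ∈ e ∧ g e = s) ∧ (∃ e ∈ F, v ∈ e ∧ g e = t) ∧
      ∀ e ∈ F, v ∈ e → s ≤ g e ∧ g e ≤ t) ∧ ((¬ ∃ e ∈ F, v ∈ e) → ∀ e ∈ F, g e < s) := by
  by_cases h : ∃ e ∈ F, v ∈ e
  · have hfin : {e ∈ F | v ∈ e}.Finite := hF.subset (sep_subset _ _)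
    obtain ⟨e, he, hv⟩ := h
    obtain ⟨e₁, he₁, hmin⟩ := exists_min_image _ g hfin ⟨e, he, hv⟩
    obtain ⟨e₂, he₂, hmax⟩ := exists_max_image _ g hfin ⟨e, he, hv⟩
    exact ⟨g e₁, g e₂, fun _ => ⟨⟨e₁, he₁.1, he₁.2, rfl⟩, ⟨e₂, he₂.1, he₂.2, rfl⟩,
      fun e he hv => ⟨hmin e ⟨he, hv⟩, hmax e ⟨he, hv⟩⟩⟩, fun h' => (h' ⟨e, he, hv⟩).elim⟩
  · obtain ⟨M, hM⟩ := (hF.image g).bddAbove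
    refine ⟨M + 1, 0, fun h' => (h h').elim, fun _ e he => ?_⟩
    have := hM ⟨e, he, rfl⟩
    omega

/-- Sort the vertices lexicographically by the first and the last rank of an edge through them;
every edge then occupies consecutive positions. -/
theorem isIntervalHypergraph_of_orderable {H : Hypergraph α} (hV : H.vertexSet.Finite)
    (hne : ∀ e ∈ H.edgeSet, e.Nonempty) (h : Orderable H.edgeSet id) :
    IsIntervalHypergraph H := by
  classical
  have hsub : ∀ e ∈ H.edgeSet, e ⊆ H.vertexSet := fun e he =>
    H.subset_vertexSet_of_mem_edgeSet' he
  have hF : H.edgeSet.Finite := hV.finite_subsets.subset fun e he => hsub e he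
  obtain ⟨g, hg, hB⟩ := h
  choose s t hcov hunc using exists_extreme_ranks hF g
  have := hV.fintype
  let e := (Fintype.equivFin H.vertexSet).symm
  let key : Fin (Fintype.card H.vertexSet) → ℤ ×ₗ ℤ := fun i => toLex (s (e i), t (e i))
  let σ := Tuple.sort key
  have hmono : Monotone (key ∘ σ) := Tuple.monotone_sort key
  let f : Fin (Fintype.card H.vertexSet) → α := fun i => e (σ i)
  have hfinj : Function.Injective f := fun i j hij =>
    σ.injective (e.injective (Subtype.ext hij))
  have hfV : ∀ i, f i ∈ H.vertexSet := fun i => (e (σ i)).2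
  have hsurj : ∀ v ∈ H.vertexSet, ∃ i, f i = v := fun v hv =>
    ⟨σ.symm (e.symm ⟨v, hv⟩), by simp [f]⟩
  have hle : ∀ i j, i ≤ j → s (f i) < s (f j) ∨ s (f i) = s (f j) ∧ t (f i) ≤ t (f j) := by
    intro i j hij
    exact Prod.Lex.le_iff.1 (hmono hij)
  refine ⟨_, f, ⟨fun i _ => hfV i, hfinj.injOn, fun v hv => ?_⟩, fun A hA => ?_⟩
  · obtain ⟨i, rfl⟩ := hsurj v hv
    exact ⟨i, mem_univ i, rfl⟩
  · set I : Finset (Fin (Fintype.card H.vertexSet)) := Finset.univ.filter (fun i => f i ∈ A) with hI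
    have hIne : I.Nonempty := by
      obtain ⟨v, hv⟩ := hne A hA
      obtain ⟨i, rfl⟩ := hsurj v (hsub A hA hv)
      exact ⟨i, by simpa [hI] using hv⟩
    have hv : f (I.min' hIne) ∈ A := by simpa [hI] using I.min'_mem hIne
    have hw : f (I.max' hIne) ∈ A := by simpa [hI] using I.max'_mem hIne
    refine ⟨I.min' hIne, I.max' hIne, I.min'_le _ (I.max'_mem hIne), Subset.antisymm ?_ ?_⟩
    · intro x hx
      obtain ⟨i, rfl⟩ := hsurj x (hsub A hA hx)
      have hiI : i ∈ I := by simpa [hI] using hx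
      exact ⟨i, ⟨I.min'_le _ hiI, I.le_max' _ hiI⟩, rfl⟩
    · rintro _ ⟨u, ⟨hu1, hu2⟩, rfl⟩
      by_contra huA
      have l1 := hle _ _ hu1
      have l2 := hle _ _ hu2
      obtain ⟨⟨ev, hev, hvev, gev⟩, -, bv⟩ := hcov _ ⟨A, hA, hv⟩
      obtain ⟨-, -, bw⟩ := hcov _ ⟨A, hA, hw⟩
      have bvA := bv A hA hv
      have bwA := bw A hA hw
      have hcu : ∃ e ∈ H.edgeSet, f u ∈ e := by
        by_contra hcu
        have := hunc _ hcu A hA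
        omega
      obtain ⟨⟨es, hes, hues, ges⟩, ⟨et, het, huet, get⟩, bu⟩ := hcov _ hcu
      have n1 : g es ≠ g A := fun h => huA (hg hes hA h ▸ hues)
      have n2 : g et ≠ g A := fun h => huA (hg het hA h ▸ huet)
      have hst := bu es hes hues
      -- Edges through u on both sides of A would put u into A by betweenness; as the first rank of
      -- u is below A, so is the last.
      have htA : g et < g A := by
        by_contra hcon
        exact huA ((hB es hes A hA et het (by omega) (by omega)).mem hues huet)
      -- The first rank of v is strictly below that of u, since a tie would give t(v) ≤ t(u) < g A ≤
      -- t(v). Thus `et` lies between `ev` and A, which share v, and u falls into `ev`, too early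
      -- for its first rank, or into A.
      have := (hB ev hev et het A hA (by omega) htA).cover ⟨_, hvev, hv⟩ huet
      rcases this with h | h
      · have := bu ev hev h
        omega
      · exact huA h

end Interval

/-! ### Minimal obstructions: cycles and claws -/

section Shapes

variable {α : Type*} {d : ℕ} {E : Set α} {F : Set (Set α)}

/-- A minimal non-orderable family of subsets of `E` of size at least `d` meeting pairwise in
at most `d - 2` points, all of whose one-point links and deletions are orderable. -/
structure IsObstruction (d : ℕ) (E : Set α) (F : Set (Set α)) : Prop where
  three_le : 3 ≤ d
  finite : F.Finite
  finite_mem : ∀ A ∈ F, A.Finite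
  le_ncard : ∀ A ∈ F, d ≤ A.ncard
  inter : ∀ A ∈ F, ∀ B ∈ F, A ≠ B → (A ∩ B).ncard + 2 ≤ d
  link : ∀ v, Orderable {H ∈ F | v ∈ H} (fun H => H \ {v})
  subset_ground : ∀ A ∈ F, A ⊆ E
  del : ∀ v ∈ E, Orderable {H ∈ F | d ≤ (H \ {v}).ncard} (fun H => H \ {v})
  not_orderable : ¬ Orderable F id
  minimal : ∀ H ∈ F, Orderable (F \ {H}) id

/-- A chordless cycle of sets, no three of which have a common point. -/
structure IsCycle {m : ℕ} (A : ZMod m → Set α) : Prop where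
  three_le : 3 ≤ m
  meets : ∀ i, Meets (A i) (A (i + 1))
  disj : ∀ i j, j ≠ i → j ≠ i + 1 → i ≠ j + 1 → ¬ Meets (A i) (A j)
  triple : ∀ i j, j ≠ i → j ≠ i + 1 → ∀ x, x ∈ A i → x ∈ A (i + 1) → x ∉ A j

theorem two_ne_zero_zmod {m : ℕ} (hm : 3 ≤ m) : (2 : ZMod m) ≠ 0 := by
  intro h0
  have := (ZMod.natCast_eq_zero_iff 2 m).1 (by exact_mod_cast h0)
  have := Nat.le_of_dvd (by norm_num) this
  omega

namespace IsCycle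

variable {m : ℕ} {A : ZMod m → Set α}

theorem add_one_ne (h : IsCycle A) (i : ZMod m) : i + 1 ≠ i := by
  have : Fact (1 < m) := ⟨by have := h.three_le; omega⟩
  simp

theorem sub_one_ne (h : IsCycle A) (i : ZMod m) : i - 1 ≠ i := by
  have : Fact (1 < m) := ⟨by have := h.three_le; omega⟩
  simp

theorem add_two_ne (h : IsCycle A) (i : ZMod m) : i + 2 ≠ i := by
  intro h0
  apply two_ne_zero_zmod h.three_le
  linear_combination h0

theorem injective (h : IsCycle A) : Function.Injective A := by
  intro i j hij
  by_contra hne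
  obtain ⟨x, hx1, hx2⟩ := h.meets i
  obtain ⟨y, hy1, hy2⟩ := h.meets j
  have hj : j = i + 1 := by
    by_contra hj
    exact h.triple i j (Ne.symm hne) hj x hx1 hx2 (hij ▸ hx1)
  have hi : i = j + 1 := by
    by_contra hi
    exact h.triple j i hne hi y hy1 hy2 (hij ▸ hy1)
  rw [hj] at hi
  exact h.add_two_ne i (by linear_combination -hi)

theorem not_orderable (h : IsCycle A) : ¬ Orderable (range A) id := by
  choose x hx using h.meets
  exact not_orderable_of_cycle h.three_le A (fun i => ⟨i, rfl⟩) x hx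
    fun i j hj hj' => h.triple i j hj hj' _ (hx i).1 (hx i).2

/-- A point lies in at most two members of the cycle. -/
theorem eq_or_eq_of_mem (h : IsCycle A) {i j l : ZMod m} {x : α} (hij : i ≠ j) (hi : x ∈ A i)
    (hj : x ∈ A j) (hl : x ∈ A l) : l = i ∨ l = j := by
  by_contra hcon
  rw [not_or] at hcon
  have : j = i + 1 ∨ i = j + 1 := by
    by_contra h'
    rw [not_or] at h'
    exact h.disj i j hij.symm h'.1 h'.2 ⟨x, hi, hj⟩
  rcases this with rfl | rfl
  · exact h.triple i l hcon.1 hcon.2 x hi hj hl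
  · exact h.triple j l hcon.2 hcon.1 x hj hi hl

end IsCycle

/-- A chordless cyclic sequence of at least four sets is a cycle. -/
theorem isCycle_of_sequence {N : ℕ} (hN : 4 ≤ N) {W : ℕ → Set α}
    (hm : ∀ i, i + 1 < N → Meets (W i) (W (i + 1))) (hm' : Meets (W (N - 1)) (W 0))
    (hd : ∀ i j, i + 2 ≤ j → j < N → (i = 0 → j + 1 < N) → ¬ Meets (W i) (W j)) :
    IsCycle (fun z : ZMod N => W z.val) := by
  have : NeZero N := ⟨by omega⟩
  have : Fact (1 < N) := ⟨by omega⟩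
  have hv : ∀ z : ZMod N, (z.val + 1 < N ∧ (z + 1).val = z.val + 1) ∨
      (z.val = N - 1 ∧ (z + 1).val = 0) := by
    intro z
    have hz := z.val_lt
    have h1 := ZMod.val_add z 1
    rw [ZMod.val_one] at h1
    rcases (show z.val + 1 ≤ N by omega).lt_or_eq with h | h
    · left; exact ⟨h, by rw [h1, Nat.mod_eq_of_lt h]⟩
    · right; exact ⟨by omega, by rw [h1, h, Nat.mod_self]⟩
  have key : ∀ i j : ZMod N, i.val < j.val → j ≠ i + 1 → i ≠ j + 1 →
      ¬ Meets (W i.val) (W j.val) := by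
    intro i j hlt h1 h2
    have hj := j.val_lt
    refine hd _ _ ?_ hj ?_
    · rcases hv i with ⟨h3, h4⟩ | ⟨h3, h4⟩
      · have : j.val ≠ i.val + 1 := fun h => h1 (ZMod.val_injective N (by rw [h, h4]))
        omega
      · omega
    · intro h0
      rcases hv j with ⟨h3, h4⟩ | ⟨h3, h4⟩
      · exact h3
      · exact (h2 (ZMod.val_injective N (by rw [h0, h4]))).elim
  have disj : ∀ i j : ZMod N, j ≠ i → j ≠ i + 1 → i ≠ j + 1 → ¬ Meets (W i.val) (W j.val) := by
    intro i j h0 h1 h2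
    rcases lt_or_gt_of_ne (fun h => h0 (ZMod.val_injective N h) : j.val ≠ i.val) with h | h
    · exact fun hm => key j i h h2 h1 hm.symm
    · exact key i j h h1 h2
  refine ⟨by omega, fun z => ?_, disj, fun i j h0 h1 x hx1 hx2 hxj => ?_⟩
  · rcases hv z with ⟨h1, h2⟩ | ⟨h1, h2⟩
    · simp only [h2]; exact hm _ h1
    · simp only [h2, h1]; exact hm'
  -- For j = i - 1 it is j and i + 1 that are not neighbours, because 3 ≠ 0 modulo N ≥ 4.
  · by_cases h2 : i = j + 1
    · refine disj (i + 1) j h1 ?_ ?_ ⟨x, hx2, hxj⟩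
      · intro h3
        have h4 : (3 : ZMod N) = 0 := by linear_combination -h2 - h3
        have := (ZMod.natCast_eq_zero_iff 3 N).1 (by exact_mod_cast h4)
        have := Nat.le_of_dvd (by norm_num) this
        omega
      · intro h3
        rw [← h2] at h3
        simp at h3
    · exact disj i j h0 h1 h2 ⟨x, hx1, hxj⟩

theorem orderable_of_ncard_le_two (hF : F.Finite) (h : F.ncard ≤ 2) : Orderable F id := by
  obtain ⟨g, hg⟩ : ∃ g : Set α → ℕ, InjOn g F := countable_iff_exists_injOn.1 hF.countable
  refine ⟨fun A => g A, fun A hA B hB hAB => hg hA hB (by simpa using hAB),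
    fun A hA B hB C hC h1 h2 => ?_⟩
  have : 2 < F.ncard := (two_lt_ncard_iff hF).2 ⟨A, B, C, hA, hB, hC, by rintro rfl; omega,
    by rintro rfl; omega, by rintro rfl; omega⟩
  omega

theorem orderable_of_btw {A B C : Set α} (h : Btw A B C) (hAB : A ≠ B) (hBC : B ≠ C)
    (hAC : A ≠ C) : Orderable {A, B, C} id := by
  -- The chain is the single set B at position 2, with A at 0 and C at 4.
  have key := orderable_insert_two (A := fun _ => B) (k := 1) (X := A) (Y := C) (p := 0) (q := 4)
    (by omega) (by omega) (by omega) (by omega) (by omega) (by omega) (by omega) (by omega)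
    (by omega) (by omega) (by omega) (fun _ _ _ _ => h) (by omega) (by omega) (by omega)
    (by omega)
  refine key.mono ?_
  rintro X (rfl | rfl | rfl)
  · simp
  · right; right; exact ⟨0, by simp, rfl⟩
  · simp

/-- Three sets with a common point, each having a private point, are not orderable. -/
theorem not_orderable_of_star {ι : Type*} {F : Set ι} {Q : ι → Set α} {a b c : ι} (ha : a ∈ F)
    (hb : b ∈ F) (hc : c ∈ F) {v x y z : α} (hv : v ∈ Q a ∧ v ∈ Q b ∧ v ∈ Q c)
    (hx : x ∈ Q a ∧ x ∉ Q b ∧ x ∉ Q c) (hy : y ∉ Q a ∧ y ∈ Q b ∧ y ∉ Q c)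
    (hz : z ∉ Q a ∧ z ∉ Q b ∧ z ∈ Q c) : ¬ Orderable F Q := by
  intro h
  have hab : a ≠ b := by rintro rfl; exact hx.2.1 hx.1
  have hbc : b ≠ c := by rintro rfl; exact hy.2.2 hy.2.1
  have hac : a ≠ c := by rintro rfl; exact hx.2.2 hx.1
  rcases h.btw_of_triple ha hb hc hab hbc hac with h | h | h
  · rcases h.cover ⟨v, hv.1, hv.2.2⟩ hy.2.1 with h | h
    · exact hy.1 h
    · exact hy.2.2 h
  · rcases h.cover ⟨v, hv.2.1, hv.1⟩ hz.2.2 with h | h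
    · exact hz.2.1 h
    · exact hz.1 h
  · rcases h.cover ⟨v, hv.2.2, hv.2.1⟩ hx.1 with h | h
    · exact hx.2.2 h
    · exact hx.2.1 h

namespace IsObstruction

theorem sperner (hF : IsObstruction d E F) : ∀ P ∈ F, ∀ Q ∈ F, P ⊆ Q → P = Q := by
  intro P hP Q hQ h
  by_contra hne
  have h1 := hF.inter P hP Q hQ hne
  rw [inter_eq_left.2 h] at h1
  have := hF.le_ncard P hP
  omega

theorem eq_of_not_orderable (hF : IsObstruction d E F) {G : Set (Set α)} (hG : G ⊆ F)
    (h : ¬ Orderable G id) : G = F := by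
  refine hG.antisymm fun H hH => ?_
  by_contra hHG
  refine h ((hF.minimal H hH).mono fun K hK => ⟨hG hK, ?_⟩)
  rintro rfl
  exact hHG hK

theorem mem_del (hF : IsObstruction d E F) {u : α} {H : Set α} (hH : H ∈ F)
    (h : u ∈ H → d < H.ncard) : H ∈ {H ∈ F | d ≤ (H \ {u}).ncard} := by
  refine ⟨hH, ?_⟩
  by_cases hu : u ∈ H
  · have := ncard_sdiff_singleton_add_one hu (hF.finite_mem H hH)
    have := h hu
    omega
  · rw [sdiff_singleton_eq_self hu]
    exact hF.le_ncard H hH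

/-- Deleting a point outside all members would change nothing, yet the deletion is orderable. -/
theorem exists_mem_of_vertex (hF : IsObstruction d E F) {v : α} (hvE : v ∈ E) :
    ∃ H ∈ F, v ∈ H := by
  by_contra h
  push Not at h
  apply hF.not_orderable
  obtain ⟨g, hg, hB⟩ := hF.del v hvE
  have hmem : ∀ H ∈ F, H ∈ {H ∈ F | d ≤ (H \ {v}).ncard} := fun H hH =>
    hF.mem_del hH fun hv => (h H hH hv).elim
  refine ⟨g, hg.mono hmem, fun A hA B hB' C hC h1 h2 => ?_⟩
  have := hB A (hmem A hA) B (hmem B hB') C (hmem C hC) h1 h2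
  change Btw A B C
  simpa only [sdiff_singleton_eq_self (h A hA), sdiff_singleton_eq_self (h B hB'),
    sdiff_singleton_eq_self (h C hC)] using this

theorem three_le_ncard (hF : IsObstruction d E F) : 3 ≤ F.ncard := by
  by_contra h
  exact hF.not_orderable (orderable_of_ncard_le_two hF.finite (by omega))

theorem exists_mem_notMem (hF : IsObstruction d E F) {A : Set α} (hA : A ∈ F) {s : Set α}
    (hs : s.Finite) (h : s.ncard < d) : ∃ u ∈ A, u ∉ s := by
  have := hF.le_ncard A hA
  exact exists_mem_notMem_of_ncard_lt_ncard (by omega) hs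

/-! ### Cycles -/

/-- If all members through v had more than d points, deleting v would keep them all, so v must be
the only common point of two consecutive members. But then `A i` has a point u in no other member,
and deleting u preserves the cycle. -/
theorem exists_ncard_eq (hF : IsObstruction d E F) {m : ℕ} {A : ZMod m → Set α} (hA : IsCycle A)
    (hAF : F = range A) {i : ZMod m} (hi : d < (A i).ncard) {v : α} (hv : v ∈ A i) :
    ∃ j, j ≠ i ∧ v ∈ A j ∧ (A j).ncard = d := by
  by_contra hcon
  push Not at hcon
  have hAi : ∀ j, A j ∈ F := fun j => by rw [hAF]; exact ⟨j, rfl⟩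
  have key : ∀ u ∈ E, (∀ j, u ∈ A j → d < (A j).ncard) →
      (∀ k, ∃ x ∈ A k, x ∈ A (k + 1) ∧ x ≠ u) → False := by
    intro u huE hu hx
    choose x hx1 hx2 hxu using hx
    exact not_orderable_of_cycle (Q := fun H => H \ {u}) hA.three_le A
      (fun j => hF.mem_del (hAi j) (hu j)) x
      (fun k => ⟨⟨hx1 k, hxu k⟩, hx2 k, hxu k⟩)
      (fun k j h1 h2 h3 => hA.triple k j h1 h2 _ (hx1 k) (hx2 k) h3.1) (hF.del u huE)
  have hbig : ∀ j, v ∈ A j → d < (A j).ncard := by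
    intro j hj
    rcases eq_or_ne j i with rfl | hne
    · exact hi
    · exact lt_of_le_of_ne (hF.le_ncard _ (hAi j)) (hcon j hne hj).symm
  by_cases hall : ∀ k, ∃ x ∈ A k, x ∈ A (k + 1) ∧ x ≠ v
  · exact key v (hF.subset_ground _ (hAi i) hv) hbig hall
  push Not at hall
  obtain ⟨k, hk⟩ := hall
  have fin : ∀ j, (A j).Finite := fun j => hF.finite_mem _ (hAi j)
  -- One of the two intersections is the singleton {v}, the other has at most d - 2 points.
  have hsum : (A i ∩ A (i + 1)).ncard + (A i ∩ A (i - 1)).ncard + 1 ≤ d := by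
    have h1 := hF.inter _ (hAi i) _ (hAi (i + 1)) (hA.injective.ne (hA.add_one_ne i).symm)
    have h2 := hF.inter _ (hAi i) _ (hAi (i - 1)) (hA.injective.ne (hA.sub_one_ne i).symm)
    obtain ⟨w, hw1, hw2⟩ := hA.meets k
    obtain rfl := hk w hw1 hw2
    have hik : i = k ∨ i = k + 1 := hA.eq_or_eq_of_mem (hA.add_one_ne k).symm hw1 hw2 hv
    rcases hik with rfl | rfl
    · have : (A i ∩ A (i + 1)).ncard ≤ 1 := by
        rw [← ncard_singleton w]
        exact ncard_le_ncard (fun x hx => hk x hx.1 hx.2) (finite_singleton w)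
      omega
    · rw [add_sub_cancel_right] at h2 ⊢
      have : (A (k + 1) ∩ A k).ncard ≤ 1 := by
        rw [← ncard_singleton w]
        exact ncard_le_ncard (fun x hx => hk x hx.2 hx.1) (finite_singleton w)
      omega
  have hle := ncard_union_le (A i ∩ A (i + 1)) (A i ∩ A (i - 1))
  obtain ⟨u, hui, hu⟩ := hF.exists_mem_notMem (hAi i)
    (((fin i).inter_of_left _).union ((fin i).inter_of_left _))
    (show (A i ∩ A (i + 1) ∪ A i ∩ A (i - 1)).ncard < d by omega)
  have honly : ∀ j, u ∈ A j → j = i := by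
    intro j hj
    by_contra hne
    by_cases h1 : j = i + 1
    · subst h1; exact hu (Or.inl ⟨hui, hj⟩)
    · by_cases h2 : i = j + 1
      · subst h2
        rw [add_sub_cancel_right] at hu
        exact hu (Or.inr ⟨hui, hj⟩)
      · exact hA.disj i j hne h1 h2 ⟨u, hui, hj⟩
  refine key u (hF.subset_ground _ (hAi i) hui)
    (fun j hj => by rw [honly j hj]; exact hi) fun k => ?_
  obtain ⟨x, hx1, hx2⟩ := hA.meets k
  refine ⟨x, hx1, hx2, ?_⟩
  rintro rfl
  exact hA.add_one_ne k ((honly _ hx2).trans (honly _ hx1).symm)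

theorem isO (hF : IsObstruction d E F) {m : ℕ} {A : ZMod m → Set α} (hA : IsCycle A)
    (hAF : range A ⊆ F) {H : Hypergraph α} (hE : H.vertexSet = E) (hH : H.edgeSet = F)
    (hp : IsPavingClutter d H) :
    IsO m (fun i => (A i ∩ A (i + 1)).ncard) d H := by
  replace hAF : F = range A := (hF.eq_of_not_orderable hAF hA.not_orderable).symm
  have hAi : ∀ j, A j ∈ F := fun j => by rw [hAF]; exact ⟨j, rfl⟩
  have fin : ∀ j, (A j).Finite := fun j => hF.finite_mem _ (hAi j)
  refine ⟨hA.three_le, fun i => ?_, fun i => ?_, ?_, hp, fun v hv => ?_, fun v _ => ?_,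
    A, hA.injective, by rw [hH, hAF], fun i => ?_, fun i j h0 h1 h2 => ?_, fun i hi v hv => ?_⟩
  · exact (ncard_pos ((fin i).inter_of_left _)).2 (hA.meets i)
  · exact hF.inter _ (hAi i) _ (hAi (i + 1)) (hA.injective.ne (hA.add_one_ne i).symm)
  · rintro ⟨i, h1, h2⟩
    -- The two intersections inside `A (j + 1)` are disjoint, so it has more than d points. A
    -- forbidden index would make two consecutive members this large, and a common point of these
    -- would lie in no member of size d.
    have big : ∀ j, d < (A j ∩ A (j + 1)).ncard + (A (j + 1) ∩ A (j + 1 + 1)).ncard →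
        d < (A (j + 1)).ncard := by
      intro j hj
      rw [← ncard_union_eq ?_ ((fin _).inter_of_left _) ((fin _).inter_of_left _)] at hj
      · refine hj.trans_le (ncard_le_ncard ?_ (fin _))
        rintro x (hx | hx)
        · exact hx.2
        · exact hx.1
      · rw [disjoint_left]
        rintro x hx hx'
        refine hA.triple j (j + 1 + 1) ?_ (hA.add_one_ne _) x hx.1 hx.2 hx'.2
        intro h
        exact hA.add_two_ne j (by linear_combination h)
    have b1 := big i h1
    have b2 := big (i + 1) (by rw [show i + 1 + 1 = i + 2 by ring] at *; exact h2)
    obtain ⟨v, hv1, hv2⟩ := hA.meets (i + 1)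
    obtain ⟨j, hj, hvj, hjd⟩ := hF.exists_ncard_eq hA hAF b1 hv1
    rcases hA.eq_or_eq_of_mem (hA.add_one_ne (i + 1)).symm hv1 hv2 hvj with rfl | rfl
    · exact hj rfl
    · omega
  · rw [hH]; exact hF.exists_mem_of_vertex (hE ▸ hv)
  · have hfin : {e ∈ H.edgeSet | v ∈ e}.Finite := (hH ▸ hF.finite).subset (sep_subset _ _)
    rw [← hfin.cast_ncard_eq]
    by_contra hcon
    obtain ⟨P, Q, R, hP, hQ, hR, h1, h2, h3⟩ := (two_lt_ncard_iff hfin).1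
      (by exact_mod_cast not_le.1 hcon)
    rw [hH, hAF] at hP hQ hR
    obtain ⟨⟨i, rfl⟩, hi⟩ := hP
    obtain ⟨⟨j, rfl⟩, hj⟩ := hQ
    obtain ⟨⟨l, rfl⟩, hl⟩ := hR
    rcases hA.eq_or_eq_of_mem (by rintro rfl; exact h1 rfl) hi hj hl with rfl | rfl
    · exact h2 rfl
    · exact h3 rfl
  · exact (((fin i).inter_of_left _).cast_ncard_eq).symm
  · exact disjoint_iff_inter_eq_empty.2 (not_nonempty_iff_eq_empty.1 (hA.disj i j h0 h1 h2))
  · rw [← (fin i).cast_ncard_eq] at hi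
    obtain ⟨j, hj, hvj, hjd⟩ := hF.exists_ncard_eq hA hAF (by exact_mod_cast hi) hv
    exact ⟨j, hj, hvj, by rw [← (fin j).cast_ncard_eq, hjd]⟩

/-! ### Claws -/

/-- A claw survives the deletion of a point u outside P ∩ D, Q ∩ D and R ∩ D, provided every member
containing u has more than d points. Each of P, Q, R has a point outside D, hence size d; and if D
is larger than d, all its points lie in P ∪ Q ∪ R. -/
theorem isSh (hF : IsObstruction d E F) {P Q R D : Set α} (hP : P ∈ F) (hQ : Q ∈ F) (hR : R ∈ F)
    (hD : D ∈ F) (hPQ : ¬ Meets P Q) (hQR : ¬ Meets Q R) (hPR : ¬ Meets P R) (mP : Meets P D)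
    (mQ : Meets Q D) (mR : Meets R D) {H : Hypergraph α} (hE : H.vertexSet = E) (hH : H.edgeSet = F)
    (hp : IsPavingClutter d H) :
    IsSh (P ∩ D).ncard (Q ∩ D).ncard (R ∩ D).ncard d H := by
  have hFe : {P, Q, R, D} = F := by
    refine hF.eq_of_not_orderable ?_ ?_
    · rintro X (rfl | rfl | rfl | rfl) <;> assumption
    · exact not_orderable_of_claw (Q := id) (a := P) (b := Q) (c := R) (e := D)
        (by simp) (by simp) (by simp) (by simp) hPQ hQR hPR mP mQ mR
  have ne : ∀ {X Y : Set α}, Meets X D → ¬ Meets X Y → X ≠ Y := by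
    rintro X Y ⟨x, hx, -⟩ h rfl
    exact h ⟨x, hx, hx⟩
  have neD : ∀ {X Y : Set α}, Meets Y D → ¬ Meets X Y → X ≠ D := by
    rintro X Y h1 h2 rfl
    exact h2 h1.symm
  have sw : ∀ {X Y : Set α}, ¬ Meets X Y → ¬ Meets Y X := fun h h' => h h'.symm
  have nPQ := ne mP hPQ
  have nPR := ne mP hPR
  have nQR := ne mQ hQR
  have nPD := neD mQ hPQ
  have nQD := neD mR hQR
  have nRD := neD mP (sw hPR)
  have fin : ∀ {X}, X ∈ F → X.Finite := fun {X} hX => hF.finite_mem X hX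
  have key : ∀ u ∈ E, (u ∈ P → d < P.ncard) → (u ∈ Q → d < Q.ncard) → (u ∈ R → d < R.ncard) →
      (u ∈ D → d < D.ncard) → ¬ (u ∈ P ∧ u ∈ D) → ¬ (u ∈ Q ∧ u ∈ D) → ¬ (u ∈ R ∧ u ∈ D) →
      False := by
    intro u huE hu1 hu2 hu3 hu4 h1 h2 h3
    have m1 : ∀ {X : Set α}, Meets X D → ¬ (u ∈ X ∧ u ∈ D) → Meets (X \ {u}) (D \ {u}) := by
      rintro X ⟨x, hx1, hx2⟩ hu
      have : x ≠ u := by rintro rfl; exact hu ⟨hx1, hx2⟩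
      exact ⟨x, ⟨hx1, this⟩, hx2, this⟩
    have m2 : ∀ {X Y : Set α}, ¬ Meets X Y → ¬ Meets (X \ {u}) (Y \ {u}) := by
      rintro X Y h ⟨x, hx1, hx2⟩
      exact h ⟨x, hx1.1, hx2.1⟩
    exact not_orderable_of_claw (hF.mem_del hP hu1) (hF.mem_del hQ hu2) (hF.mem_del hR hu3)
      (hF.mem_del hD hu4) (m2 hPQ) (m2 hQR) (m2 hPR) (m1 mP h1) (m1 mQ h2) (m1 mR h3) (hF.del u huE)
  have small : ∀ {X : Set α}, X ∈ F → X ≠ D → (∀ u ∈ X, u ∉ D → d < X.ncard → False) →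
      X.ncard = d := by
    intro X hX hXD h
    have h1 := hF.inter X hX D hD hXD
    obtain ⟨u, hu, hu'⟩ := hF.exists_mem_notMem hX ((fin hX).inter_of_left D) (by omega)
    by_contra hne
    exact h u hu (fun h => hu' ⟨hu, h⟩) (lt_of_le_of_ne (hF.le_ncard X hX) (Ne.symm hne))
  have no : ∀ {X Y : Set α} {u : α}, u ∈ X → ¬ Meets X Y → u ∉ Y := fun h1 h2 h3 => h2 ⟨_, h1, h3⟩
  have cP : P.ncard = d := small hP nPD fun u hu huD hlt =>
    key u (hF.subset_ground _ hP hu) (fun _ => hlt)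
    (fun h => (no hu hPQ h).elim) (fun h => (no hu hPR h).elim) (fun h => (huD h).elim)
    (fun h => huD h.2) (fun h => huD h.2) (fun h => huD h.2)
  have cQ : Q.ncard = d := small hQ nQD fun u hu huD hlt => key u (hF.subset_ground _ hQ hu)
    (fun h => (no hu (sw hPQ) h).elim) (fun _ => hlt)
    (fun h => (no hu hQR h).elim) (fun h => (huD h).elim)
    (fun h => huD h.2) (fun h => huD h.2) (fun h => huD h.2)
  have cR : R.ncard = d := small hR nRD fun u hu huD hlt => key u (hF.subset_ground _ hR hu)
    (fun h => (no hu (sw hPR) h).elim) (fun h => (no hu (sw hQR) h).elim) (fun _ => hlt)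
    (fun h => (huD h).elim) (fun h => huD h.2) (fun h => huD h.2) (fun h => huD h.2)
  have pos : ∀ {X : Set α}, X ∈ F → Meets X D → 1 ≤ (X ∩ D).ncard := fun hX hm =>
    (ncard_pos ((fin hX).inter_of_left _)).2 hm
  have dj : ∀ {X Y : Set α}, ¬ Meets X Y → Disjoint X Y := fun h =>
    disjoint_iff_inter_eq_empty.2 (not_nonempty_iff_eq_empty.1 h)
  have ec : ∀ {X : Set α}, X ∈ F → X.encard = (X.ncard : ℕ∞) := fun hX =>
    ((fin hX).cast_ncard_eq).symm
  have eci : ∀ {X : Set α}, X ∈ F → (X ∩ D).encard = ((X ∩ D).ncard : ℕ∞) := fun hX =>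
    (((fin hX).inter_of_left D).cast_ncard_eq).symm
  refine ⟨⟨pos hP mP, hF.inter P hP D hD nPD⟩, ⟨pos hQ mQ, hF.inter Q hQ D hD nQD⟩,
    ⟨pos hR mR, hF.inter R hR D hD nRD⟩, hp, fun v hv => ?_, P, Q, R, D, nPQ, nPR, nPD, nQR, nQD,
    nRD, by rw [hH, hFe], by rw [ec hP, cP], by rw [ec hQ, cQ], by rw [ec hR, cR], ?_, eci hP,
    eci hQ, eci hR, dj hPQ, dj hQR, dj hPR, fun hlt => ?_⟩
  · rw [hH]; exact hF.exists_mem_of_vertex (hE ▸ hv)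
  · rw [ec hD]; exact_mod_cast hF.le_ncard D hD
  · rw [ec hD] at hlt ⊢
    replace hlt : d < D.ncard := by exact_mod_cast hlt
    have hcov : D = (P ∩ D ∪ Q ∩ D) ∪ R ∩ D := by
      ext x
      constructor
      · intro hx
        by_contra hcon
        simp only [mem_union, mem_inter_iff, not_or] at hcon
        obtain ⟨⟨h1, h2⟩, h3⟩ := hcon
        exact key x (hF.subset_ground _ hD hx) (fun h => (h1 ⟨h, hx⟩).elim)
          (fun h => (h2 ⟨h, hx⟩).elim) (fun h => (h3 ⟨h, hx⟩).elim) (fun _ => hlt) h1 h2 h3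
      · rintro ((hx | hx) | hx) <;> exact hx.2
    have h1 : Disjoint (P ∩ D) (Q ∩ D) := (dj hPQ).mono inter_subset_left inter_subset_left
    have h2 : Disjoint (P ∩ D ∪ Q ∩ D) (R ∩ D) := by
      rw [disjoint_union_left]
      exact ⟨(dj hPR).mono inter_subset_left inter_subset_left,
        (dj hQR).mono inter_subset_left inter_subset_left⟩
    have h3 := ncard_union_eq h2 (((fin hP).inter_of_left _).union ((fin hQ).inter_of_left _))
      ((fin hR).inter_of_left _)
    rw [ncard_union_eq h1 ((fin hP).inter_of_left _) ((fin hQ).inter_of_left _), ← hcov] at h3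
    exact_mod_cast h3.symm

end IsObstruction

end Shapes

/-! ### Obstructions with three members, and the classification -/

section Trichotomy

variable {α : Type*} {d : ℕ} {E : Set α} {F : Set (Set α)}

namespace IsObstruction

/-- Removing v puts Q between P and R, although Q is not between them before. So Q has a point q
outside P ∪ R, and then P ∩ R = {v}. This is a star at v; deleting a point other than v that leaves
such a star intact is impossible, which gives the sizes. -/
theorem isY (hF : IsObstruction d E F) {P Q R : Set α} (hP : P ∈ F) (hQ : Q ∈ F) (hR : R ∈ F)
    (hPQ : P ≠ Q) (hQR : Q ≠ R) (hPR : P ≠ R) {v : α} (vP : v ∈ P) (vQ : v ∈ Q) (vR : v ∈ R)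
    (h : ¬ Btw P Q R) (h' : Btw (P \ {v}) (Q \ {v}) (R \ {v})) {H : Hypergraph α}
    (hE : H.vertexSet = E) (hH : H.edgeSet = F) (hp : IsPavingClutter d H) :
    IsY ((P ∩ Q) \ R).ncard ((Q ∩ R) \ P).ncard d H := by
  have fin : ∀ {X}, X ∈ F → X.Finite := fun {X} hX => hF.finite_mem X hX
  have hsub : P ∩ R ⊆ Q := by
    rintro x ⟨hxP, hxR⟩
    by_cases hxv : x = v
    · rwa [hxv]
    · exact (h'.mem ⟨hxP, hxv⟩ ⟨hxR, hxv⟩).1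
  obtain ⟨q, hqQ, hq⟩ : ∃ q ∈ Q, q ∉ P ∪ R := by
    by_contra hcon
    push Not at hcon
    exact h ⟨hsub, fun _ => hcon⟩
  have hqP : q ∉ P := fun h => hq (Or.inl h)
  have hqR : q ∉ R := fun h => hq (Or.inr h)
  have hPRv : ∀ x, x ∈ P → x ∈ R → x = v := by
    intro x hxP hxR
    by_contra hxv
    rcases h'.cover ⟨x, ⟨hxP, hxv⟩, hxR, hxv⟩ (x := q) ⟨hqQ, by rintro rfl; exact hqP vP⟩ with h | h
    · exact hqP h.1
    · exact hqR h.1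
  have star : ∀ u ∈ E, (u ∈ P → d < P.ncard) → (u ∈ Q → d < Q.ncard) → (u ∈ R → d < R.ncard) →
      ∀ p q r, p ∈ P → p ∉ Q → q ∈ Q → q ∉ P → q ∉ R → r ∈ R → r ∉ Q → p ≠ u → q ≠ u → r ≠ u →
      v ≠ u → False := by
    intro u huE h1 h2 h3 p q r hp1 hp2 hq1 hq2 hq3 hr1 hr2 hpu hqu hru hvu
    refine not_orderable_of_star (Q := fun H => H \ {u}) (hF.mem_del hP h1) (hF.mem_del hQ h2)
      (hF.mem_del hR h3) (v := v) (x := p) (y := q) (z := r) ⟨⟨vP, hvu⟩, ⟨vQ, hvu⟩, ⟨vR, hvu⟩⟩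
      ⟨⟨hp1, hpu⟩, fun h => hp2 h.1, fun h => ?_⟩ ⟨fun h => hq2 h.1, ⟨hq1, hqu⟩, fun h => hq3 h.1⟩
      ⟨fun h => ?_, fun h => hr2 h.1, ⟨hr1, hru⟩⟩ (hF.del u huE)
    · exact hp2 (hPRv p hp1 h.1 ▸ vQ)
    · exact hr2 (hPRv r h.1 hr1 ▸ vQ)
  -- Two points of X outside Q: one to delete, one to keep the star.
  have two : ∀ {X : Set α}, X ∈ F → X ≠ Q → ∃ x ∈ X, x ∉ Q ∧ ∃ y ∈ X, y ∉ Q ∧ y ≠ x := by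
    intro X hX hXQ
    have h1 := hF.inter X hX Q hQ hXQ
    have finX : (X ∩ Q).Finite := (fin hX).inter_of_left Q
    obtain ⟨x, hx, hx'⟩ := hF.exists_mem_notMem hX finX (by omega)
    obtain ⟨y, hy, hy'⟩ := hF.exists_mem_notMem hX (finX.insert x)
      (by have := ncard_insert_le x (X ∩ Q); omega)
    exact ⟨x, hx, fun h => hx' ⟨hx, h⟩, y, hy, fun h => hy' (Or.inr ⟨hy, h⟩),
      fun h => hy' (Or.inl h)⟩
  obtain ⟨p₁, hp₁, hp₁Q, p₂, hp₂, hp₂Q, hpp⟩ := two hP hPQ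
  obtain ⟨r₁, hr₁, hr₁Q, r₂, hr₂, hr₂Q, hr⟩ := two hR hQR.symm
  have hFe : {P, Q, R} = F := by
    refine hF.eq_of_not_orderable ?_ ?_
    · rintro X (rfl | rfl | rfl) <;> assumption
    · exact not_orderable_of_star (Q := id) (a := P) (b := Q) (c := R) (by simp) (by simp)
        (by simp) ⟨vP, vQ, vR⟩
        ⟨hp₁, hp₁Q, fun h => hp₁Q (hPRv _ hp₁ h ▸ vQ)⟩ ⟨hqP, hqQ, hqR⟩
        ⟨fun h => hr₁Q (hPRv _ h hr₁ ▸ vQ), hr₁Q, hr₁⟩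
  have cP : P.ncard = d := by
    by_contra hne
    have hlt := lt_of_le_of_ne (hF.le_ncard P hP) (Ne.symm hne)
    exact star p₁ (hF.subset_ground _ hP hp₁) (fun _ => hlt) (fun h => (hp₁Q h).elim)
      (fun h => (hp₁Q (hPRv _ hp₁ h ▸ vQ)).elim) p₂ q r₁ hp₂ hp₂Q hqQ hqP hqR hr₁ hr₁Q hpp
      (by rintro rfl; exact hqP hp₁) (by rintro rfl; exact hr₁Q (hPRv _ hp₁ hr₁ ▸ vQ))
      (by rintro rfl; exact hp₁Q vQ)
  have cR : R.ncard = d := by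
    by_contra hne
    have hlt := lt_of_le_of_ne (hF.le_ncard R hR) (Ne.symm hne)
    exact star r₁ (hF.subset_ground _ hR hr₁) (fun h => (hr₁Q (hPRv _ h hr₁ ▸ vQ)).elim)
      (fun h => (hr₁Q h).elim) (fun _ => hlt) p₁ q r₂ hp₁ hp₁Q hqQ hqP hqR hr₂ hr₂Q
      (by rintro rfl; exact hr₁Q (hPRv _ hp₁ hr₁ ▸ vQ)) (by rintro rfl; exact hqR hr₁) hr
      (by rintro rfl; exact hr₁Q vQ)
  have ec : ∀ {X : Set α}, X.Finite → X.encard = (X.ncard : ℕ∞) := fun hX =>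
    hX.cast_ncard_eq.symm
  have card : ∀ {X : Set α}, X ∈ F → X ≠ Q → v ∈ X → ∀ S : Set α, (∀ x, x ∈ X → x ∈ S → x = v) →
      v ∈ S → ((X ∩ Q) \ S).ncard + 3 ≤ d := by
    intro X hX hXQ hvX S hS hvS
    have h1 := hF.inter X hX Q hQ hXQ
    have h2 : (X ∩ Q) \ S = (X ∩ Q) \ {v} := by
      ext x
      constructor
      · rintro ⟨hx, hxS⟩
        exact ⟨hx, by rintro rfl; exact hxS hvS⟩
      · rintro ⟨hx, hxv⟩
        exact ⟨hx, fun h => hxv (hS x hx.1 h)⟩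
    rw [h2]
    have := ncard_sdiff_singleton_add_one (show v ∈ X ∩ Q from ⟨hvX, vQ⟩) ((fin hX).inter_of_left Q)
    omega
  -- The sets A, B, C of the shape are P, R, Q: the middle set Q plays the role of C.
  refine ⟨card hP hPQ vP R hPRv vR, ?_, hp, fun v hv => ?_, P, R, Q, hPR, hPQ, hQR.symm,
    by rw [hH, ← hFe, pair_comm], by rw [ec (fin hP), cP],
    by rw [ec (fin hR), cR], ?_, ec (((fin hP).inter_of_left _).sdiff),
    ec (((fin hQ).inter_of_left _).sdiff), ?_, ?_, ?_, fun hlt => ?_⟩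
  · rw [inter_comm]
    exact card hR hQR.symm vR P (fun x h1 h2 => hPRv x h2 h1) vP
  · rw [hH]; exact hF.exists_mem_of_vertex (hE ▸ hv)
  · rw [ec (fin hQ)]; exact_mod_cast hF.le_ncard Q hQ
  · rw [encard_eq_zero, sdiff_eq_empty]
    exact hsub
  · rw [encard_pos]
    exact ⟨q, hqQ, hq⟩
  · rw [encard_eq_one]
    exact ⟨v, Subset.antisymm (fun x hx => hPRv x hx.1.1 hx.1.2) (by
      rintro x rfl; exact ⟨⟨vP, vR⟩, vQ⟩)⟩
  · rw [ec (fin hQ)] at hlt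
    replace hlt : d < Q.ncard := by exact_mod_cast hlt
    rw [encard_eq_one]
    refine ⟨q, Subset.antisymm (fun x hx => ?_) (by rintro x rfl; exact ⟨hqQ, hq⟩)⟩
    by_contra hxq
    have hxP : x ∉ P := fun h => hx.2 (Or.inl h)
    have hxR : x ∉ R := fun h => hx.2 (Or.inr h)
    exact star q (hF.subset_ground _ hQ hqQ) (fun h => (hqP h).elim) (fun _ => hlt)
      (fun h => (hqR h).elim) p₁ x r₁ hp₁ hp₁Q hx.1 hxP hxR hr₁ hr₁Q (by rintro rfl; exact hqP hp₁) hxq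
      (by rintro rfl; exact hqR hr₁)
      (by rintro rfl; exact hqP vP)

theorem isCycle_three {P Q R : Set α} (hPQ : Meets P Q) (hQR : Meets Q R) (hPR : Meets P R)
    (h : ∀ x ∈ P, x ∈ Q → x ∉ R) : IsCycle (m := 3) (![P, Q, R] : Fin 3 → Set α) := by
  refine ⟨le_rfl, ?_, ?_, ?_⟩
  · intro i
    fin_cases i
    · exact hPQ
    · exact hQR
    · exact hPR.symm
  · intro i j h1 h2 h3
    exfalso
    revert i j
    decide
  · intro i j h1 h2 x hx1 hx2 hx3
    fin_cases i <;> fin_cases j <;> first | exact h1 rfl | exact h2 rfl | skip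
    · exact h x hx1 hx2 hx3
    · exact h x hx3 hx1 hx2
    · exact h x hx2 hx3 hx1

/-- No betweenness holds, so the sets meet pairwise. Without a common point they form a 3-cycle;
with one, its link is orderable, and the set in the middle there becomes the centre of a Y. -/
theorem trichotomy_of_ncard_eq_three (hF : IsObstruction d E F) (h3 : F.ncard = 3)
    {H : Hypergraph α} (hE : H.vertexSet = E) (hH : H.edgeSet = F) (hp : IsPavingClutter d H) :
    (∃ (m : ℕ) (a : ZMod m → ℕ), IsO m a d H) ∨ ∃ a b : ℕ, IsY a b d H := by
  obtain ⟨P, Q, R, hPQ, hPR, hQR, rfl⟩ := ncard_eq_three.1 h3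
  have hP : P ∈ ({P, Q, R} : Set (Set α)) := by simp
  have hQ : Q ∈ ({P, Q, R} : Set (Set α)) := by simp
  have hR : R ∈ ({P, Q, R} : Set (Set α)) := by simp
  have n1 : ¬ Btw P Q R := fun h => hF.not_orderable (orderable_of_btw h hPQ hQR hPR)
  have n2 : ¬ Btw Q R P := fun h => hF.not_orderable <|
    (orderable_of_btw h hQR hPR.symm hPQ.symm).mono (by
      rintro X (rfl | rfl | rfl) <;> simp)
  have n3 : ¬ Btw R P Q := fun h => hF.not_orderable <|
    (orderable_of_btw h hPR.symm hPQ hQR.symm).mono (by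
      rintro X (rfl | rfl | rfl) <;> simp)
  have m1 : Meets P R := by by_contra h; exact n1 (.of_not_meets h)
  have m2 : Meets Q P := by by_contra h; exact n2 (.of_not_meets h)
  have m3 : Meets R Q := by by_contra h; exact n3 (.of_not_meets h)
  by_cases hv : ∀ x ∈ P, x ∈ Q → x ∉ R
  · left
    refine ⟨3, _, hF.isO (isCycle_three m2.symm m3.symm m1 hv) ?_ hE hH hp⟩
    rintro _ ⟨i, rfl⟩
    revert i
    -- `ZMod 3` unfolds to `Fin 3`.
    change ∀ i : Fin 3, (![P, Q, R] : Fin 3 → Set α) i ∈ _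
    intro i
    fin_cases i
    · exact hP
    · exact hQ
    · exact hR
  · right
    push Not at hv
    obtain ⟨v, vP, vQ, vR⟩ := hv
    rcases (hF.link v).btw_of_triple ⟨hP, vP⟩ ⟨hQ, vQ⟩ ⟨hR, vR⟩ hPQ hQR hPR with h | h | h
    · exact ⟨_, _, hF.isY hP hQ hR hPQ hQR hPR vP vQ vR n1 h hE hH hp⟩
    · exact ⟨_, _, hF.isY hQ hR hP hQR hPR.symm hPQ.symm vQ vR vP n2 h hE hH hp⟩
    · exact ⟨_, _, hF.isY hR hP hQ hPR.symm hPQ hQR.symm vR vP vQ n3 h hE hH hp⟩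

/-- In the link of the hub the rim points are private common points of a 4-cycle. -/
theorem no_wheel (hF : IsObstruction d E F) (P : Fin 4 → Set α) (hP : ∀ i, P i ∈ F)
    (hc : (⋂ i, P i).Nonempty) : ¬ ∀ i, ∃ x, ∀ j, x ∈ P j ↔ (j = i ∨ j = i + 1) := by
  intro h
  obtain ⟨c, hc⟩ := hc
  rw [mem_iInter] at hc
  choose x hx using h
  have hxc : ∀ i, x i ≠ c := by
    intro i hi
    have h2 : ∀ i : Fin 4, ¬ (i + 2 = i ∨ i + 2 = i + 1) := by decide
    exact h2 i ((hx i (i + 2)).1 (hi ▸ hc _))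
  have h1 : ∀ i : Fin 4, P i ∈ {H ∈ F | c ∈ H} := fun i => ⟨hP i, hc i⟩
  have h2 : ∀ i : Fin 4, x i ∈ P i \ {c} ∧ x i ∈ P (i + 1) \ {c} := fun i =>
    ⟨⟨(hx i i).2 (Or.inl rfl), hxc i⟩, ⟨(hx i (i + 1)).2 (Or.inr rfl), hxc i⟩⟩
  have h3 : ∀ i j : Fin 4, j ≠ i → j ≠ i + 1 → x i ∉ P j \ {c} := fun i j h1 h2 h3 =>
    ((hx i j).1 h3.1).elim h1 h2
  exact not_orderable_of_cycle (Q := fun H => H \ {c}) (m := 4) (by norm_num) P h1 x h2 h3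
    (hF.link c)

theorem trichotomy (hF : IsObstruction d E F) {H : Hypergraph α} (hE : H.vertexSet = E)
    (hH : H.edgeSet = F) (hp : IsPavingClutter d H) :
    (∃ (m : ℕ) (a : ZMod m → ℕ), IsO m a d H) ∨ (∃ a b : ℕ, IsY a b d H) ∨
      ∃ a b c : ℕ, IsSh a b c d H := by
  rcases hF.three_le_ncard.eq_or_lt with h3 | h3
  · rcases hF.trichotomy_of_ncard_eq_three h3.symm hE hH hp with h | h
    · exact Or.inl h
    · exact Or.inr (Or.inl h)
  · by_contra hcon
    push Not at hcon
    obtain ⟨c1, -, c3⟩ := hcon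
    refine hF.not_orderable (IsClean.orderable ⟨hF.sperner, ?_, ?_, hF.no_wheel, ?_⟩ hF.finite h3
      hF.minimal)
    · intro P hP Q hQ R hR hPQ hQR hPR
      -- With at least four members every triple omits one, so minimality orders it.
      obtain ⟨S, hS, hS'⟩ : ∃ S ∈ F, S ∉ ({P, Q, R} : Set (Set α)) := by
        refine exists_mem_notMem_of_ncard_lt_ncard ?_ (by simp)
        rw [ncard_eq_three.2 ⟨P, Q, R, hPQ, hPR, hQR, rfl⟩]
        exact h3
      simp only [mem_insert_iff, mem_singleton_iff, not_or] at hS'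
      exact (hF.minimal S hS).btw_of_triple ⟨hP, fun h => hS'.1 h.symm⟩
        ⟨hQ, fun h => hS'.2.1 h.symm⟩ ⟨hR, fun h => hS'.2.2 h.symm⟩ hPQ hQR hPR
    · intro P hP Q hQ R hR D hD h1 h2 h3 m1 m2 m3
      exact c3 _ _ _ (hF.isSh hP hQ hR hD h1 h2 h3 m1 m2 m3 hE hH hp)
    · intro N hN W hW hm hm' hd
      have : NeZero N := ⟨by omega⟩
      refine c1 _ _ (hF.isO (isCycle_of_sequence hN hm hm' hd) ?_ hE hH hp)
      rintro _ ⟨z, rfl⟩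
      exact hW _ z.val_lt

end IsObstruction

end Trichotomy

/-! ### Dependent hyperplanes of paving matroids -/

section Paving

variable {α : Type*} {M : Matroid α} {d : ℕ}

/-- A dependent hyperplane. -/
def IsDepHyperplane (M : Matroid α) (H : Set α) : Prop := IsHyperplane M H ∧ M.Dep H

theorem IsPaving.indep_of_encard_lt (hM : IsPaving M) (hd : M.eRank = d) {I : Set α}
    (hI : I ⊆ M.E) (h : I.encard < d) : M.Indep I := by
  by_contra hcon
  obtain ⟨C, hCI, hC⟩ := (Matroid.Dep.exists_isCircuit_subset ⟨hcon, hI⟩)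
  have h1 := hM C hC
  rw [hd] at h1
  exact (h1.trans (encard_le_encard hCI)).not_gt h

theorem IsDepHyperplane.eRk_lt {H : Set α} (hH : IsDepHyperplane M H) (hd : M.eRank = d) :
    M.eRk H + 1 = d := hH.1.2.trans hd

theorem IsDepHyperplane.le_encard {H : Set α} (hM : IsPaving M) (hH : IsDepHyperplane M H)
    (hd : M.eRank = d) : (d : ℕ∞) ≤ H.encard := by
  obtain ⟨C, hCH, hC⟩ := hH.2.exists_isCircuit_subset
  rw [← hd]
  exact (hM C hC).trans (encard_le_encard hCH)

theorem IsDepHyperplane.not_indep {H B : Set α} (hH : IsDepHyperplane M H) (hd : M.eRank = d)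
    (hBH : B ⊆ H) (hB : B.encard = d) : ¬ M.Indep B := by
  intro h
  have h1 := h.encard_le_eRk_of_subset hBH
  rw [hB] at h1
  have h2 := hH.eRk_lt hd
  have h3 : M.eRk H + 1 ≤ M.eRk H := h2.trans_le h1
  have h4 : M.eRk H ≠ ⊤ := by
    intro h
    rw [h] at h2
    exact absurd h2 (by simp)
  exact (ENat.lt_add_one_iff h4).2 le_rfl |>.not_ge h3

/-- Paving makes every set of d - 1 points independent, and H has rank d - 1; so H is the closure of
any d - 1 of its points. -/
theorem IsDepHyperplane.isBasis {H I : Set α} (hM : IsPaving M) (hH : IsDepHyperplane M H)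
    (hd : M.eRank = d) (hIH : I ⊆ H) (hI : I.encard + 1 = d) : M.Indep I ∧ M.closure I = H := by
  have hfin : I.Finite := by
    rw [← encard_ne_top_iff]
    intro h
    rw [h] at hI
    exact absurd hI (by simp)
  have hind : M.Indep I := hM.indep_of_encard_lt hd (hIH.trans hH.2.subset_ground) (by
    rw [← hI, ENat.lt_add_one_iff (encard_ne_top_iff.2 hfin)])
  refine ⟨hind, ?_⟩
  have hle : M.eRk H ≤ M.eRk I := by
    rw [hind.eRk_eq_encard]
    have := (hH.eRk_lt hd).trans hI.symm
    exact (ENat.add_left_injective_of_ne_top ENat.one_ne_top this).le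
  rw [(hind.isBasis_of_eRk_ge hfin hIH hle hH.2.subset_ground).closure_eq_closure, hH.1.1.closure]

theorem IsDepHyperplane.isBase_insert {H I : Set α} {e : α} (hM : IsPaving M)
    (hH : IsDepHyperplane M H) (hd : M.eRank = d) (hIH : I ⊆ H) (hI : I.encard + 1 = d)
    (he : e ∈ M.E) (heH : e ∉ H) : M.IsBase (insert e I) := by
  obtain ⟨hind, hcl⟩ := hH.isBasis hM hd hIH hI
  have heI : e ∉ I := fun h => heH (hIH h)
  have hins : M.Indep (insert e I) := hind.insert_indep_iff.2 (Or.inl ⟨he, by rwa [hcl]⟩)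
  have hcard : (insert e I).encard = d := by rw [encard_insert_of_notMem heI, hI]
  refine hins.isBase_of_eRk_ge ?_ ?_
  · rw [← encard_ne_top_iff, hcard]; exact ENat.natCast_ne_top d
  · rw [hins.eRk_eq_encard, hcard, hd]

theorem IsDepHyperplane.inter_ncard {H H' : Set α} [M.Finite] (hM : IsPaving M)
    (hH : IsDepHyperplane M H) (hH' : IsDepHyperplane M H') (hd : M.eRank = d) (h2 : 2 ≤ d)
    (hne : H ≠ H') : (H ∩ H').ncard + 2 ≤ d := by
  by_contra hcon
  obtain ⟨I, hI, hIc⟩ := exists_subset_card_eq (s := H ∩ H') (n := d - 1) (by omega)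
  have hfin : I.Finite := M.ground_finite.subset
    (hI.trans (inter_subset_left.trans hH.2.subset_ground))
  have hIe : I.encard + 1 = d := by
    rw [← hfin.cast_ncard_eq, hIc]
    exact_mod_cast (by omega : d - 1 + 1 = d)
  exact hne ((hH.isBasis hM hd (hI.trans inter_subset_left) hIe).2.symm.trans
    (hH'.isBasis hM hd (hI.trans inter_subset_right) hIe).2)

/-- The closure of B works: its rank is below d by dependence, and at least d - 1 because smaller
sets are independent. -/
theorem exists_isDepHyperplane {B : Set α} (hM : IsPaving M) (hd : M.eRank = d) (hdpos : 1 ≤ d)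
    (hB : B ⊆ M.E) (hBd : B.encard = d) (hBi : ¬ M.Indep B) :
    ∃ H, IsDepHyperplane M H ∧ B ⊆ H := by
  have hBfin : B.Finite := by rw [← encard_ne_top_iff, hBd]; exact ENat.natCast_ne_top d
  have hcl : B ⊆ M.closure B := M.subset_closure B hB
  have hdep : M.Dep B := ⟨hBi, hB⟩
  refine ⟨M.closure B, ⟨⟨M.isFlat_closure B, ?_⟩, hdep.superset hcl (M.closure_subset_ground B)⟩,
    hcl⟩
  rw [M.eRk_closure_eq, hd]
  have hlt : M.eRk B < d := hBd ▸ Matroid.eRk_lt_encard_of_dep_of_finite hBfin hdep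
  obtain ⟨I, hI, hIc⟩ := exists_subset_card_eq (s := B) (n := d - 1) (by
    rw [ncard, hBd]; simp)
  have hIe : I.encard = (d - 1 : ℕ) := by rw [← (hBfin.subset hI).cast_ncard_eq, hIc]
  have hind := hM.indep_of_encard_lt hd (hI.trans hB) (by
    rw [hIe]; exact_mod_cast (by omega : d - 1 < d))
  have hge := hind.encard_le_eRk_of_subset hI
  rw [hIe] at hge
  lift M.eRk B to ℕ using hlt.ne_top with r
  norm_cast at hlt hge ⊢
  omega

/-! ### Relaxations -/

/-- The independent sets of the relaxation of a paving matroid of rank `d` with ground set `E` to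
the dependent hyperplanes in `F`. -/
def RelaxIndep (E : Set α) (d : ℕ) (F : Set (Set α)) (I : Set α) : Prop :=
  I ⊆ E ∧ (I.ncard < d ∨ I.ncard = d ∧ ∀ H ∈ F, ¬ I ⊆ H)

/-- The paving matroid of rank `d` on the finite set `E` with family `F` of dependent
hyperplanes. -/
def pavingMatroid {E : Set α} (hE : E.Finite) {d : ℕ} (hd : 2 ≤ d) {F : Set (Set α)}
    (hFE : ∀ A ∈ F, A ⊆ E)
    (hinter : ∀ A ∈ F, ∀ B ∈ F, A ≠ B → (A ∩ B).ncard + 2 ≤ d) : Matroid α :=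
  (IndepMatroid.ofFinite hE (RelaxIndep E d F) ⟨empty_subset E, Or.inl (by simp; omega)⟩
    (by
      rintro I J ⟨hJE, hJ⟩ hIJ
      have hJfin := hE.subset hJE
      have hle := ncard_le_ncard hIJ hJfin
      refine ⟨hIJ.trans hJE, ?_⟩
      rcases hJ with hJ | ⟨hJ, hJ'⟩
      · left; omega
      · rcases (hJ ▸ hle).lt_or_eq with h | h
        · exact Or.inl h
        · rw [eq_of_subset_of_ncard_le hIJ (by omega) hJfin]
          exact Or.inr ⟨hJ, hJ'⟩)
    (by
      rintro I J ⟨hIE, hI⟩ ⟨hJE, hJ⟩ hlt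
      have hIfin := hE.subset hIE
      have hJfin := hE.subset hJE
      by_contra hcon
      push Not at hcon
      obtain ⟨e₀, he₀J, he₀I⟩ := exists_mem_notMem_of_ncard_lt_ncard hlt hIfin
      -- If no e augments I, then I has d - 1 points and each I ∪ {e} lies in a member of F. These
      -- members share I, so they coincide, and the one member contains J.
      have hsmall : ∀ e ∈ J, e ∉ I → I.ncard + 1 = d ∧ ∃ H ∈ F, insert e I ⊆ H := by
        intro e heJ heI
        have h1 := hcon e heJ heI
        have h2 := ncard_insert_of_notMem heI hIfin
        have h3 : insert e I ⊆ E := insert_subset (hJE heJ) hIE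
        unfold RelaxIndep at h1
        push Not at h1
        have h4 := h1 h3
        have h5 : J.ncard ≤ d := by omega
        refine ⟨by omega, ?_⟩
        exact h4.2 (by omega)
      obtain ⟨hId, H, hH, hIH⟩ := hsmall e₀ he₀J he₀I
      refine (hJ.resolve_left (by omega)).2 H hH fun e heJ => ?_
      by_cases heI : e ∈ I
      · exact hIH (Or.inr heI)
      · obtain ⟨-, H', hH', hIH'⟩ := hsmall e heJ heI
        by_cases hHH : H = H'
        · rw [hHH]; exact hIH' (Or.inl rfl)
        · have h1 := hinter H hH H' hH' hHH
          have hsub : I ⊆ (H ∩ H') := fun x hx => ⟨hIH (Or.inr hx), hIH' (Or.inr hx)⟩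
          have := ncard_le_ncard hsub (hE.subset (inter_subset_left.trans (hFE H hH)))
          omega)
    (fun _ hI => hI.1)).matroid

section

variable {E : Set α} (hE : E.Finite) (hd : 2 ≤ d) {F : Set (Set α)} (hFE : ∀ A ∈ F, A ⊆ E)
  (hinter : ∀ A ∈ F, ∀ B ∈ F, A ≠ B → (A ∩ B).ncard + 2 ≤ d)

@[simp] theorem pavingMatroid_indep {I : Set α} :
    (pavingMatroid hE hd hFE hinter).Indep I ↔ RelaxIndep E d F I := Iff.rfl

theorem pavingMatroid_eRank {B : Set α} (hBE : B ⊆ E) (hB : B.ncard = d)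
    (hBF : ∀ H ∈ F, ¬ B ⊆ H) : (pavingMatroid hE hd hFE hinter).eRank = d := by
  apply le_antisymm
  · rw [Matroid.eRank_def, Matroid.eRk_le_iff]
    intro I hI hind
    rw [pavingMatroid_indep] at hind
    rw [← (hE.subset hind.1).cast_ncard_eq]
    rcases hind.2 with h | h
    · exact_mod_cast h.le
    · exact_mod_cast h.1.le
  · have hind : (pavingMatroid hE hd hFE hinter).Indep B :=
      (pavingMatroid_indep hE hd hFE hinter).2 ⟨hBE, Or.inr ⟨hB, hBF⟩⟩
    have := hind.encard_le_eRank
    rwa [← (hE.subset hBE).cast_ncard_eq, hB] at this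

theorem pavingMatroid_isPaving (hr : (pavingMatroid hE hd hFE hinter).eRank = d) :
    IsPaving (pavingMatroid hE hd hFE hinter) := by
  intro C hC
  rw [hr]
  have hCE : C ⊆ E := hC.subset_ground
  rw [← (hE.subset hCE).cast_ncard_eq]
  by_contra hlt
  exact hC.not_indep ((pavingMatroid_indep hE hd hFE hinter).2
    ⟨hCE, Or.inl (by exact_mod_cast not_le.1 hlt)⟩)

/-- No d points of H are independent, so the rank is d - 1. H is flat because d - 1 of its points
together with a point outside lie in no member H', which would share too much with H. -/
theorem pavingMatroid_isDepHyperplane (hr : (pavingMatroid hE hd hFE hinter).eRank = d)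
    {H : Set α} (hH : H ∈ F) (hHd : d ≤ H.ncard) :
    IsDepHyperplane (pavingMatroid hE hd hFE hinter) H := by
  set N := pavingMatroid hE hd hFE hinter with hN
  have hHE : H ⊆ N.E := hFE H hH
  have hHfin := hE.subset (hFE H hH)
  have hle : ∀ I ⊆ H, N.Indep I → I.ncard + 1 ≤ d := by
    intro I hI hind
    rcases ((pavingMatroid_indep hE hd hFE hinter).1 hind).2 with h | h
    · exact h
    · exact (h.2 H hH hI).elim
  obtain ⟨J, hJH, hJ⟩ := exists_subset_card_eq (s := H) (n := d - 1) (by omega)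
  have hJind : N.Indep J := (pavingMatroid_indep hE hd hFE hinter).2
    ⟨hJH.trans (hFE H hH), Or.inl (by omega)⟩
  have hrk : N.eRk H = (d - 1 : ℕ) := by
    apply le_antisymm
    · rw [Matroid.eRk_le_iff]
      intro I hI hind
      rw [← (hHfin.subset hI).cast_ncard_eq]
      have := hle I hI hind
      exact_mod_cast (by omega : I.ncard ≤ d - 1)
    · rw [← hJ, (hHfin.subset hJH).cast_ncard_eq]
      exact hJind.encard_le_eRk_of_subset hJH
  have hrk1 : N.eRk H + 1 = N.eRank := by
    rw [hrk, hr]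
    exact_mod_cast (by omega : d - 1 + 1 = d)
  refine ⟨⟨⟨?_, hHE⟩, hrk1⟩, ?_, hHE⟩
  · intro I X hIH hIX x hxX
    by_contra hxH
    have hIc : I.ncard = d - 1 := by
      have := hIH.encard_eq_eRk
      rw [hrk, ← (hHfin.subset hIH.subset).cast_ncard_eq] at this
      exact_mod_cast this
    have hxI : x ∉ I := fun h => hxH (hIH.subset h)
    have hIfin := hHfin.subset hIH.subset
    refine hxI (hIX.mem_of_insert_indep hxX ((pavingMatroid_indep hE hd hFE hinter).2
      ⟨insert_subset (hIX.subset_ground hxX) (hIH.subset.trans (hFE H hH)), Or.inr ⟨?_, ?_⟩⟩))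
    · rw [ncard_insert_of_notMem hxI hIfin]; omega
    · intro H' hH' hsub
      have hne : H ≠ H' := by
        rintro rfl
        exact hxH (hsub (Or.inl rfl))
      have h1 := hinter H hH H' hH' hne
      have h2 := ncard_le_ncard (show I ⊆ H ∩ H' from fun y hy =>
        ⟨hIH.subset hy, hsub (Or.inr hy)⟩) (hHfin.inter_of_left H')
      omega
  · intro hind
    have := hle H subset_rfl hind
    omega

/-- A dependent hyperplane contains a dependent d-set, which lies in a member of F; sharing d
points, the two are equal. -/
theorem pavingMatroid_clutter (hr : (pavingMatroid hE hd hFE hinter).eRank = d)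
    (hFd : ∀ A ∈ F, d ≤ A.ncard) : (clutter (pavingMatroid hE hd hFE hinter)).edgeSet = F := by
  have hpav := pavingMatroid_isPaving hE hd hFE hinter hr
  have : (pavingMatroid hE hd hFE hinter).Finite := ⟨hE⟩
  ext H
  constructor
  · intro hH
    change IsDepHyperplane (pavingMatroid hE hd hFE hinter) H at hH
    have hHfin : H.Finite := hE.subset hH.2.subset_ground
    have hHd : d ≤ H.ncard := by
      have := hH.le_encard hpav hr
      rw [← hHfin.cast_ncard_eq] at this
      exact_mod_cast this
    obtain ⟨B, hBH, hB⟩ := exists_subset_card_eq hHd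
    have hBfin := hHfin.subset hBH
    have hni := hH.not_indep hr hBH (by rw [← hBfin.cast_ncard_eq, hB])
    rw [pavingMatroid_indep] at hni
    obtain ⟨H', hH', hBH'⟩ : ∃ H' ∈ F, B ⊆ H' := by
      by_contra hcon
      push Not at hcon
      exact hni ⟨hBH.trans hH.2.subset_ground, Or.inr ⟨hB, hcon⟩⟩
    by_cases hne : H = H'
    · rwa [hne]
    · have h1 := hH.inter_ncard hpav
        (pavingMatroid_isDepHyperplane hE hd hFE hinter hr hH' (hFd H' hH')) hr hd hne
      have h2 := ncard_le_ncard (subset_inter hBH hBH') (hHfin.inter_of_left H')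
      omega
  · intro hH
    exact pavingMatroid_isDepHyperplane hE hd hFE hinter hr hH (hFd H hH)

end

end Paving

/-! ### Matroid polytopes and interval inequalities -/

section Polytope

variable {n : ℕ}

theorem sum_indicator_eq_card (B : Set (Fin n)) (K : Finset (Fin n)) :
    ∑ l ∈ K, B.indicator (1 : Fin n → ℝ) l = ((B ∩ K).ncard : ℝ) := by
  classical
  have h : B ∩ (K : Set (Fin n)) = ((K.filter (· ∈ B) : Finset (Fin n)) : Set (Fin n)) := by
    ext x; simp [and_comm]
  rw [h, ncard_coe_finset, Finset.card_filter]
  push_cast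
  exact Finset.sum_congr rfl fun l _ => by simp [indicator_apply]

theorem convex_setOf_sum_le (K : Finset (Fin n)) (c : ℝ) :
    Convex ℝ {x : Fin n → ℝ | ∑ l ∈ K, x l ≤ c} := by
  have h : IsLinearMap ℝ (fun x : Fin n → ℝ => ∑ l ∈ K, x l) :=
    ⟨fun x y => by simp [Finset.sum_add_distrib], fun c x => by simp [Finset.mul_sum]⟩
  exact convex_halfSpace_le h c

theorem ncard_of_isBase {N : Matroid (Fin n)} {d : ℕ} (hd : N.eRank = d) {B : Set (Fin n)}
    (hB : N.IsBase B) : B.ncard = d := by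
  have := hB.encard_eq_eRank
  rw [hd] at this
  rw [ncard, this]
  rfl

theorem indicator_mem_hypersimplex {B : Set (Fin n)} {d : ℕ} (hB : B.ncard = d) :
    B.indicator (1 : Fin n → ℝ) ∈ hypersimplex d n := by
  classical
  refine ⟨fun i => ?_, ?_⟩
  · by_cases h : i ∈ B <;> simp [h]
  · rw [sum_indicator_eq_card]
    simp [hB]

/-- A vertex of the hypersimplex lies in the matroid polytope only if it comes from a base. -/
theorem isBase_of_indicator_mem {N : Matroid (Fin n)} {d : ℕ} (hd : N.eRank = d)
    {B : Set (Fin n)} (hBd : B.ncard = d) (hB : B.indicator 1 ∈ matroidPolytope N) :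
    N.IsBase B := by
  classical
  by_contra hcon
  -- The half-space x(B) ≤ d - 1 contains the vertices of all d-sets except B.
  have hsub : matroidPolytope N ⊆ {x : Fin n → ℝ | ∑ l ∈ B.toFinset, x l ≤ (d : ℝ) - 1} := by
    refine convexHull_min ?_ (convex_setOf_sum_le _ _)
    rintro _ ⟨B', hB', rfl⟩
    simp only [mem_ofPred_eq]
    rw [sum_indicator_eq_card, coe_toFinset]
    have h1 : B'.ncard = d := ncard_of_isBase hd hB'
    have h2 : (B' ∩ B).ncard + 1 ≤ d := by
      by_contra h
      have h3 : (B' ∩ B).ncard ≤ B'.ncard := ncard_le_ncard inter_subset_left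
      have h4 : B' ∩ B = B' := eq_of_subset_of_ncard_le inter_subset_left (by omega)
      have h5 : B' = B := eq_of_subset_of_ncard_le (inter_eq_left.1 h4) (by omega)
      exact hcon (h5 ▸ hB')
    have : ((B' ∩ B).ncard : ℝ) + 1 ≤ d := by exact_mod_cast h2
    linarith
  have := hsub hB
  simp only [mem_ofPred_eq] at this
  rw [sum_indicator_eq_card, coe_toFinset, inter_self, hBd] at this
  linarith

/-- In an ordered interval positroid, a set which behaves like a dependent hyperplane is an
interval. -/
theorem IsOrderedIntervalPositroid.exists_eq_Icc {N : Matroid (Fin n)}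
    (hN : IsOrderedIntervalPositroid N) {r : ℕ} (hr : 2 ≤ r) {K : Set (Fin n)}
    (hK : r ≤ K.ncard) (hnb : ∀ B ⊆ K, B.ncard = r → ¬ N.IsBase B)
    (hins : ∀ I ⊆ K, I.ncard + 1 = r → ∀ e ∉ K, N.IsBase (insert e I)) :
    ∃ i j, i ≤ j ∧ K = Icc i j := by
  classical
  obtain ⟨-, d, S, hd, -, hP⟩ := hN
  have hKf : K.toFinset.Nonempty := by
    rw [toFinset_nonempty]
    exact nonempty_of_ncard_ne_zero (by omega)
  set i := K.toFinset.min' hKf with hi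
  set j := K.toFinset.max' hKf with hj
  have hiK : i ∈ K := by simpa using K.toFinset.min'_mem hKf
  have hjK : j ∈ K := by simpa using K.toFinset.max'_mem hKf
  have hij : i ≤ j := K.toFinset.min'_le _ (by simpa using hjK)
  refine ⟨i, j, hij, Subset.antisymm (fun x hx => ⟨K.toFinset.min'_le _ (by simpa using hx),
    K.toFinset.le_max' _ (by simpa using hx)⟩) fun e he => ?_⟩
  by_contra heK
  -- B is a non-base containing both extreme points of K, which needs r ≥ 2. Its indicator violates
  -- some interval inequality.
  obtain ⟨B, hijB, hBK, hBr⟩ := exists_subsuperset_card_eq (s := {i, j}) (t := K) (n := r)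
    (by rintro x (rfl | rfl) <;> assumption) ((ncard_insert_le _ _).trans (by simpa using hr)) hK
  have hbase : ∀ b ∈ B, ∀ e ∉ K, N.IsBase (insert e (B \ {b})) := fun b hb e he =>
    hins _ (sdiff_subset.trans hBK) (by rw [ncard_sdiff_singleton_add_one hb, hBr]) e he
  have hdr : d = r := by
    have h1 := ncard_of_isBase hd (hbase i (hijB (Or.inl rfl)) e heK)
    rw [ncard_insert_of_notMem (fun h => heK (hBK h.1)),
      ncard_sdiff_singleton_add_one (hijB (Or.inl rfl)), hBr] at h1
    exact h1.symm
  subst hdr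
  have hnot : B.indicator 1 ∉ matroidPolytope N := fun h =>
    hnb B hBK hBr (isBase_of_indicator_mem hd hBr h)
  rw [hP] at hnot
  simp only [mem_ofPred_eq, not_and] at hnot
  have hviol := hnot (indicator_mem_hypersimplex hBr)
  push Not at hviol
  obtain ⟨p, hp, hlt⟩ := hviol
  -- Exchanging b for e gives a base, which satisfies the violated inequality; so the exchange
  -- lowers the sum, b is inside the interval and e outside. An interval containing i and j cannot
  -- omit e.
  have key : ∀ b ∈ B, ∀ e ∉ K, b ∈ Finset.Icc p.1 p.2.1 ∧ e ∉ Finset.Icc p.1 p.2.1 := by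
    intro b hb e he
    have hmem : (insert e (B \ {b})).indicator (1 : Fin n → ℝ) ∈ matroidPolytope N :=
      subset_convexHull ℝ _ ⟨_, hbase b hb e he, rfl⟩
    rw [hP] at hmem
    have hle := hmem.2 p hp
    have hpt : ∀ l, (insert e (B \ {b})).indicator (1 : Fin n → ℝ) l =
        B.indicator 1 l - (if l = b then 1 else 0) + (if l = e then 1 else 0) := by
      intro l
      have heB : e ∉ B := fun h => he (hBK h)
      by_cases h1 : l = e
      · subst h1
        have : l ≠ b := by rintro rfl; exact heB hb
        simp [heB, this]
      · by_cases h2 : l = b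
        · subst h2; simp [hb, h1]
        · by_cases h3 : l ∈ B <;> simp [h1, h2, h3]
    simp only [hpt, Finset.sum_add_distrib, Finset.sum_sub_distrib, Finset.sum_ite_eq'] at hle
    by_contra hcon
    rw [not_and_or, not_not] at hcon
    rcases hcon with h | h
    · rw [if_neg h] at hle
      split_ifs at hle <;> linarith
    · rw [if_pos h] at hle
      split_ifs at hle <;> linarith
  have h1 := (key i (hijB (Or.inl rfl)) e heK)
  have h2 := (key j (hijB (Or.inr rfl)) e heK).1
  rw [Finset.mem_Icc] at h1 h2
  exact h1.2 (Finset.mem_Icc.2 ⟨h1.1.1.trans he.1, he.2.trans h2.2⟩)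

/-! ### The polytope of a paving matroid -/

/-- The part of the hypersimplex cut out by the dependent hyperplanes of a paving matroid. -/
def pavingPolytope (n d : ℕ) (S : Set (Finset (Fin n))) : Set (Fin n → ℝ) :=
  {x | x ∈ hypersimplex d n ∧ ∀ H ∈ S, ∑ l ∈ H, x l ≤ (d : ℝ) - 1}

theorem convex_hypersimplex (d n : ℕ) : Convex ℝ (hypersimplex d n) := by
  rintro x ⟨hx, hx'⟩ y ⟨hy, hy'⟩ a b ha hb hab
  refine ⟨fun i => ?_, ?_⟩
  · simp only [Pi.add_apply, Pi.smul_apply, smul_eq_mul]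
    have h1 := hx i
    have h2 := hy i
    constructor
    · have := mul_nonneg ha h1.1
      have := mul_nonneg hb h2.1
      linarith
    · have := mul_le_mul_of_nonneg_left h1.2 ha
      have := mul_le_mul_of_nonneg_left h2.2 hb
      linarith
  · simp only [Pi.add_apply, Pi.smul_apply, smul_eq_mul, Finset.sum_add_distrib,
      ← Finset.mul_sum, hx', hy']
    rw [← add_mul, hab, one_mul]

theorem convex_pavingPolytope (n d : ℕ) (S : Set (Finset (Fin n))) :
    Convex ℝ (pavingPolytope n d S) := by
  have : pavingPolytope n d S =
      hypersimplex d n ∩ ⋂ H ∈ S, {x : Fin n → ℝ | ∑ l ∈ H, x l ≤ (d : ℝ) - 1} := by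
    ext x; simp [pavingPolytope]
  rw [this]
  exact (convex_hypersimplex d n).inter (convex_iInter₂ fun H _ => convex_setOf_sum_le H _)

theorem isCompact_pavingPolytope (n d : ℕ) (S : Set (Finset (Fin n))) :
    IsCompact (pavingPolytope n d S) := by
  have hc : IsCompact (univ.pi fun _ : Fin n => Icc (0 : ℝ) 1) :=
    isCompact_univ_pi fun _ => isCompact_Icc
  refine hc.of_isClosed_subset ?_ fun x hx i _ => ⟨(hx.1.1 i).1, (hx.1.1 i).2⟩
  have : pavingPolytope n d S = (((⋂ i, {x : Fin n → ℝ | 0 ≤ x i}) ∩ (⋂ i, {x | x i ≤ 1})) ∩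
      {x | ∑ i, x i = d}) ∩ ⋂ H ∈ S, {x : Fin n → ℝ | ∑ l ∈ H, x l ≤ (d : ℝ) - 1} := by
    ext x; simp [pavingPolytope, hypersimplex, forall_and]
  rw [this]
  refine (((isClosed_iInter fun i => ?_).inter (isClosed_iInter fun i => ?_)).inter ?_).inter
    (isClosed_iInter fun H => isClosed_iInter fun _ => ?_)
  · exact isClosed_le continuous_const (continuous_apply i)
  · exact isClosed_le (continuous_apply i) continuous_const
  · exact isClosed_eq (by fun_prop) continuous_const
  · exact isClosed_le (by fun_prop) continuous_const

/-- A point of the polytope with two fractional coordinates not separated by a tight constraint is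
not extreme. -/
theorem not_mem_extremePoints {d : ℕ} {S : Set (Finset (Fin n))} {x : Fin n → ℝ} {u v : Fin n}
    (huv : u ≠ v) (hu : 0 < x u ∧ x u < 1) (hv : 0 < x v ∧ x v < 1)
    (hsep : ∀ H ∈ S, ∑ l ∈ H, x l = (d : ℝ) - 1 → (u ∈ H ↔ v ∈ H)) :
    x ∉ extremePoints ℝ (pavingPolytope n d S) := by
  classical
  intro hx
  have hxP := hx.1
  rw [mem_extremePoints] at hx
  -- Move x along e_u - e_v in both directions. Tight constraints do not change, and the slack ones
  -- survive for small t.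
  set y : ℝ → Fin n → ℝ := fun t l => x l + t * ((if l = u then 1 else 0) - if l = v then 1 else 0)
    with hy
  have hsum : ∀ (t : ℝ) (H : Finset (Fin n)), ∑ l ∈ H, y t l =
      ∑ l ∈ H, x l + t * ((if u ∈ H then 1 else 0) - if v ∈ H then 1 else 0) := by
    intro t H
    simp only [hy, Finset.sum_add_distrib, ← Finset.mul_sum, Finset.sum_sub_distrib,
      Finset.sum_ite_eq']
  have hev : ∀ᶠ t in nhds (0 : ℝ), y t ∈ pavingPolytope n d S := by
    have hcont : ∀ l, Continuous fun t => y t l := fun l => by simp only [hy]; fun_prop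
    have h0 : ∀ l, y 0 l = x l := fun l => by simp [hy]
    have e1 : ∀ l, ∀ᶠ t in nhds (0 : ℝ), 0 ≤ y t l ∧ y t l ≤ 1 := by
      intro l
      by_cases hl : l = u ∨ l = v
      · have hl' : 0 < x l ∧ x l < 1 := by rcases hl with rfl | rfl <;> assumption
        have h1 : ∀ᶠ t in nhds (0 : ℝ), 0 < y t l :=
          (hcont l).continuousAt.eventually_const_lt (by change 0 < y 0 l; rw [h0]; exact hl'.1)
        have h2 : ∀ᶠ t in nhds (0 : ℝ), y t l < 1 :=
          (hcont l).continuousAt.eventually_lt_const (by change y 0 l < 1; rw [h0]; exact hl'.2)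
        filter_upwards [h1, h2] with t a b using ⟨a.le, b.le⟩
      · rw [not_or] at hl
        refine Filter.Eventually.of_forall fun t => ?_
        have : y t l = x l := by simp [hy, hl.1, hl.2]
        rw [this]
        exact hxP.1.1 l
    have e2 : ∀ H ∈ S, ∀ᶠ t in nhds (0 : ℝ), ∑ l ∈ H, y t l ≤ (d : ℝ) - 1 := by
      intro H hH
      rcases (hxP.2 H hH).lt_or_eq with h | h
      · have hc : Continuous fun t => ∑ l ∈ H, y t l :=
          continuous_finsetSum H fun l _ => hcont l
        have : ∀ᶠ t in nhds (0 : ℝ), ∑ l ∈ H, y t l < (d : ℝ) - 1 :=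
          hc.continuousAt.eventually_lt_const (by simpa [h0] using h)
        filter_upwards [this] with t ht using ht.le
      · refine Filter.Eventually.of_forall fun t => ?_
        rw [hsum]
        have := hsep H hH h
        by_cases hu : u ∈ H
        · simp [hu, this.1 hu, h]
        · have hv' : v ∉ H := fun h => hu (this.2 h)
          simp [hu, hv', h]
    have e2' : ∀ᶠ t in nhds (0 : ℝ), ∀ H ∈ S, ∑ l ∈ H, y t l ≤ (d : ℝ) - 1 :=
      (Filter.eventually_all_finite (toFinite S)).2 e2
    filter_upwards [Filter.eventually_all.2 e1, e2'] with t h1 h2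
    refine ⟨⟨h1, ?_⟩, h2⟩
    rw [hsum]
    simp [hxP.1.2]
  have hev' : ∀ᶠ t in nhds (0 : ℝ), y (-t) ∈ pavingPolytope n d S := by
    have : Filter.Tendsto (fun t : ℝ => -t) (nhds 0) (nhds 0) := by
      simpa using (continuous_neg (G := ℝ)).tendsto 0
    exact this.eventually hev
  obtain ⟨t, ⟨h1, h2⟩, ht⟩ := (((hev.and hev').filter_mono nhdsWithin_le_nhds).and
    (self_mem_nhdsWithin : Ioi (0 : ℝ) ∈ nhdsWithin 0 (Ioi 0))).exists
  have hmem : x ∈ openSegment ℝ (y t) (y (-t)) := by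
    refine ⟨1 / 2, 1 / 2, by norm_num, by norm_num, by norm_num, ?_⟩
    ext l
    simp only [hy, Pi.add_apply, Pi.smul_apply, smul_eq_mul]
    ring
  have h3 := congrFun (hx.2 _ h1 _ h2 hmem).1 u
  simp only [hy, if_true, huv, if_false, sub_zero, mul_one] at h3
  have : (0 : ℝ) < t := ht
  linarith

/-- If a set with integral sum has a fractional coordinate then it has another one. -/
theorem exists_fractional_ne {x : Fin n → ℝ} (hx : ∀ i, 0 ≤ x i ∧ x i ≤ 1) {K : Finset (Fin n)}
    {m : ℤ} (hK : ∑ l ∈ K, x l = m) {u : Fin n} (huK : u ∈ K) (hu : 0 < x u ∧ x u < 1) :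
    ∃ v ∈ K, v ≠ u ∧ 0 < x v ∧ x v < 1 := by
  classical
  by_contra hcon
  push Not at hcon
  have h01 : ∀ l ∈ K.erase u, x l = if x l = 1 then (1 : ℝ) else 0 := by
    intro l hl
    rw [Finset.mem_erase] at hl
    split_ifs with h
    · exact h
    · by_contra h0
      have h1 := hcon l hl.2 hl.1 (lt_of_le_of_ne (hx l).1 (Ne.symm h0))
      exact h (le_antisymm (hx l).2 h1)
  have hsum : ∑ l ∈ K.erase u, x l = (((K.erase u).filter fun l => x l = 1).card : ℝ) := by
    rw [Finset.sum_congr rfl h01, Finset.card_filter]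
    push_cast
    rfl
  rw [← Finset.add_sum_erase K x huK, hsum] at hK
  have h1 : x u = ((m - ((K.erase u).filter fun l => x l = 1).card : ℤ) : ℝ) := by
    push_cast
    linarith
  rw [h1] at hu
  have h2 : (0 : ℤ) < m - ((K.erase u).filter fun l => x l = 1).card := by exact_mod_cast hu.1
  have h3 : m - ((K.erase u).filter fun l => x l = 1).card < (1 : ℤ) := by exact_mod_cast hu.2
  omega

/-- Given a fractional coordinate u, some set with integral sum provides a second one that no tight
constraint separates from u, contradicting extremality. -/
theorem eq_zero_or_one_of_mem_extremePoints {d : ℕ} {S : Set (Finset (Fin n))}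
    (hS : ∀ H ∈ S, ∀ H' ∈ S, H ≠ H' → (H ∩ H').card + 2 ≤ d) {x : Fin n → ℝ}
    (hx : x ∈ extremePoints ℝ (pavingPolytope n d S)) (u : Fin n) : x u = 0 ∨ x u = 1 := by
  classical
  have hxP := hx.1
  obtain ⟨⟨h01, hsum⟩, hle⟩ := hxP
  by_contra hcon
  rw [not_or] at hcon
  have hu : 0 < x u ∧ x u < 1 :=
    ⟨lt_of_le_of_ne (h01 u).1 (Ne.symm hcon.1), lt_of_le_of_ne (h01 u).2 hcon.2⟩
  set T : Set (Finset (Fin n)) := {H ∈ S | ∑ l ∈ H, x l = (d : ℝ) - 1} with hT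
  -- Uncrossing: 2(d - 1) = x(H ∪ H') + x(H ∩ H') ≤ d + (d - 2) is an equality, so coordinates are 1
  -- on H ∩ H' and 0 off H ∪ H'.
  have pair : ∀ H ∈ T, ∀ H' ∈ T, H ≠ H' → ∀ w, 0 < x w → x w < 1 → (w ∈ H ↔ w ∉ H') := by
    rintro H ⟨hH, hHs⟩ H' ⟨hH', hHs'⟩ hne w hw0 hw1
    have hc : (((H ∩ H').card : ℕ) : ℝ) + 2 ≤ d := by exact_mod_cast hS H hH H' hH' hne
    have hadd := Finset.sum_union_inter (s₁ := H) (s₂ := H') (f := x)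
    have hcard : ∑ l ∈ H ∩ H', (1 - x l) = (H ∩ H').card - ∑ l ∈ H ∩ H', x l := by
      simp [Finset.sum_sub_distrib]
    have hcompl : ∑ l ∈ (H ∪ H')ᶜ, x l = d - ∑ l ∈ H ∪ H', x l := by
      rw [← hsum, ← Finset.sum_add_sum_compl (H ∪ H') x]
      ring
    have p1 : ∀ l ∈ H ∩ H', 0 ≤ 1 - x l := fun l _ => by have := (h01 l).2; linarith
    have p2 : ∀ l ∈ (H ∪ H')ᶜ, 0 ≤ x l := fun l _ => (h01 l).1
    have n1 := Finset.sum_nonneg p1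
    have n2 := Finset.sum_nonneg p2
    constructor
    · intro h1 h2
      have := Finset.single_le_sum p1 (Finset.mem_inter.2 ⟨h1, h2⟩)
      linarith
    · intro h1
      by_contra h2
      have := Finset.single_le_sum p2 (a := w) (by simp [h1, h2])
      linarith
  have done : ∀ (K : Finset (Fin n)) (m : ℤ), ∑ l ∈ K, x l = m → u ∈ K →
      ¬ ∀ v ∈ K, 0 < x v → x v < 1 → ∀ H ∈ T, u ∈ H ↔ v ∈ H := by
    intro K m hK huK hall
    obtain ⟨v, hvK, hvu, hv⟩ := exists_fractional_ne h01 hK huK hu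
    exact not_mem_extremePoints hvu.symm hu hv
      (fun H hH hHs => hall v hvK hv.1 hv.2 H ⟨hH, hHs⟩) hx
  -- The set with integral sum is a tight H containing u (sum d - 1), everything if nothing is tight
  -- (sum d), or the complement of a tight H missing u (sum 1). In the last case H is the only tight
  -- set, as any other would contain u by `pair`.
  by_cases hex : ∃ H ∈ T, u ∈ H
  · obtain ⟨H, hH, huH⟩ := hex
    refine done H ((d : ℤ) - 1) (by rw [hH.2]; push_cast; rfl) huH fun v hv hv0 hv1 H' hH' => ?_
    by_cases hne : H = H'
    · subst hne; exact ⟨fun _ => hv, fun _ => huH⟩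
    · have h1 := (pair H hH H' hH' hne u hu.1 hu.2).1 huH
      have h2 := (pair H hH H' hH' hne v hv0 hv1).1 hv
      exact ⟨fun h => (h1 h).elim, fun h => (h2 h).elim⟩
  · push Not at hex
    rcases T.eq_empty_or_nonempty with hT0 | ⟨H, hH⟩
    · exact done Finset.univ d (by rw [hsum]; simp) (Finset.mem_univ u)
        fun v _ _ _ H hH => by rw [hT0] at hH; exact hH.elim
    · refine done Hᶜ 1 ?_ (by simpa using hex H hH) fun v hv _ _ H' hH' => ?_
      · have := Finset.sum_add_sum_compl H x
        rw [hsum, hH.2] at this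
        push_cast
        linarith
      · by_cases hne : H = H'
        · subst hne
          simp only [Finset.mem_compl] at hv
          exact ⟨fun h => (hex _ hH h).elim, fun h => (hv h).elim⟩
        · exact (hex H' hH' (by
            by_contra h
            exact hex H hH ((pair H hH H' hH' hne u hu.1 hu.2).2 h))).elim

/-- By Krein–Milman it suffices to look at extreme points; these are 0/1 vectors of d-sets contained
in no H, that is, of bases. -/
theorem matroidPolytope_eq_pavingPolytope {N : Matroid (Fin n)} {d : ℕ}
    (hd : N.eRank = d) {S : Set (Finset (Fin n))}
    (hS : ∀ H ∈ S, ∀ H' ∈ S, H ≠ H' → (H ∩ H').card + 2 ≤ d)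
    (hbase : ∀ B : Set (Fin n), B.ncard = d → (N.IsBase B ↔ ∀ H ∈ S, ¬ B ⊆ H)) :
    matroidPolytope N = pavingPolytope n d S := by
  classical
  apply Subset.antisymm
  · refine convexHull_min ?_ (convex_pavingPolytope n d S)
    rintro _ ⟨B, hB, rfl⟩
    have hBd := ncard_of_isBase hd hB
    refine ⟨indicator_mem_hypersimplex hBd, fun H hH => ?_⟩
    rw [sum_indicator_eq_card]
    have h1 := (hbase B hBd).1 hB H hH
    have h2 : (B ∩ H).ncard < B.ncard := ncard_lt_ncard (inter_ssubset_left_iff.2 h1)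
    have : (((B ∩ H).ncard : ℕ) : ℝ) + 1 ≤ d := by exact_mod_cast hBd ▸ h2
    linarith
  · set V : Set (Fin n → ℝ) := {x | ∃ B, N.IsBase B ∧ x = B.indicator 1} with hV
    have hVfin : V.Finite :=
      (toFinite {B | N.IsBase B}).image (fun B => B.indicator 1) |>.subset (by
      rintro _ ⟨B, hB, rfl⟩; exact ⟨B, hB, rfl⟩)
    have hext : extremePoints ℝ (pavingPolytope n d S) ⊆ V := by
      intro x hx
      have h01 := eq_zero_or_one_of_mem_extremePoints hS hx
      have hxB : x = {i | x i = 1}.indicator 1 := by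
        ext i
        rcases h01 i with h | h <;> simp [h]
      have hBd : {i | x i = 1}.ncard = d := by
        have h1 := hx.1.1.2
        rw [hxB, sum_indicator_eq_card] at h1
        simpa using h1
      refine ⟨{i | x i = 1}, (hbase _ hBd).2 fun H hH hsub => ?_, hxB⟩
      have h1 := hx.1.2 H hH
      rw [hxB, sum_indicator_eq_card, inter_eq_left.2 hsub, hBd] at h1
      linarith
    calc pavingPolytope n d S
        = closure (convexHull ℝ (extremePoints ℝ (pavingPolytope n d S))) :=
          (closure_convexHull_extremePoints (isCompact_pavingPolytope n d S)
            (convex_pavingPolytope n d S)).symm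
      _ ⊆ closure (convexHull ℝ V) := closure_mono (convexHull_mono hext)
      _ = convexHull ℝ V := (hVfin.isClosed_convexHull ℝ).closure_eq

end Polytope

/-! ### Paving interval positroids and their excluded minors -/

section PavingPositroids

variable {α : Type*} {M : Matroid α} {d : ℕ}

theorem IsIntervalPositroid.exists_order (h : IsIntervalPositroid M) :
    ∃ (n : ℕ) (f : Fin n → α), Function.Injective f ∧
      ∀ (r : ℕ) (A : Set α), 2 ≤ r → A ⊆ M.E → r ≤ A.ncard →
        (∀ B ⊆ A, B.ncard = r → ¬ M.IsBase B) →
        (∀ I ⊆ A, I.ncard + 1 = r → ∀ e ∈ M.E, e ∉ A → M.IsBase (insert e I)) →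
        ∃ i j : Fin n, i ≤ j ∧ A = f '' Icc i j := by
  obtain ⟨n, N, f, hN, rfl⟩ := h
  refine ⟨n, f, f.injective, fun r A hr hA hrA hnb hins => ?_⟩
  have hbase : ∀ B : Set (Fin n), (N.mapEmbedding f).IsBase (f '' B) ↔ N.IsBase B := fun B => by
    rw [Matroid.mapEmbedding_isBase_iff, preimage_image_eq _ f.injective]
    exact and_iff_left (image_subset_range f B)
  rw [Matroid.mapEmbedding_ground_eq, hN.1, image_univ] at hA
  obtain ⟨K, rfl⟩ := subset_range_iff_exists_image_eq.1 hA
  have hcard : ∀ B : Set (Fin n), (f '' B).ncard = B.ncard := fun B =>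
    ncard_image_of_injective B f.injective
  obtain ⟨i, j, hij, hK⟩ := hN.exists_eq_Icc hr (K := K) (by rwa [hcard] at hrA)
    (fun B hB hBr hBb => hnb (f '' B) (image_mono hB) (by rw [hcard, hBr]) ((hbase B).2 hBb))
    (fun I hI hIr e he => by
      have := hins (f '' I) (image_mono hI) (by rw [hcard, hIr]) (f e)
        (by rw [Matroid.mapEmbedding_ground_eq, hN.1]; exact mem_image_of_mem f (mem_univ e))
        (fun h => he ((f.injective.mem_set_image).1 h))
      rwa [← image_insert_eq, hbase] at this)
  exact ⟨i, j, hij, by rw [hK]⟩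

/-- The sets that behave in an interval positroid like the dependent hyperplanes of a paving
matroid can be ordered. -/
theorem IsIntervalPositroid.orderable {ι : Type*} {F : Set ι} {Q : ι → Set α} {r : ℕ}
    (h : IsIntervalPositroid M) (hr : 2 ≤ r) (hsub : ∀ A ∈ F, Q A ⊆ M.E)
    (hcard : ∀ A ∈ F, r ≤ (Q A).ncard)
    (hnb : ∀ A ∈ F, ∀ B ⊆ Q A, B.ncard = r → ¬ M.IsBase B)
    (hins : ∀ A ∈ F, ∀ I ⊆ Q A, I.ncard + 1 = r → ∀ e ∈ M.E, e ∉ Q A → M.IsBase (insert e I))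
    (hS : ∀ A ∈ F, ∀ B ∈ F, Q A ⊆ Q B → A = B) : Orderable F Q := by
  obtain ⟨n, f, hf, h⟩ := h.exists_order
  exact orderable_of_intervals hf
    (fun A hA => h r (Q A) hr (hsub A hA) (hcard A hA) (hnb A hA) (hins A hA)) hS

theorem isBase_iff_of_isPaving [M.Finite] (hM : IsPaving M) (hd : M.eRank = d) (hdpos : 1 ≤ d)
    {B : Set α} (hB : B ⊆ M.E) (hBd : B.ncard = d) :
    M.IsBase B ↔ ∀ H, IsDepHyperplane M H → ¬ B ⊆ H := by
  have hBfin := M.ground_finite.subset hB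
  have hBe : B.encard = d := by rw [← hBfin.cast_ncard_eq, hBd]
  constructor
  · exact fun h H hH hBH => hH.not_indep hd hBH hBe h.indep
  · intro h
    have hind : M.Indep B := by
      by_contra hcon
      obtain ⟨H, hH, hBH⟩ := exists_isDepHyperplane hM hd hdpos hB hBe hcon
      exact h H hH hBH
    exact hind.isBase_of_eRk_ge hBfin (by rw [hind.eRk_eq_encard, hBe, hd])

/-- A paving matroid whose clutter is an interval hypergraph is an interval positroid. -/
theorem isIntervalPositroid_of_isIntervalHypergraph [M.Finite] (hM : IsPaving M)
    (hd : M.eRank = d) (h2 : 2 ≤ d) (h : IsIntervalHypergraph (clutter M)) :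
    IsIntervalPositroid M := by
  classical
  obtain ⟨n, f, hf, hint⟩ := h
  have hrange : range f = M.E := by rw [← image_univ]; exact hf.image_eq
  have hinj : Function.Injective f := injOn_univ.1 hf.injOn
  set g : Fin n ↪ α := ⟨f, hinj⟩ with hg
  set N := M.comap f with hN
  have hNM : N.mapEmbedding g = M := Matroid.map_comap hrange.ge hinj.injOn
  have hNE : N.E = univ := by
    rw [hN, Matroid.comap_ground_eq, ← hrange, preimage_range]
  have hNr : N.eRank = d := by
    rw [← hd, ← hNM]
    exact (Matroid.eRank_map N g.injective.injOn).symm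
  have hbase : ∀ B : Set (Fin n), M.IsBase (f '' B) ↔ N.IsBase B := fun B => by
    have := Matroid.mapEmbedding_isBase_iff (M := N) (f := g) (B := f '' B)
    rw [hNM] at this
    rw [this]
    change N.IsBase (f ⁻¹' (f '' B)) ∧ f '' B ⊆ range f ↔ _
    rw [preimage_image_eq _ hinj]
    exact and_iff_left (image_subset_range f B)
  have hsubE : ∀ B : Set (Fin n), f '' B ⊆ M.E := fun B => hrange ▸ image_subset_range f B
  set S : Set (Finset (Fin n)) := {H | IsDepHyperplane M (f '' (H : Set (Fin n)))} with hS
  have hSpair : S.Pairwise fun H H' => (H ∩ H').card + 2 ≤ d := by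
    intro H hH H' hH' hne
    have := IsDepHyperplane.inter_ncard hM hH hH' hd h2 fun h =>
      hne (Finset.coe_injective (hinj.image_injective h))
    rwa [← image_inter hinj, ncard_image_of_injective _ hinj, ← Finset.coe_inter,
      ncard_coe_finset] at this
  have hpoly := matroidPolytope_eq_pavingPolytope hNr (S := S) hSpair fun B hB => by
    rw [← hbase, isBase_iff_of_isPaving hM hd (by omega) (hsubE B)
      (by rw [ncard_image_of_injective _ hinj, hB])]
    constructor
    · exact fun h H hH hBH => h _ hH (image_mono hBH)
    · intro h H hH hBH
      have hHE : H ⊆ range f := hrange ▸ hH.2.subset_ground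
      obtain ⟨K, rfl⟩ := subset_range_iff_exists_image_eq.1 hHE
      refine h K.toFinset ?_ ?_
      · rw [hS, mem_ofPred_eq, coe_toFinset]; exact hH
      · rw [coe_toFinset]; exact (image_subset_image_iff hinj).1 hBH
  -- Under f every dependent hyperplane is an interval, so the constraints x(H) ≤ d - 1 are interval
  -- inequalities.
  refine ⟨n, N, g, ⟨hNE, d, {p | p.1 ≤ p.2.1 ∧ IsDepHyperplane M (f '' Icc p.1 p.2.1) ∧
    p.2.2 = (d : ℝ) - 1}, hNr, fun p hp => hp.1, ?_⟩, hNM⟩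
  rw [hpoly]
  ext x
  constructor
  · rintro ⟨hx, hxS⟩
    refine ⟨hx, ?_⟩
    rintro ⟨i, j, c⟩ ⟨-, hH, hc⟩
    simp only at hc hH ⊢
    rw [hc]
    refine hxS _ ?_
    rw [hS, mem_ofPred_eq, Finset.coe_Icc]
    exact hH
  · rintro ⟨hx, hxS⟩
    refine ⟨hx, fun H hH => ?_⟩
    obtain ⟨i, j, hij, hHij⟩ := hint _ hH
    have hHI : H = Finset.Icc i j := by
      apply Finset.coe_injective
      rw [Finset.coe_Icc]
      exact hinj.image_injective hHij
    have hH' : IsDepHyperplane M (f '' Icc i j) := hHij ▸ hH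
    rw [hHI]
    exact hxS (i, j, (d : ℝ) - 1) ⟨hij, hH', rfl⟩

theorem IsDepHyperplane.le_ncard [M.Finite] {H : Set α} (hM : IsPaving M)
    (hH : IsDepHyperplane M H) (hd : M.eRank = d) : d ≤ H.ncard := by
  have := hH.le_encard hM hd
  rw [← (M.ground_finite.subset hH.2.subset_ground).cast_ncard_eq] at this
  exact_mod_cast this

theorem IsDepHyperplane.eq_of_subset [M.Finite] {H H' : Set α} (hM : IsPaving M)
    (hH : IsDepHyperplane M H) (hH' : IsDepHyperplane M H') (hd : M.eRank = d) (h2 : 2 ≤ d)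
    (h : H ⊆ H') : H = H' := by
  by_contra hne
  have h1 := hH.inter_ncard hM hH' hd h2 hne
  have h3 := hH.le_ncard hM hd
  rw [inter_eq_left.2 h] at h1
  omega

theorem isStrictMinor_of_isMinor_of_notMem {N : Matroid α} (h : N ≤m M) {v : α} (hv : v ∈ M.E)
    (hvN : v ∉ N.E) : N <m M :=
  ⟨h, fun h' => hvN (h'.subset hv)⟩

/-- For v in the ground set, the sets H \ {v} with v ∈ H behave like dependent hyperplanes in M / v,
of rank d - 1; this rank is at least 2 because d ≥ 3. -/
theorem orderable_link [M.Finite] (hM : IsPaving M) (hd : M.eRank = d) (h3 : 3 ≤ d)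
    (hex : IsExcludedMinor IsIntervalPositroid M) (v : α) :
    Orderable {H | IsDepHyperplane M H ∧ v ∈ H} (fun H => H \ {v}) := by
  by_cases hv : v ∈ M.E
  swap
  · have : {H | IsDepHyperplane M H ∧ v ∈ H} = ∅ :=
      eq_empty_of_forall_notMem fun H hH => hv (hH.1.2.subset_ground hH.2)
    rw [this]
    exact orderable_of_intervals (n := 0) (f := Fin.elim0) (fun i => i.elim0)
      (fun _ h => h.elim) (fun _ h => h.elim)
  have hvi : M.Indep {v} := hM.indep_of_encard_lt hd (singleton_subset_iff.2 hv) (by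
    rw [encard_singleton]; exact_mod_cast (by omega : 1 < d))
  have hpos : IsIntervalPositroid (M.contract {v}) :=
    hex.2 _ (isStrictMinor_of_isMinor_of_notMem ⟨{v}, ∅, (Matroid.delete_empty _).symm⟩ hv
      fun h => h.2 rfl)
  refine hpos.orderable (r := d - 1) (by omega) ?_ ?_ ?_ ?_ ?_
  · exact fun H hH => sdiff_subset_sdiff_left hH.1.2.subset_ground
  · intro H hH
    have := hH.1.le_ncard hM hd
    have := ncard_sdiff_singleton_add_one hH.2 (M.ground_finite.subset hH.1.2.subset_ground)
    omega
  · intro H hH B hB hBr hBb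
    rw [hvi.contract_isBase_iff] at hBb
    have hBH : B ∪ {v} ⊆ H := union_subset (hB.trans sdiff_subset) (singleton_subset_iff.2 hH.2)
    have hfin := M.ground_finite.subset (hBH.trans hH.1.2.subset_ground)
    refine hH.1.not_indep hd hBH ?_ hBb.1.indep
    rw [← hfin.cast_ncard_eq, union_singleton, ncard_insert_of_notMem (fun h => (hB h).2 rfl)
      (hfin.subset subset_union_left), hBr]
    exact_mod_cast (by omega : d - 1 + 1 = d)
  · intro H hH I hI hIr e he heH
    rw [hvi.contract_isBase_iff, union_singleton, insert_comm, disjoint_singleton_right]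
    have hIfin := M.ground_finite.subset (hI.trans (sdiff_subset.trans hH.1.2.subset_ground))
    have hvI : v ∉ I := fun h => (hI h).2 rfl
    have hev : e ≠ v := he.2
    refine ⟨hH.1.isBase_insert hM hd (insert_subset hH.2 (hI.trans sdiff_subset)) ?_ he.1
      fun h => heH ⟨h, hev⟩, ?_⟩
    · rw [encard_insert_of_notMem hvI, ← hIfin.cast_ncard_eq]
      exact_mod_cast (by omega : I.ncard + 1 + 1 = d)
    · rintro (h | h)
      exacts [hev h.symm, hvI h]
  · intro H hH H' hH' hsub
    refine hH.1.eq_of_subset hM hH'.1 hd (by omega) fun x hx => ?_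
    by_cases hxv : x = v
    · exact hxv ▸ hH'.2
    · exact (hsub ⟨hx, hxv⟩).1

/-- In M \ v the rank parameter stays d, so only the H that keep at least d points count. -/
theorem orderable_del [M.Finite] (hM : IsPaving M) (hd : M.eRank = d) (h2 : 2 ≤ d)
    (hex : IsExcludedMinor IsIntervalPositroid M) {v : α} (hv : v ∈ M.E) :
    Orderable {H | IsDepHyperplane M H ∧ d ≤ (H \ {v}).ncard} (fun H => H \ {v}) := by
  have hpos : IsIntervalPositroid (M.delete {v}) :=
    hex.2 _ (isStrictMinor_of_isMinor_of_notMem ⟨∅, {v}, by rw [Matroid.contract_empty]⟩ hv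
      fun h => h.2 rfl)
  refine hpos.orderable (r := d) h2 ?_ (fun H hH => hH.2) ?_ ?_ ?_
  · exact fun H hH => sdiff_subset_sdiff_left hH.1.2.subset_ground
  · intro H hH B hB hBr hBb
    have hBH : B ⊆ H := hB.trans sdiff_subset
    have hfin := M.ground_finite.subset (hBH.trans hH.1.2.subset_ground)
    refine hH.1.not_indep hd hBH ?_ hBb.indep.of_delete
    rw [← hfin.cast_ncard_eq, hBr]
  · intro H hH I hI hIr e he heH
    have hIfin := M.ground_finite.subset (hI.trans (sdiff_subset.trans hH.1.2.subset_ground))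
    have hev : e ≠ v := he.2
    have hb : M.IsBase (insert e I) := by
      refine hH.1.isBase_insert hM hd (hI.trans sdiff_subset) ?_ he.1 fun h => heH ⟨h, hev⟩
      rw [← hIfin.cast_ncard_eq]
      exact_mod_cast hIr
    rw [Matroid.delete_isBase_iff]
    refine hb.isBasis_of_subset sdiff_subset (insert_subset he ?_)
    exact hI.trans (sdiff_subset_sdiff_left hH.1.2.subset_ground)
  · intro H hH H' hH' hsub
    by_contra hne
    have h1 := hH.1.inter_ncard hM hH'.1 hd h2 hne
    have h3 := ncard_le_ncard (subset_inter (sdiff_subset (s := H) (t := {v}))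
      (hsub.trans sdiff_subset)) ((M.ground_finite.subset hH.1.2.subset_ground).inter_of_left H')
    have := hH.2
    omega

theorem isIntervalHypergraph_clutter_iff_orderable [M.Finite] (hM : IsPaving M)
    (hd : M.eRank = d) (h2 : 2 ≤ d) :
    IsIntervalHypergraph (clutter M) ↔ Orderable (clutter M).edgeSet id := by
  constructor
  · rintro ⟨n, f, hf, hint⟩
    exact orderable_of_intervals (injOn_univ.1 hf.injOn) hint
      fun A hA B hB hAB => IsDepHyperplane.eq_of_subset hM hA hB hd h2 hAB
  · refine isIntervalHypergraph_of_orderable M.ground_finite fun H hH => ?_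
    have := IsDepHyperplane.le_ncard hM hH hd
    exact nonempty_of_ncard_ne_zero (by omega)

/-- The dependent hyperplanes of a paving excluded minor of interval positroids contain an
obstruction. -/
theorem exists_isObstruction [M.Finite] (hM : IsPaving M) (hd : M.eRank = d) (h3 : 3 ≤ d)
    (hex : IsExcludedMinor IsIntervalPositroid M) :
    ∃ F ⊆ (clutter M).edgeSet, IsObstruction d M.E F := by
  have hfin : (clutter M).edgeSet.Finite := M.ground_finite.finite_subsets.subset
    fun H hH => hH.2.subset_ground
  have hno : ¬ Orderable (clutter M).edgeSet id := fun h => hex.1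
    (isIntervalPositroid_of_isIntervalHypergraph hM hd (by omega)
      ((isIntervalHypergraph_clutter_iff_orderable hM hd (by omega)).2 h))
  obtain ⟨F, hF⟩ := (hfin.finite_subsets.subset (t := {F | F ⊆ (clutter M).edgeSet ∧
    ¬ Orderable F id}) fun F hF => hF.1).exists_minimal ⟨_, subset_rfl, hno⟩
  have hdep : ∀ H ∈ F, IsDepHyperplane M H := fun H hH => hF.prop.1 hH
  refine ⟨F, hF.prop.1, ?_⟩
  exact
    { three_le := h3
      finite := hfin.subset hF.prop.1
      finite_mem := fun A hA => M.ground_finite.subset (hdep A hA).2.subset_ground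
      le_ncard := fun A hA => (hdep A hA).le_ncard hM hd
      inter := fun A hA B hB hne => (hdep A hA).inter_ncard hM (hdep B hB) hd (by omega) hne
      link := fun v => (orderable_link hM hd h3 hex v).mono fun H hH => ⟨hdep H hH.1, hH.2⟩
      subset_ground := fun A hA => (hdep A hA).2.subset_ground
      del := fun v hv => (orderable_del hM hd (by omega) hex hv).mono
        fun H hH => ⟨hdep H hH.1, hH.2⟩
      not_orderable := hF.prop.2
      minimal := fun H hH => by
        by_contra hcon
        have := hF.le_of_le ⟨sdiff_subset.trans hF.prop.1, hcon⟩ sdiff_subset hH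
        exact this.2 rfl }

end PavingPositroids

end PavingIP

/-- Excluded minors of interval positroids that are paving relax to a non-interval clutter of one of
the three types. -/
theorem mainTheorem1 {α : Type*} (M : Matroid α) [M.Finite] (d : ℕ) (hd : 3 ≤ d)
    (hrank : M.eRank = d) (hpaving : PavingIP.IsPaving M)
    (hexcl : PavingIP.IsExcludedMinor PavingIP.IsIntervalPositroid M) :
    ∃ N : Matroid α, PavingIP.IsRelaxation N M ∧
      ¬ PavingIP.IsIntervalHypergraph (PavingIP.clutter N) ∧
      ((∃ (m : ℕ) (a : ZMod m → ℕ), PavingIP.IsO m a d (PavingIP.clutter N)) ∨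
       (∃ a b : ℕ, PavingIP.IsY a b d (PavingIP.clutter N)) ∨
       (∃ a b c : ℕ, PavingIP.IsSh a b c d (PavingIP.clutter N))) := by
  have hd2 : 2 ≤ d := by omega
  obtain ⟨F, hFM, hF⟩ := PavingIP.exists_isObstruction hpaving hrank hd hexcl
  set N := PavingIP.pavingMatroid M.ground_finite hd2 hF.subset_ground hF.inter with hN
  have hNfin : N.Finite := ⟨M.ground_finite⟩
  -- A base of M lies in no dependent hyperplane, so it stays independent in N and fixes the rank.
  obtain ⟨B, hB⟩ := M.exists_isBase
  have hBe : B.encard = d := hB.encard_eq_eRank.trans hrank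
  have hr : N.eRank = d := PavingIP.pavingMatroid_eRank M.ground_finite hd2 hF.subset_ground
    hF.inter hB.subset_ground (by rw [Set.ncard, hBe]; rfl)
    fun H hH hBH => PavingIP.IsDepHyperplane.not_indep (hFM hH) hrank hBH hBe hB.indep
  have hpav : PavingIP.IsPaving N := PavingIP.pavingMatroid_isPaving _ _ _ _ hr
  have hcl : (PavingIP.clutter N).edgeSet = F :=
    PavingIP.pavingMatroid_clutter _ _ _ _ hr hF.le_ncard
  refine ⟨N, ⟨hpav, hr.trans hrank.symm, rfl, hcl.trans_subset hFM⟩, ?_,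
    hF.trichotomy rfl hcl ⟨N, hNfin, hpav, hr, rfl⟩⟩
  rw [PavingIP.isIntervalHypergraph_clutter_iff_orderable hpav hr hd2, hcl]
  exact hF.not_orderable
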